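/- **Setting.** Let $\Gamma$ be a plumbing graph with finite totally ordered vertex set $\mathcal J$ (a simple graph, possibly with cycles or disconnected, all genera zero) with integer decorations $e_j$, and let $L=\mathbb Z\langle E_j\rangle_{j\in\mathcal J}$ carry the form $(E_j,E_j)=e_j$ and, for $i\ne j$, $(E_i,E_j)=1$ if $i,j$ are adjacent and $0$ otherwise. Assume the form is non-degenerate. Let $L'=\{l'\in L\otimes\mathbb Q:(l',L)\subset\mathbb Z\}$, with basis $E_j^*$ given by $(E_j^*,E_i)=-\delta_{ij}$, and $\mathrm{Char}=\{k\in L':-\tfrac12(k+l,l)\in\mathbb Z\ \forall l\in L\}$, with classes $[k]=k+2L$. Put $w(k)=-(k^2+|\mathcal J|)/8$; a $q$-cube is a pair $(k,I)$ with $k\in\mathrm{Char}$, $I\subset\mathcal J$, $|I|=q$, and $w(k,I)=\max_{I'\subset I}w(k+2\sum_{j\in I'}E_j)$. Let $\mathcal T_0^+=\mathbb Z[U,U^{-1}]/U\mathbb Z[U]$, let $\mathcal F^q(\Gamma)$ be the $\mathbb Z[U]$-module of finitely supported $\mathcal T_0^+$-valued functions on $q$-cubes, and for $I=\{j_1<\dots<j_{q+1}\}$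 let $$(\delta\phi)(k,I)=\sum_{l}(-1)^l\Big(U^{w(k,I)-w(k,I\setminus j_l)}\phi(k,I\setminus j_l)-U^{w(k,I)-w(k+2E_{j_l},I\setminus j_l)}\phi(k+2E_{j_l},I\setminus j_l)\Big).$$ Then $\mathbb H^q(\Gamma)=H^q(\mathcal F^*(\Gamma),\delta)$ is the lattice cohomology. If $\Gamma$ is negative definite, $\mathbb T(\Gamma)\subset\mathbb H^0(\Gamma)$ is the image of $\bigoplus_{[k]\in \mathrm{Char}/2L}\mathcal T_0^+\to\mathbb H^0(\Gamma)$, $(x_{[k]})\mapsto\big(k\mapsto U^{\,w(k)-\min_{[k]}w}\,x_{[k]}\big)$. Fix a vertex $j_0$. Let $\Gamma\setminus j_0$ be obtained by deleting $j_0$ with its edges, $\Gamma_{j_0}^+$ by replacing $e_{j_0}$ by $e_{j_0}+1$, and $\Gamma^b$ by attaching to $j_0$, by one edge, a new vertex with decoration $-1$. For each class $[k]$ of $\Gamma\setminus j_0$ fix a representative $r_{[k]}\in[k]$. Define $$(\overline B^q\phi)\Big(\sum_{j\ne j_0}a_jE_j^*,I\Big)=\sum_{a\equiv e_{j_0}(2)}(-1)^{n(k,a)/2}\,\phi\Big(\sum_{j\ne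 j_0}a_jE_j^*+aE_{j_0}^*,I\Big),$$ where $k=\sum_{j\neq j_0} a_jE_j^*$, $n(k,a)=(k-r_{[k]},R(E_{j_0}))+a+e_{j_0}$ and $R(E_{j_0})=-\sum_{j\text{ adjacent to }j_0}E_j^*$ in $L'(\Gamma\setminus j_0)$; and $$(A^q\phi)\Big(\sum_j a_jE_j^*,I\Big)=\sum_{a\ \mathrm{odd}}U^{\,w_{\Gamma^b}(k^b_a,I)-w_{\Gamma_{j_0}^+}(k_a,I)}\,\phi(k_a,I),\qquad k^b_a=\sum_j a_jE_{j,\Gamma^b}^*+aE_{new}^*,\quad k_a=\sum_j a_jE_{j,\Gamma_{j_0}^+}^*+aE_{j_0,\Gamma_{j_0}^+}^*.$$ **Theorem.** Assume that $\Gamma_{j_0}^+$ is negative definite (then so are $\Gamma$ and $\Gamma\setminus j_0$). Then $$0\to\mathcal F^*(\Gamma_{j_0}^+)\xrightarrow{A^*}\mathcal F^*(\Gamma)\xrightarrow{\overline B^*}\mathcal F^*(\Gamma\setminus j_0)\to0$$ is a short exact sequence of complexes of $\mathbb Z[U]$-modules, and in its long exact cohomology sequence $$0\to\mathbb H^0(\Gamma_{j_0}^+)\xrightarrow{\mathbb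 A^0}\mathbb H^0(\Gamma)\xrightarrow{\overline{\mathbb B}^0}\mathbb H^0(\Gamma\setminus j_0)\xrightarrow{\mathbb C^0}\mathbb H^1(\Gamma_{j_0}^+)\to\cdots$$ one has $\mathbb T(\Gamma\setminus j_0)\subset\operatorname{im}\overline{\mathbb B}^0$; equivalently, the restriction of $\mathbb C^0$ to $\mathbb T(\Gamma\setminus j_0)$ is zero. -/

import Mathlib

open Polynomial CategoryTheory

noncomputable section

/-- A plumbing graph with vertex set `J` (all genera zero): a simple graph, possibly with cycles and
possibly disconnected, together with an integer decoration `e j` of every vertex. -/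
structure PlumbingGraph (J : Type*) where
  graph : SimpleGraph J
  e : J → ℤ

namespace LatticeCohomology

/-! ### The module `𝒯₀⁺` -/

/-- The `ℤ[U]`-module `𝒯₀⁺ = ℤ[U, U⁻¹] / U ℤ[U]`; the variable `X` of `ℤ[X]` plays the role of `U`. -/
abbrev TPlus : Type :=
  LaurentPolynomial ℤ ⧸ Submodule.span ℤ[X] {(LaurentPolynomial.T 1 : LaurentPolynomial ℤ)}

/-- `U ^ x` for a rational exponent `x`. It is only used when `x` is a non-negative integer. -/
def uPow (x : ℚ) : ℤ[X] := X ^ ⌊x⌋₊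

lemma TPlus.exists_pow_smul_eq_zero (x : TPlus) : ∃ n : ℕ, (X ^ n : ℤ[X]) • x = 0 := by
  obtain ⟨f, rfl⟩ := Submodule.Quotient.mk_surjective _ x
  obtain ⟨n, g, hg⟩ := LaurentPolynomial.exists_T_pow f
  refine ⟨n + 1, ?_⟩
  rw [← Submodule.Quotient.mk_smul, Submodule.Quotient.mk_eq_zero, Submodule.mem_span_singleton]
  refine ⟨g, ?_⟩
  rw [Algebra.smul_def, Algebra.smul_def, LaurentPolynomial.algebraMap_eq_toLaurent,
    LaurentPolynomial.algebraMap_eq_toLaurent, hg, Polynomial.toLaurent_X_pow, mul_assoc,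
    ← LaurentPolynomial.T_add, mul_comm]
  push_cast
  rfl

lemma pow_smul_eq_zero_of_le {x : TPlus} {m n : ℕ} (h : (X ^ m : ℤ[X]) • x = 0) (hmn : m ≤ n) :
    (X ^ n : ℤ[X]) • x = 0 := by
  obtain ⟨d, rfl⟩ := Nat.exists_eq_add_of_le hmn
  rw [add_comm, pow_add, mul_smul, h, smul_zero]

lemma uPow_mul {x y : ℚ} (hx : 0 ≤ x) (hy : 0 ≤ y) (hx' : ∃ n : ℤ, x = n) (hy' : ∃ n : ℤ, y = n) :
    uPow x * uPow y = uPow (x + y) := by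
  obtain ⟨m, rfl⟩ := hx'
  obtain ⟨n, rfl⟩ := hy'
  lift m to ℕ using by exact_mod_cast hx
  lift n to ℕ using by exact_mod_cast hy
  have : (((m : ℤ) : ℚ) + ((n : ℤ) : ℚ)) = ((m + n : ℕ) : ℚ) := by push_cast; rfl
  rw [uPow, uPow, uPow, this, Int.cast_natCast, Int.cast_natCast, Nat.floor_natCast,
    Nat.floor_natCast, Nat.floor_natCast, pow_add]

end LatticeCohomology

namespace PlumbingGraph

open LatticeCohomology

variable {J : Type*} [Fintype J] [LinearOrder J] (Γ : PlumbingGraph J)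

/-! ### The lattice `L = ℤ⟨E_j⟩`, the dual lattice `L'` and characteristic elements -/

open Classical in
/-- The intersection matrix `(E_i, E_j)`. An element `l = ∑ l_j E_j` of `L` is represented by
`l : J → ℤ`. -/
def mat : Matrix J J ℤ :=
  Matrix.of fun i j => if i = j then Γ.e i else if Γ.graph.Adj i j then 1 else 0

/-- The intersection matrix over `ℚ`. -/
def matQ : Matrix J J ℚ := Γ.mat.map (fun n : ℤ => (n : ℚ))

/-- The intersection form is non-degenerate. -/
def Nondegenerate : Prop := Γ.matQ.det ≠ 0

/-- The intersection form (on `L ⊗ ℚ`) is negative definite. -/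
def NegDef : Prop := ∀ x : J → ℚ, x ≠ 0 → x ⬝ᵥ (Γ.matQ.mulVec x) < 0

/-- An element `∑ a_j E_j^*` of the dual lattice `L'` is represented by its coordinates
`a : J → ℤ`, where `(E_j^*, E_i) = -δ_{ij}`. Since `E_j^* = -∑_i (M⁻¹)_{ij} E_i` for the intersection
matrix `M`, the rational intersection form on `L'` is given by `M⁻¹` in these coordinates. -/
def dualForm (a b : J → ℤ) : ℚ :=
  (fun j => (a j : ℚ)) ⬝ᵥ (Γ.matQ⁻¹.mulVec fun j => (b j : ℚ))

/-- The coordinates of `l ∈ L` as an element of `L'`, namely `-(l, E_j)`. -/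
def toDual (l : J → ℤ) : J → ℤ := -(Γ.mat.mulVec l)

/-- `k = ∑ a_j E_j^*` is characteristic: `χ_k(l) = -(k + l, l) / 2` is an integer for all `l ∈ L`.
Here `(k, l) = -∑ a_j l_j`. -/
def IsChar (a : J → ℤ) : Prop := ∀ l : J → ℤ, Even (-(a ⬝ᵥ l) + l ⬝ᵥ (Γ.mat.mulVec l))

/-- The set of characteristic elements. -/
def Char : Type _ := {a : J → ℤ // Γ.IsChar a}

lemma mat_symm (i j : J) : Γ.mat i j = Γ.mat j i := by
  classical
  simp only [mat, Matrix.of_apply]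
  by_cases h : i = j
  · subst h; rfl
  · rw [if_neg h, if_neg (Ne.symm h), Γ.graph.adj_comm]

lemma mat_transpose : Γ.mat.transpose = Γ.mat := by
  ext i j
  exact Γ.mat_symm j i

lemma matQ_transpose : Γ.matQ.transpose = Γ.matQ := by
  ext i j
  simp [matQ, Γ.mat_symm j i]

lemma mat_self (j : J) : Γ.mat j j = Γ.e j := by
  simp [mat]

lemma isChar_iff (a : J → ℤ) : Γ.IsChar a ↔ ∀ j, a j ≡ Γ.e j [ZMOD 2] := by
  constructor
  · intro h j
    have := h (Pi.single j 1)
    simp only [dotProduct_single, mul_one, Matrix.mulVec_single_one, single_dotProduct, one_mul,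
      Matrix.col_apply, mat_self] at this
    rw [Int.modEq_iff_dvd]
    obtain ⟨c, hc⟩ := this
    exact ⟨c, by omega⟩
  · intro h l
    have key : ∀ s : Finset J, ∀ l : J → ℤ, (∀ j ∉ s, l j = 0) →
        Even (-(a ⬝ᵥ l) + l ⬝ᵥ (Γ.mat.mulVec l)) := by
      intro s
      induction s using Finset.induction_on with
      | empty =>
        intro l hl
        have : l = 0 := funext fun j => hl j (Finset.notMem_empty j)
        simp [this]
      | insert i s hi ih =>
        intro l hl
        have h1 := ih (l - Pi.single i (l i)) (by
          intro j hj
          by_cases hji : j = i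
          · subst hji; simp
          · simp [hji, hl j (by simp [hji, hj])])
        generalize hm : l - Pi.single i (l i) = m at h1
        have hl' : l = m + Pi.single i (l i) := by rw [← hm]; simp
        generalize l i = c at hl'
        subst hl'
        have hsym : (Pi.single i c : J → ℤ) ⬝ᵥ (Γ.mat.mulVec m)
            = m ⬝ᵥ (Γ.mat.mulVec (Pi.single i c)) := by
          rw [Matrix.dotProduct_mulVec, ← Matrix.mulVec_transpose, mat_transpose, dotProduct_comm]
        have hc : Even (-(a i * c) + c * (Γ.e i * c)) := by
          obtain ⟨t, ht⟩ := (Int.modEq_iff_dvd.mp (h i))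
          have h2 : Even (c * (c - 1)) := Int.even_mul_pred_self c
          obtain ⟨u, hu⟩ := h2
          refine ⟨t * c + Γ.e i * u, ?_⟩
          have h3 : a i = Γ.e i - 2 * t := by omega
          rw [h3]
          linear_combination Γ.e i * hu
        have e2 : (Pi.single i c : J → ℤ) ⬝ᵥ (Γ.mat.mulVec (Pi.single i c))
            = c * (Γ.e i * c) := by
          simp [single_dotProduct, Matrix.mulVec_single, mat_self, mul_comm]
        have e3 : a ⬝ᵥ (Pi.single i c) = a i * c := by simp
        rw [Matrix.mulVec_add, dotProduct_add, add_dotProduct, dotProduct_add, dotProduct_add, hsym,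
          e2, e3]
        obtain ⟨u, hu⟩ := h1
        obtain ⟨v, hv⟩ := hc
        exact ⟨u + v + m ⬝ᵥ (Γ.mat.mulVec (Pi.single i c)), by linarith⟩
    exact key Finset.univ l (by simp)

namespace Char

variable {Γ}

@[ext]
lemma ext {k k' : Γ.Char} (h : k.1 = k'.1) : k = k' := Subtype.ext h

/-- The characteristic element `k + 2l`, for `l ∈ L`. -/
def shift (k : Γ.Char) (l : J → ℤ) : Γ.Char :=
  ⟨k.1 + 2 • Γ.toDual l, by
    rw [isChar_iff]
    intro j
    have := (Γ.isChar_iff _).1 k.2 j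
    have h2 : (2 • Γ.toDual l) j ≡ 0 [ZMOD 2] := by
      simp [Int.modEq_zero_iff_dvd]
    simpa using this.add h2⟩

lemma shift_val (k : Γ.Char) (l : J → ℤ) : (k.shift l).1 = k.1 + 2 • Γ.toDual l := rfl

lemma shift_apply (k : Γ.Char) (l : J → ℤ) (j : J) :
    (k.shift l).1 j = k.1 j - 2 * Γ.mat.mulVec l j := by
  change k.1 j + 2 • -(Γ.mat.mulVec l j) = _
  rw [two_nsmul]
  ring

lemma shift_zero (k : Γ.Char) : k.shift 0 = k := by
  apply Char.ext
  simp [shift_val, toDual]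

lemma shift_shift (k : Γ.Char) (l m : J → ℤ) : (k.shift l).shift m = k.shift (l + m) := by
  apply Char.ext
  simp only [shift_val, toDual, Matrix.mulVec_add]
  simp only [smul_neg, neg_add]
  rw [smul_add, smul_neg, smul_neg]
  abel

end Char

/-- Two characteristic elements are in the same class iff they differ by an element of `2L`. -/
def charSetoid : Setoid Γ.Char where
  r k k' := ∃ l : J → ℤ, k' = k.shift l
  iseqv :=
    { refl := fun k => ⟨0, k.shift_zero.symm⟩
      symm := by
        rintro k _ ⟨l, rfl⟩
        exact ⟨-l, by rw [Char.shift_shift, add_neg_cancel, Char.shift_zero]⟩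
      trans := by
        rintro k _ _ ⟨l, rfl⟩ ⟨m, rfl⟩
        exact ⟨l + m, Char.shift_shift _ _ _⟩ }

/-- The set of classes `Char / 2L`. -/
def CharClass : Type _ := Quotient Γ.charSetoid

/-- The class `[k]` of a characteristic element. -/
def charClass (k : Γ.Char) : Γ.CharClass := Quotient.mk Γ.charSetoid k

/-! ### Weights and cubes -/

/-- The weight `w(k) = -(k² + s) / 8`, with `s` the number of vertices. -/
def w (k : Γ.Char) : ℚ := -(Γ.dualForm k.1 k.1 + Fintype.card J) / 8

/-- The element `E_I = ∑_{j ∈ I} E_j` of `L`. -/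
def E (I : Finset J) : J → ℤ := fun j => if j ∈ I then 1 else 0

/-- A cube `(k, I)`; its vertices are `k + 2 E_{I'}` for `I' ⊆ I` and its dimension is `|I|`. -/
abbrev Cube : Type _ := Γ.Char × Finset J

/-- The weight of a cube: the maximum of the weights of its vertices. -/
def wCube (c : Γ.Cube) : ℚ :=
  c.2.powerset.sup' ⟨∅, Finset.empty_mem_powerset _⟩ fun I' => Γ.w (c.1.shift (E I'))

lemma matQ_mul_cast (l : J → ℤ) :
    Γ.matQ.mulVec (fun j => (l j : ℚ)) = fun j => ((Γ.mat.mulVec l j : ℤ) : ℚ) := by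
  ext i
  simp [Matrix.mulVec, dotProduct, matQ]

/-- `(k, k) = a · u` if the coordinate vector `a` of `k` is `M u`. -/
lemma dualForm_eq (h : Γ.Nondegenerate) (a b : J → ℤ) (u : J → ℚ)
    (hu : Γ.matQ.mulVec u = fun j => (b j : ℚ)) :
    Γ.dualForm a b = (fun j => (a j : ℚ)) ⬝ᵥ u := by
  rw [dualForm, ← hu, Matrix.mulVec_mulVec, Matrix.nonsing_inv_mul _ (isUnit_iff_ne_zero.mpr h),
    Matrix.one_mulVec]

lemma dualForm_comm (a b : J → ℤ) : Γ.dualForm a b = Γ.dualForm b a := by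
  rw [dualForm, dualForm, Matrix.dotProduct_mulVec, ← Matrix.mulVec_transpose,
    Matrix.transpose_nonsing_inv, matQ_transpose, dotProduct_comm]

lemma dualForm_toDual (h : Γ.Nondegenerate) (a l : J → ℤ) :
    Γ.dualForm a (Γ.toDual l) = -((a ⬝ᵥ l : ℤ) : ℚ) := by
  rw [Γ.dualForm_eq h a (Γ.toDual l) (fun j => ((-l j : ℤ) : ℚ))]
  · simp [dotProduct]
  · rw [matQ_mul_cast]
    ext i
    simp only [toDual, ← Matrix.mulVec_neg]
    rfl

lemma dualForm_add_right (a b c : J → ℤ) :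
    Γ.dualForm a (b + c) = Γ.dualForm a b + Γ.dualForm a c := by
  simp only [dualForm, ← dotProduct_add, ← Matrix.mulVec_add]
  congr 2
  ext j
  simp

lemma dualForm_add_left (a b c : J → ℤ) :
    Γ.dualForm (a + b) c = Γ.dualForm a c + Γ.dualForm b c := by
  rw [dualForm_comm, dualForm_add_right, dualForm_comm Γ c a, dualForm_comm Γ c b]

lemma w_shift (h : Γ.Nondegenerate) (k : Γ.Char) (l : J → ℤ) :
    Γ.w (k.shift l) = Γ.w k + ((k.1 ⬝ᵥ l - l ⬝ᵥ (Γ.mat.mulVec l) : ℤ) : ℚ) / 2 := by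
  have e1 : Γ.dualForm (Γ.toDual l) (Γ.toDual l) = ((l ⬝ᵥ (Γ.mat.mulVec l) : ℤ) : ℚ) := by
    rw [Γ.dualForm_toDual h, toDual, neg_dotProduct, dotProduct_comm]
    push_cast; ring
  have e2 := Γ.dualForm_toDual h k.1 l
  have e3 : Γ.dualForm (Γ.toDual l) k.1 = -((k.1 ⬝ᵥ l : ℤ) : ℚ) := by rw [dualForm_comm, e2]
  rw [w, w, Char.shift_val, two_smul]
  simp only [dualForm_add_left, dualForm_add_right, e1, e2, e3]
  push_cast
  ring

lemma w_shift_sub_int (k : Γ.Char) (l : J → ℤ) : ∃ n : ℤ, Γ.w (k.shift l) - Γ.w k = n := by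
  by_cases h : Γ.Nondegenerate
  · obtain ⟨c, hc⟩ := k.2 l
    refine ⟨-c, ?_⟩
    rw [w_shift _ h]
    have : k.1 ⬝ᵥ l - l ⬝ᵥ (Γ.mat.mulVec l) = -(2 * c) := by linarith
    rw [this]
    push_cast
    ring
  · refine ⟨0, ?_⟩
    have : Γ.matQ⁻¹ = 0 := Matrix.nonsing_inv_apply_not_isUnit _ (by
      rw [isUnit_iff_ne_zero]; exact h)
    simp [w, dualForm, this]

lemma wCube_sub_w_int (k : Γ.Char) (l : J → ℤ) (I : Finset J) :
    ∃ n : ℤ, Γ.wCube (k.shift l, I) - Γ.w k = n := by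
  obtain ⟨I', -, h⟩ := Finset.exists_mem_eq_sup' (s := I.powerset)
    ⟨∅, Finset.empty_mem_powerset _⟩ fun I' => Γ.w ((k.shift l).shift (E I'))
  rw [wCube, h, Char.shift_shift]
  exact Γ.w_shift_sub_int _ _

lemma wCube_sub_int (k : Γ.Char) (l : J → ℤ) (I I' : Finset J) :
    ∃ n : ℤ, Γ.wCube (k, I) - Γ.wCube (k.shift l, I') = n := by
  obtain ⟨m, hm⟩ := Γ.wCube_sub_w_int k 0 I
  obtain ⟨n, hn⟩ := Γ.wCube_sub_w_int k l I'
  rw [Char.shift_zero] at hm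
  exact ⟨m - n, by push_cast; linarith⟩

lemma wCube_mono (k : Γ.Char) {I I' : Finset J} (h : I' ⊆ I) :
    Γ.wCube (k, I') ≤ Γ.wCube (k, I) :=
  Finset.sup'_mono _ (Finset.powerset_mono.mpr h) _

lemma E_insert {I : Finset J} {j : J} (h : j ∉ I) : E (insert j I) = E {j} + E I := by
  ext i
  by_cases hi : i = j
  · subst hi; simp [E, h]
  · simp [E, hi]

lemma wCube_shift_le (k : Γ.Char) {I : Finset J} {j : J} (h : j ∈ I) :
    Γ.wCube (k.shift (E {j}), I.erase j) ≤ Γ.wCube (k, I) := by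
  refine Finset.sup'_le _ _ fun I' hI' => ?_
  rw [Finset.mem_powerset] at hI'
  have hj : j ∉ I' := fun hj => Finset.notMem_erase j I (hI' hj)
  rw [Char.shift_shift, ← E_insert hj]
  refine Finset.le_sup' (fun I' => Γ.w (k.shift (E I'))) ?_
  rw [Finset.mem_powerset]
  exact Finset.insert_subset h (hI'.trans (Finset.erase_subset _ _))

lemma wCube_empty (k : Γ.Char) : Γ.wCube (k, ∅) = Γ.w k := by
  have : E (∅ : Finset J) = 0 := by ext; simp [E]
  simp [wCube, this, Char.shift_zero]

/-! ### The complex `(ℱ^*, δ)` -/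

/-- The part of the coboundary operator in the direction `E_j`:
`φ ↦ U^{w(k,I)-w(k,I∖j)} φ(k, I∖j) - U^{w(k,I)-w(k+2E_j,I∖j)} φ(k+2E_j, I∖j)`. -/
def deltaDir (j : J) : (Γ.Cube → TPlus) →ₗ[ℤ[X]] (Γ.Cube → TPlus) where
  toFun φ c :=
    uPow (Γ.wCube c - Γ.wCube (c.1, c.2.erase j)) • φ (c.1, c.2.erase j)
      - uPow (Γ.wCube c - Γ.wCube (c.1.shift (E {j}), c.2.erase j))
        • φ (c.1.shift (E {j}), c.2.erase j)
  map_add' φ ψ := by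
    ext c
    simp only [Pi.add_apply, smul_add]
    abel
  map_smul' p φ := by
    ext c
    simp only [Pi.smul_apply, RingHom.id_apply, smul_sub, smul_smul, mul_comm]

/-- The sign `(-1)^l` of `j = j_l` in `I = {j_1 < ⋯ < j_q}`. -/
def sgn (I : Finset J) (j : J) : ℤ := (-1) ^ (I.filter (· ≤ j)).card

/-- The coboundary operator
`(δφ)(k,I) = ∑_l (-1)^l (U^{w(k,I)-w(k,I∖j_l)} φ(k,I∖j_l) - U^{w(k,I)-w(k+2E_{j_l},I∖j_l)}
φ(k+2E_{j_l},I∖j_l))`, where `I = {j_1 < ⋯ < j_q}`. -/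
def delta : (Γ.Cube → TPlus) →ₗ[ℤ[X]] (Γ.Cube → TPlus) where
  toFun φ c := ∑ j ∈ c.2, sgn c.2 j • Γ.deltaDir j φ c
  map_add' φ ψ := by
    ext c
    simp only [map_add, Pi.add_apply, smul_add, Finset.sum_add_distrib]
  map_smul' p φ := by
    ext c
    simp only [map_smul, Pi.smul_apply, RingHom.id_apply, Finset.smul_sum]
    exact Finset.sum_congr rfl fun j _ => smul_comm _ _ _

lemma delta_apply (φ : Γ.Cube → TPlus) (c : Γ.Cube) :
    Γ.delta φ c = ∑ j ∈ c.2, sgn c.2 j • Γ.deltaDir j φ c := rfl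

lemma deltaDir_apply (j : J) (φ : Γ.Cube → TPlus) (k : Γ.Char) (I : Finset J) :
    Γ.deltaDir j φ (k, I) = uPow (Γ.wCube (k, I) - Γ.wCube (k, I.erase j)) • φ (k, I.erase j)
      - uPow (Γ.wCube (k, I) - Γ.wCube (k.shift (E {j}), I.erase j))
        • φ (k.shift (E {j}), I.erase j) := rfl

lemma deltaDir_apply_of_mem_iff (j : J) (φ : Γ.Cube → TPlus) (k : Γ.Char) (I I' : Finset J)
    (hI' : ∀ i, i ∈ I' ↔ i ≠ j ∧ i ∈ I) :
    Γ.deltaDir j φ (k, I) = uPow (Γ.wCube (k, I) - Γ.wCube (k, I')) • φ (k, I')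
      - uPow (Γ.wCube (k, I) - Γ.wCube (k.shift (E {j}), I')) • φ (k.shift (E {j}), I') := by
  obtain rfl : I' = I.erase j := Finset.ext fun i => by rw [hI', Finset.mem_erase]
  rfl

lemma deltaDir_deltaDir {i j : J} (φ : Γ.Cube → TPlus) (k : Γ.Char) {I : Finset J} (hj : j ∈ I)
    (hi : i ∈ I) (hij : i ≠ j) :
    Γ.deltaDir j (Γ.deltaDir i φ) (k, I) =
      uPow (Γ.wCube (k, I) - Γ.wCube (k, (I.erase j).erase i)) • φ (k, (I.erase j).erase i)
      - uPow (Γ.wCube (k, I) - Γ.wCube (k.shift (E {i}), (I.erase j).erase i))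
        • φ (k.shift (E {i}), (I.erase j).erase i)
      - uPow (Γ.wCube (k, I) - Γ.wCube (k.shift (E {j}), (I.erase j).erase i))
        • φ (k.shift (E {j}), (I.erase j).erase i)
      + uPow (Γ.wCube (k, I) - Γ.wCube (k.shift (E {i} + E {j}), (I.erase j).erase i))
        • φ (k.shift (E {i} + E {j}), (I.erase j).erase i) := by
  have hi' : i ∈ I.erase j := Finset.mem_erase.mpr ⟨hij, hi⟩
  have a0 : ∀ (k : Γ.Char) {i : J} {I : Finset J}, 0 ≤ Γ.wCube (k, I) - Γ.wCube (k, I.erase i) :=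
    fun k i I => sub_nonneg.mpr (Γ.wCube_mono k (Finset.erase_subset _ _))
  have a1 : ∀ (k : Γ.Char) {i : J} {I : Finset J}, i ∈ I →
      0 ≤ Γ.wCube (k, I) - Γ.wCube (k.shift (E {i}), I.erase i) :=
    fun k i I h => sub_nonneg.mpr (Γ.wCube_shift_le k h)
  have b0 : ∀ (k : Γ.Char) {I I' : Finset J}, ∃ n : ℤ, Γ.wCube (k, I) - Γ.wCube (k, I') = n := by
    intro k I I'
    simpa [Char.shift_zero] using Γ.wCube_sub_int k 0 I I'
  have b1 := Γ.wCube_sub_int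
  simp only [deltaDir_apply, smul_sub, smul_smul]
  rw [uPow_mul (a0 _) (a0 _) (b0 _) (b0 _), uPow_mul (a0 _) (a1 _ hi') (b0 _) (b1 _ _ _ _),
    uPow_mul (a1 _ hj) (a0 _) (b1 _ _ _ _) (b0 _),
    uPow_mul (a1 _ hj) (a1 _ hi') (b1 _ _ _ _) (b1 _ _ _ _)]
  simp only [sub_add_sub_cancel, Char.shift_shift, add_comm (E {j}) (E {i})]
  abel

lemma deltaDir_comm {i j : J} (φ : Γ.Cube → TPlus) (k : Γ.Char) {I : Finset J} (hj : j ∈ I)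
    (hi : i ∈ I) (hij : i ≠ j) :
    Γ.deltaDir j (Γ.deltaDir i φ) (k, I) = Γ.deltaDir i (Γ.deltaDir j φ) (k, I) := by
  rw [Γ.deltaDir_deltaDir φ k hj hi hij, Γ.deltaDir_deltaDir φ k hi hj hij.symm,
    Finset.erase_right_comm, add_comm (E {i}) (E {j})]
  abel

lemma sgn_mul_sgn {i j : J} {I : Finset J} (hj : j ∈ I) (hi : i ∈ I) (hij : i ≠ j) :
    sgn I j * sgn (I.erase j) i = -(sgn I i * sgn (I.erase i) j) := by
  have key : ∀ {i j : J}, j ∈ I → i ∈ I → i < j →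
      sgn (I.erase j) i = sgn I i ∧ sgn (I.erase i) j = - sgn I j := by
    intro i j hj hi hlt
    constructor
    · rw [sgn, sgn, Finset.filter_erase, Finset.erase_eq_of_notMem]
      simp [hlt]
    · rw [sgn, sgn, Finset.filter_erase]
      have hm : i ∈ I.filter (· ≤ j) := by simp [hi, hlt.le]
      rw [← Finset.card_erase_add_one hm, pow_succ]
      ring
  rcases lt_or_gt_of_ne hij with h | h
  · obtain ⟨h1, h2⟩ := key hj hi h
    rw [h1, h2]; ring
  · obtain ⟨h1, h2⟩ := key hi hj h
    rw [h1, h2]; ring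

lemma delta_delta (φ : Γ.Cube → TPlus) : Γ.delta (Γ.delta φ) = 0 := by
  ext ⟨k, I⟩
  have h1 : ∀ j ∈ I, Γ.deltaDir j (Γ.delta φ) (k, I)
      = ∑ i ∈ I.erase j, sgn (I.erase j) i • Γ.deltaDir j (Γ.deltaDir i φ) (k, I) := by
    intro j hj
    simp only [deltaDir_apply, delta_apply, Finset.smul_sum, ← Finset.sum_sub_distrib, smul_sub]
    refine Finset.sum_congr rfl fun i hi => ?_
    simp only [smul_comm (sgn _ _)]
  rw [delta_apply, Pi.zero_apply]
  rw [Finset.sum_congr rfl fun j hj => by rw [h1 j hj, Finset.smul_sum]]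
  rw [Finset.sum_sigma']
  refine Finset.sum_involution (fun x _ => ⟨x.2, x.1⟩) ?_ ?_ ?_ ?_
  · rintro ⟨j, i⟩ h
    simp only [Finset.mem_sigma, Finset.mem_erase] at h
    obtain ⟨hj, hij, hi⟩ := h
    simp only [smul_smul]
    rw [sgn_mul_sgn hj hi hij, Γ.deltaDir_comm φ k hj hi hij, neg_smul, neg_add_cancel]
  · rintro ⟨j, i⟩ h _ heq
    simp only [Finset.mem_sigma, Finset.mem_erase] at h
    simp only [Sigma.mk.injEq, heq_eq_eq] at heq
    exact h.2.1 heq.1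
  · rintro ⟨j, i⟩ h
    simp only [Finset.mem_sigma, Finset.mem_erase] at h ⊢
    exact ⟨h.2.2, h.2.1.symm, h.1⟩
  · rintro ⟨j, i⟩ h
    rfl

/-- `ℱ^q`: the `𝒯₀⁺`-valued functions with finite support on the set of `q`-cubes (represented as
functions on the set of all cubes which vanish on the cubes of dimension different from `q`). -/
def cochains (q : ℕ) : Submodule ℤ[X] (Γ.Cube → TPlus) where
  carrier := {φ | (Function.support φ).Finite ∧ ∀ c : Γ.Cube, φ c ≠ 0 → c.2.card = q}
  add_mem' {φ ψ} hφ hψ := by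
    refine ⟨(hφ.1.union hψ.1).subset (Function.support_add φ ψ), fun c hc => ?_⟩
    by_cases h : φ c = 0
    · exact hψ.2 c fun h' => hc (by simp [h, h'])
    · exact hφ.2 c h
  zero_mem' := by simp
  smul_mem' p φ hφ := by
    have : ∀ c, (p • φ) c ≠ 0 → φ c ≠ 0 := fun c hc h => hc (by simp [h])
    exact ⟨hφ.1.subset this, fun c hc => hφ.2 c (this c hc)⟩

lemma cochains_apply_eq_zero {q : ℕ} {φ : Γ.Cube → TPlus} (hφ : φ ∈ Γ.cochains q) {c : Γ.Cube}
    (hc : c.2.card ≠ q) : φ c = 0 := by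
  by_contra h
  exact hc (hφ.2 c h)

lemma shift_injective (l : J → ℤ) : Function.Injective fun k : Γ.Char => k.shift l := by
  intro k k' h
  have := congrArg (fun k : Γ.Char => k.shift (-l)) h
  simpa [Char.shift_shift, Char.shift_zero] using this

lemma delta_mem {q : ℕ} {φ : Γ.Cube → TPlus} (hφ : φ ∈ Γ.cochains q) :
    Γ.delta φ ∈ Γ.cochains (q + 1) := by
  have key : ∀ c, Γ.delta φ c ≠ 0 → ∃ j ∈ c.2, φ (c.1, c.2.erase j) ≠ 0 ∨
      φ (c.1.shift (E {j}), c.2.erase j) ≠ 0 := by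
    intro c hc
    by_contra! hcon
    refine hc (Finset.sum_eq_zero fun j hj => ?_)
    obtain ⟨h1, h2⟩ := hcon j hj
    rw [show Γ.deltaDir j φ c = _ from Γ.deltaDir_apply j φ c.1 c.2, h1, h2]
    simp
  constructor
  · have hfin : (⋃ j : J, ⋃ c ∈ Function.support φ, {(c.1, insert j c.2),
        (c.1.shift (-E {j}), insert j c.2)} : Set Γ.Cube).Finite :=
      Set.finite_iUnion fun j => hφ.1.biUnion fun c _ => Set.toFinite _
    refine hfin.subset ?_
    rintro ⟨k, I⟩ hc
    obtain ⟨j, hj, h | h⟩ := key _ hc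
    · simp only [Set.mem_iUnion]
      refine ⟨j, _, h, ?_⟩
      left
      simp [Finset.insert_erase hj]
    · simp only [Set.mem_iUnion]
      refine ⟨j, _, h, ?_⟩
      right
      simp [Finset.insert_erase hj, Char.shift_shift, Char.shift_zero]
  · intro c hc
    obtain ⟨j, hj, h | h⟩ := key _ hc
    · rw [← hφ.2 _ h, Finset.card_erase_add_one hj]
    · rw [← hφ.2 _ h, Finset.card_erase_add_one hj]

/-- The coboundary operator `δ : ℱ^q → ℱ^{q+1}`. -/
def deltaHom (q : ℕ) : Γ.cochains q →ₗ[ℤ[X]] Γ.cochains (q + 1) :=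
  Γ.delta.restrict fun _ h => Γ.delta_mem h

lemma deltaHom_deltaHom (q : ℕ) : Γ.deltaHom (q + 1) ∘ₗ Γ.deltaHom q = 0 := by
  ext φ : 1
  exact Subtype.ext (Γ.delta_delta φ.1)

/-- The cochain complex `(ℱ^*(Γ), δ)` of `ℤ[U]`-modules. -/
def cochainComplex : CochainComplex (ModuleCat ℤ[X]) ℕ :=
  CochainComplex.of (fun q => ModuleCat.of ℤ[X] (Γ.cochains q))
    (fun q => ModuleCat.ofHom (Γ.deltaHom q)) fun q => by
      rw [← ModuleCat.ofHom_comp, deltaHom_deltaHom]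
      rfl

lemma cochainComplex_d (q : ℕ) :
    Γ.cochainComplex.d q (q + 1) = ModuleCat.ofHom (Γ.deltaHom q) :=
  CochainComplex.of_d (fun q => ModuleCat.of ℤ[X] (Γ.cochains q))
    (fun q => ModuleCat.ofHom (Γ.deltaHom q)) q

/-- The lattice cohomology `ℍ^q(Γ)`. -/
abbrev latticeCohomology (q : ℕ) : ModuleCat ℤ[X] := Γ.cochainComplex.homology q

/-! ### The canonical submodule `𝕋 ⊆ ℍ⁰` of a negative definite graph -/

variable {Γ}

lemma nondegenerate_of_mulVec (h : ∀ x : J → ℚ, Γ.matQ.mulVec x = 0 → x = 0) : Γ.Nondegenerate := by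
  intro hdet
  obtain ⟨x, hx, hx'⟩ := Matrix.exists_mulVec_eq_zero_iff.mpr hdet
  exact hx (h x hx')

lemma NegDef.nondegenerate (h : Γ.NegDef) : Γ.Nondegenerate := by
  refine nondegenerate_of_mulVec fun x hx => ?_
  by_contra hne
  have := h x hne
  rw [hx, dotProduct_zero] at this
  exact lt_irrefl _ this

lemma NegDef.finite_le (h : Γ.NegDef) (r : ℚ) : {k : Γ.Char | Γ.w k ≤ r}.Finite := by
  obtain ⟨N, hN⟩ : ∃ N : ℕ, ∀ j, (8 * r + Fintype.card J - Γ.e j) / 2 ≤ N := by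
    obtain ⟨N, hN⟩ := Finite.exists_le (fun j : J => ⌈(8 * r + Fintype.card J - Γ.e j) / 2⌉₊)
    exact ⟨N, fun j => (Nat.le_ceil _).trans (by exact_mod_cast hN j)⟩
  have hfin : (Set.Icc (fun _ : J => -(N : ℤ)) fun _ : J => (N : ℤ)).Finite := Set.finite_Icc _ _
  refine Set.Finite.of_finite_image (f := Subtype.val) (hfin.subset ?_) Subtype.val_injective.injOn
  rintro _ ⟨k, hk, rfl⟩
  have hnd := h.nondegenerate
  set u : J → ℚ := Γ.matQ⁻¹.mulVec fun j => (k.1 j : ℚ) with hu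
  have hMu : Γ.matQ.mulVec u = fun j => (k.1 j : ℚ) := by
    rw [hu, Matrix.mulVec_mulVec, Matrix.mul_nonsing_inv _ (isUnit_iff_ne_zero.mpr hnd),
      Matrix.one_mulVec]
  have hkk : Γ.dualForm k.1 k.1 = u ⬝ᵥ (Γ.matQ.mulVec u) := by
    rw [hMu, dotProduct_comm, Γ.dualForm_eq hnd _ _ u hMu]
  have hw : -(u ⬝ᵥ (Γ.matQ.mulVec u)) ≤ 8 * r + Fintype.card J := by
    have hk' : Γ.w k ≤ r := hk
    rw [w, hkk] at hk'
    linarith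
  have hle : ∀ x : J → ℚ, x ⬝ᵥ (Γ.matQ.mulVec x) ≤ 0 := by
    intro x
    by_cases hx : x = 0
    · simp [hx]
    · exact (h x hx).le
  have key : ∀ (j : J) (t : ℚ), u ⬝ᵥ (Γ.matQ.mulVec u) + 2 * t * k.1 j + t * t * Γ.e j ≤ 0 := by
    intro j t
    have := hle (u + Pi.single j t)
    rw [Matrix.mulVec_add, dotProduct_add, add_dotProduct, add_dotProduct,
      Matrix.dotProduct_mulVec u Γ.matQ (Pi.single j t), ← Matrix.mulVec_transpose, matQ_transpose,
      hMu, single_dotProduct, dotProduct_single, single_dotProduct] at this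
    rw [hMu]
    have e1 : Γ.matQ.mulVec (Pi.single j t) j = Γ.e j * t := by
      simp [Matrix.mulVec_single, matQ, mat_self, mul_comm]
    rw [e1] at this
    linarith
  constructor <;> intro j
  · have h1 := key j (-1)
    have h2 := hN j
    have : -(N : ℚ) ≤ k.1 j := by linarith
    exact_mod_cast this
  · have h1 := key j 1
    have h2 := hN j
    have : (k.1 j : ℚ) ≤ N := by linarith
    exact_mod_cast this

lemma NegDef.exists_isLeast (h : Γ.NegDef) (c : Γ.CharClass) :
    ∃ m : ℚ, IsLeast (Γ.w '' {k | Γ.charClass k = c}) m := by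
  obtain ⟨k₀, rfl⟩ := Quotient.exists_rep c
  have hfin : {k : Γ.Char | Γ.charClass k = Γ.charClass k₀ ∧ Γ.w k ≤ Γ.w k₀}.Finite :=
    (h.finite_le (Γ.w k₀)).subset fun k hk => hk.2
  obtain ⟨k, hk, hmin⟩ := Set.exists_min_image _ Γ.w hfin ⟨k₀, rfl, le_rfl⟩
  refine ⟨Γ.w k, ⟨k, hk.1, rfl⟩, ?_⟩
  rintro _ ⟨k', hk', rfl⟩
  by_cases hle : Γ.w k' ≤ Γ.w k₀
  · exact hmin k' ⟨hk', hle⟩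
  · exact hk.2.trans (not_le.mp hle).le

/-- The minimum of the weights `w(k)` of the elements `k` of a given class, i.e. half of the number
`d[k]`. -/
def NegDef.minWeight (h : Γ.NegDef) (c : Γ.CharClass) : ℚ := (h.exists_isLeast c).choose

lemma NegDef.minWeight_isLeast (h : Γ.NegDef) (c : Γ.CharClass) :
    IsLeast (Γ.w '' {k | Γ.charClass k = c}) (h.minWeight c) := (h.exists_isLeast c).choose_spec

lemma NegDef.minWeight_le (h : Γ.NegDef) (k : Γ.Char) : h.minWeight (Γ.charClass k) ≤ Γ.w k :=
  (h.minWeight_isLeast _).2 ⟨k, rfl, rfl⟩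

lemma NegDef.sub_minWeight_int (h : Γ.NegDef) (k : Γ.Char) :
    ∃ n : ℤ, Γ.w k - h.minWeight (Γ.charClass k) = n := by
  obtain ⟨k', hk', he⟩ := (h.minWeight_isLeast (Γ.charClass k)).1
  obtain ⟨l, rfl⟩ : ∃ l, k = k'.shift l := Quotient.exact (s := Γ.charSetoid) hk'
  rw [← he]
  exact Γ.w_shift_sub_int _ _

/-- The value at `(k, I)` of the augmentation: `U^{w(k) - min_{[k]} w} x_{[k]}` if `I = ∅`. -/
def NegDef.augmentationFun (h : Γ.NegDef) :
    (Γ.CharClass →₀ TPlus) →ₗ[ℤ[X]] (Γ.Cube → TPlus) where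
  toFun x c :=
    if c.2 = ∅ then uPow (Γ.w c.1 - h.minWeight (Γ.charClass c.1)) • x (Γ.charClass c.1) else 0
  map_add' x y := by
    ext c
    by_cases hc : c.2 = ∅ <;> simp [hc]
  map_smul' p x := by
    ext c
    by_cases hc : c.2 = ∅ <;> simp [hc, smul_smul, mul_comm]

lemma NegDef.augmentationFun_mem (h : Γ.NegDef) (x : Γ.CharClass →₀ TPlus) :
    h.augmentationFun x ∈ Γ.cochains 0 := by
  choose N hN using fun c => TPlus.exists_pow_smul_eq_zero (x c)
  refine ⟨?_, ?_⟩
  · have hfin : (⋃ c ∈ (x.support : Set Γ.CharClass),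
        (fun k : Γ.Char => ((k, ∅) : Γ.Cube)) '' {k | Γ.w k ≤ h.minWeight c + N c}).Finite :=
      x.support.finite_toSet.biUnion fun c _ => (h.finite_le _).image _
    refine hfin.subset ?_
    rintro ⟨k, I⟩ hc
    simp only [augmentationFun, LinearMap.coe_mk, AddHom.coe_mk, Function.mem_support] at hc
    by_cases hI : I = ∅
    · subst hI
      rw [if_pos rfl] at hc
      simp only [Set.mem_iUnion]
      refine ⟨Γ.charClass k, ?_, k, ?_, rfl⟩
      · simp only [Finset.mem_coe, Finsupp.mem_support_iff]
        intro h0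
        exact hc (by rw [h0, smul_zero])
      · by_contra hlt
        refine hc (pow_smul_eq_zero_of_le (hN _) (Nat.le_floor ?_))
        rw [Set.mem_ofPred_eq, not_le] at hlt
        linarith
    · exact absurd (if_neg hI) hc
  · intro c hc
    by_contra hcard
    refine hc (if_neg fun hI => hcard ?_)
    rw [hI, Finset.card_empty]

/-- The augmentation `ε : ⨁_{[k]} 𝒯⁺_{d[k]} → ℱ⁰`, `ε(x)(k) = U^{w(k) - d[k]/2} x_{[k]}`.
(As a `ℤ[U]`-module without its grading, `𝒯⁺_{d[k]}` is `𝒯₀⁺`.) -/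
def NegDef.augmentation (h : Γ.NegDef) : (Γ.CharClass →₀ TPlus) →ₗ[ℤ[X]] Γ.cochains 0 :=
  h.augmentationFun.codRestrict _ h.augmentationFun_mem

lemma NegDef.delta_augmentationFun (h : Γ.NegDef) (x : Γ.CharClass →₀ TPlus) :
    Γ.delta (h.augmentationFun x) = 0 := by
  ext ⟨k, I⟩
  refine Finset.sum_eq_zero fun j hj => ?_
  change j ∈ I at hj
  suffices Γ.deltaDir j (h.augmentationFun x) (k, I) = 0 by rw [this, smul_zero]
  rw [deltaDir_apply]
  by_cases hI : I.erase j = ∅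
  · have hcl : Γ.charClass (k.shift (E {j})) = Γ.charClass k :=
      Quotient.sound (s := Γ.charSetoid) (Setoid.symm' _ ⟨_, rfl⟩)
    have h1 := Γ.wCube_mono k (Finset.erase_subset j I)
    have h2 := Γ.wCube_shift_le k hj
    have i1 := Γ.wCube_sub_int k 0 I (I.erase j)
    have i2 := Γ.wCube_sub_int k (E {j}) I (I.erase j)
    have m1 := h.minWeight_le k
    have m2 := h.minWeight_le (k.shift (E {j}))
    have n1 := h.sub_minWeight_int k
    have n2 := h.sub_minWeight_int (k.shift (E {j}))
    rw [Char.shift_zero] at i1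
    simp only [hI, wCube_empty, hcl] at h1 h2 i1 i2 m1 m2 n1 n2 ⊢
    simp only [augmentationFun, LinearMap.coe_mk, AddHom.coe_mk, if_true, hcl, smul_smul]
    rw [uPow_mul (sub_nonneg.mpr h1) (sub_nonneg.mpr m1) i1 n1,
      uPow_mul (sub_nonneg.mpr h2) (sub_nonneg.mpr m2) i2 n2, sub_add_sub_cancel,
      sub_add_sub_cancel, sub_self]
  · simp [augmentationFun, hI]

lemma NegDef.augmentation_d (h : Γ.NegDef) :
    (ModuleCat.ofHom h.augmentation : ModuleCat.of ℤ[X] (Γ.CharClass →₀ TPlus) ⟶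
      Γ.cochainComplex.X 0) ≫ Γ.cochainComplex.d 0 1 = 0 := by
  rw [Γ.cochainComplex_d 0]
  exact ModuleCat.hom_ext (LinearMap.ext fun x => Subtype.ext (h.delta_augmentationFun x))

/-- The canonical submodule `𝕋(Γ) = ⨁_{[k]} 𝒯⁺_{d[k]}` of `ℍ⁰(Γ)`: the image of the map
`⨁_{[k]} 𝒯⁺_{d[k]} → ℍ⁰(Γ)` induced by the augmentation. -/
def NegDef.canonicalSubmodule (h : Γ.NegDef) : Submodule ℤ[X] (Γ.latticeCohomology 0) :=
  LinearMap.range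
    (Γ.cochainComplex.liftCycles (ModuleCat.ofHom h.augmentation) 1 (by simp) h.augmentation_d ≫
      Γ.cochainComplex.homologyπ 0).hom

variable (Γ)

/-! ### The graphs `Γ∖j₀`, `Γ_{j₀}^+` and `Γ^b` -/

/-- The graph `Γ∖j₀`: the vertex `j₀` and its adjacent edges are deleted. -/
def delete (j₀ : J) : PlumbingGraph {j : J // j ≠ j₀} where
  graph := Γ.graph.comap Subtype.val
  e j := Γ.e j

/-- The graph `Γ_{j₀}^+`: the decoration `e_{j₀}` is replaced by `e_{j₀} + 1`. -/
def incr (j₀ : J) : PlumbingGraph J where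
  graph := Γ.graph
  e := Function.update Γ.e j₀ (Γ.e j₀ + 1)

/-- The graph `Γ^b`: a new vertex `⊤` with decoration `-1` is attached to `j₀` by one edge. -/
def attach (j₀ : J) : PlumbingGraph (WithTop J) where
  graph := Γ.graph.map Function.Embedding.coeWithTop ⊔ SimpleGraph.edge ⊤ (j₀ : WithTop J)
  e := WithTop.recTopCoe (-1) Γ.e

variable (j₀ : J)

lemma delete_mat (i j : {j : J // j ≠ j₀}) : (Γ.delete j₀).mat i j = Γ.mat i j := by
  classical
  simp [mat, delete, Subtype.ext_iff]

lemma incr_mat (i j : J) :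
    (Γ.incr j₀).mat i j = Γ.mat i j + if i = j₀ ∧ j = j₀ then 1 else 0 := by
  classical
  by_cases hij : i = j
  · subst hij
    by_cases hi : i = j₀
    · subst hi; simp [mat, incr]
    · simp [mat, incr, hi]
  · have : ¬(i = j₀ ∧ j = j₀) := fun h => hij (h.1.trans h.2.symm)
    simp only [mat, incr, Matrix.of_apply, if_neg hij, if_neg this, add_zero]
    rfl

lemma attach_mat_coe (i j : J) :
    (Γ.attach j₀).mat (i : WithTop J) (j : WithTop J) = Γ.mat i j := by
  classical
  simp [mat, attach, SimpleGraph.edge_adj, SimpleGraph.map_adj]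

lemma attach_mat_top_coe (j : J) :
    (Γ.attach j₀).mat ⊤ (j : WithTop J) = if j = j₀ then 1 else 0 := by
  classical
  simp [mat, attach, SimpleGraph.edge_adj, SimpleGraph.map_adj]

lemma attach_mat_top_top : (Γ.attach j₀).mat ⊤ ⊤ = -1 := by
  simp [mat_self, attach]

lemma incr_matQ_mulVec (x : J → ℚ) (i : J) :
    (Γ.incr j₀).matQ.mulVec x i = Γ.matQ.mulVec x i + if i = j₀ then x j₀ else 0 := by
  have : ∀ j, (Γ.incr j₀).matQ i j * x j
      = Γ.matQ i j * x j + if j = j₀ then (if i = j₀ then x j else 0) else 0 := by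
    intro j
    simp only [matQ, Matrix.map_apply, incr_mat]
    by_cases h1 : i = j₀ <;> by_cases h2 : j = j₀ <;> simp [h1, h2, add_mul]
  simp only [Matrix.mulVec, dotProduct, this, Finset.sum_add_distrib]
  simp

lemma incr_mat_mulVec (x : J → ℤ) (i : J) :
    (Γ.incr j₀).mat.mulVec x i = Γ.mat.mulVec x i + if i = j₀ then x j₀ else 0 := by
  have : ∀ j, (Γ.incr j₀).mat i j * x j
      = Γ.mat i j * x j + if j = j₀ then (if i = j₀ then x j else 0) else 0 := by
    intro j
    simp only [incr_mat]
    by_cases h1 : i = j₀ <;> by_cases h2 : j = j₀ <;> simp [h1, h2, add_mul]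
  simp only [Matrix.mulVec, dotProduct, this, Finset.sum_add_distrib]
  simp

lemma sum_withTop {M : Type*} [AddCommMonoid M] (f : WithTop J → M) :
    ∑ x, f x = f ⊤ + ∑ j : J, f j :=
  Fintype.sum_option f

lemma attach_matQ_mulVec_top (y : WithTop J → ℚ) :
    (Γ.attach j₀).matQ.mulVec y ⊤ = y j₀ - y ⊤ := by
  simp only [Matrix.mulVec, dotProduct, sum_withTop, matQ, Matrix.map_apply, attach_mat_top_top,
    attach_mat_top_coe]
  simp
  ring

lemma attach_matQ_mulVec_coe (y : WithTop J → ℚ) (i : J) :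
    (Γ.attach j₀).matQ.mulVec y (i : WithTop J)
      = Γ.matQ.mulVec (fun j => y j) i + if i = j₀ then y ⊤ else 0 := by
  simp only [Matrix.mulVec, dotProduct, sum_withTop, matQ, Matrix.map_apply, attach_mat_coe,
    (Γ.attach j₀).mat_symm i ⊤, attach_mat_top_coe]
  by_cases h : i = j₀ <;> simp [h, add_comm]

variable {Γ j₀}

lemma NegDef.of_incr (h : (Γ.incr j₀).NegDef) : Γ.NegDef := by
  intro x hx
  have h1 := h x hx
  have h2 : x ⬝ᵥ ((Γ.incr j₀).matQ.mulVec x) = x ⬝ᵥ (Γ.matQ.mulVec x) + x j₀ * x j₀ := by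
    simp only [dotProduct, incr_matQ_mulVec, mul_add, Finset.sum_add_distrib]
    simp
  nlinarith [mul_self_nonneg (x j₀)]

lemma NegDef.delete (h : Γ.NegDef) : (Γ.delete j₀).NegDef := by
  intro x hx
  set y : J → ℚ := fun j => if hj : j ≠ j₀ then x ⟨j, hj⟩ else 0 with hy
  have hyx : ∀ i : {j : J // j ≠ j₀}, y i = x i := fun i => by simp [hy, i.2]
  have hy0 : ∀ j ∉ Set.range (Subtype.val : {j : J // j ≠ j₀} → J), y j = 0 := by
    intro j hj
    by_cases hj' : j = j₀
    · simp [hy, hj']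
    · exact absurd ⟨⟨j, hj'⟩, rfl⟩ hj
  have hne : y ≠ 0 := by
    intro h0
    apply hx
    ext i
    rw [← hyx, h0]; rfl
  refine lt_of_eq_of_lt ?_ (h y hne)
  refine Fintype.sum_of_injective Subtype.val Subtype.val_injective _ _ (fun j hj => ?_) fun i => ?_
  · rw [hy0 j hj, zero_mul]
  · rw [hyx]
    congr 1
    refine Fintype.sum_of_injective Subtype.val Subtype.val_injective _ _ (fun j hj => ?_)
      fun j => ?_
    · rw [hy0 j hj, mul_zero]
    · change (Γ.delete j₀).matQ i j * x j = Γ.matQ i j * y j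
      rw [hyx, matQ, matQ, Matrix.map_apply, Matrix.map_apply, delete_mat]

lemma Nondegenerate.attach (h : (Γ.incr j₀).Nondegenerate) : (Γ.attach j₀).Nondegenerate := by
  refine nondegenerate_of_mulVec fun y hy => ?_
  have h1 : y j₀ - y ⊤ = 0 := by rw [← Γ.attach_matQ_mulVec_top, hy]; rfl
  have h2 : (Γ.incr j₀).matQ.mulVec (fun j : J => y j) = 0 := by
    ext i
    rw [incr_matQ_mulVec, sub_eq_zero.mp h1, ← attach_matQ_mulVec_coe, hy]
    rfl
  have h3 : (fun j : J => y j) = 0 := by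
    by_contra hne
    exact h (Matrix.exists_mulVec_eq_zero_iff.mp ⟨_, hne, h2⟩)
  have h4 : ∀ j : J, y j = 0 := fun j => congrFun h3 j
  ext x
  induction x using WithTop.recTopCoe with
  | top => rw [← sub_eq_zero.mp h1, h4]; rfl
  | coe j => exact h4 j

/-! ### Comparison of weights along an inclusion of graphs -/

section Incl

variable {K : Type*} [Fintype K] [LinearOrder K] {H : PlumbingGraph K} {f : K ↪o J}

lemma extend_not_range (l : K → ℤ) {j : J} (hj : j ∉ Set.range f) :
    Function.extend f l 0 j = 0 :=
  Function.extend_apply' _ _ _ hj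

lemma extend_map (l : K → ℤ) (i : K) : Function.extend f l 0 (f i) = l i :=
  f.injective.extend_apply _ _ _

lemma mulVec_extend (hM : ∀ i j, H.mat i j = Γ.mat (f i) (f j)) (l : K → ℤ) (i : K) :
    Γ.mat.mulVec (Function.extend f l 0) (f i) = H.mat.mulVec l i := by
  symm
  refine Fintype.sum_of_injective f f.injective _ _ (fun j hj => ?_) fun j => ?_
  · rw [extend_not_range l hj, mul_zero]
  · change H.mat i j * l j = Γ.mat (f i) (f j) * Function.extend f l 0 (f j)
    rw [hM, extend_map]

lemma w_shift_extend (hΓ : Γ.Nondegenerate) (hH : H.Nondegenerate)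
    (hM : ∀ i j, H.mat i j = Γ.mat (f i) (f j)) (k : Γ.Char) (κ : H.Char)
    (hk : ∀ i, k.1 (f i) = κ.1 i) (l : K → ℤ) :
    Γ.w (k.shift (Function.extend f l 0)) = H.w (κ.shift l) + (Γ.w k - H.w κ) := by
  rw [w_shift _ hΓ, w_shift _ hH]
  have e1 : k.1 ⬝ᵥ (Function.extend f l 0) = κ.1 ⬝ᵥ l := by
    symm
    refine Fintype.sum_of_injective f f.injective _ _ (fun j hj => ?_) fun j => ?_
    · rw [extend_not_range l hj, mul_zero]
    · rw [hk, extend_map]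
  have e2 : (Function.extend f l 0) ⬝ᵥ (Γ.mat.mulVec (Function.extend f l 0))
      = l ⬝ᵥ (H.mat.mulVec l) := by
    symm
    refine Fintype.sum_of_injective f f.injective _ _ (fun j hj => ?_) fun j => ?_
    · rw [extend_not_range l hj, zero_mul]
    · rw [mulVec_extend hM, extend_map]
  rw [e1, e2]
  ring

lemma E_map (I : Finset K) : E (I.map f.toEmbedding) = Function.extend f (E I) 0 := by
  ext j
  by_cases hj : j ∈ Set.range f
  · obtain ⟨i, rfl⟩ := hj
    rw [extend_map]
    simp [E]
  · rw [extend_not_range _ hj, E, if_neg]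
    intro hj'
    obtain ⟨i, -, rfl⟩ := Finset.mem_map.mp hj'
    exact hj ⟨i, rfl⟩

lemma wCube_extend (hΓ : Γ.Nondegenerate) (hH : H.Nondegenerate)
    (hM : ∀ i j, H.mat i j = Γ.mat (f i) (f j)) (k : Γ.Char) (κ : H.Char)
    (hk : ∀ i, k.1 (f i) = κ.1 i) (l : K → ℤ) (I : Finset K) :
    Γ.wCube (k.shift (Function.extend f l 0), I.map f.toEmbedding)
      = H.wCube (κ.shift l, I) + (Γ.w k - H.w κ) := by
  have key : ∀ I' : Finset K,
      Γ.w ((k.shift (Function.extend f l 0)).shift (E (I'.map f.toEmbedding)))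
        = H.w ((κ.shift l).shift (E I')) + (Γ.w k - H.w κ) := by
    intro I'
    rw [Char.shift_shift, Char.shift_shift, ← w_shift_extend hΓ hH hM k κ hk, E_map]
    congr 2
    ext j
    by_cases hj : j ∈ Set.range f
    · obtain ⟨i, rfl⟩ := hj
      simp only [Pi.add_apply, extend_map]
    · simp only [Pi.add_apply, extend_not_range _ hj, add_zero]
  apply le_antisymm
  · refine Finset.sup'_le _ _ fun I' hI' => ?_
    obtain ⟨I'', hI'', rfl⟩ := Finset.subset_map_iff.mp (Finset.mem_powerset.mp hI')
    rw [key]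
    gcongr
    exact Finset.le_sup' (fun I' => H.w ((κ.shift l).shift (E I'))) (Finset.mem_powerset.mpr hI'')
  · rw [← le_sub_iff_add_le]
    refine Finset.sup'_le _ _ fun I' hI' => ?_
    rw [le_sub_iff_add_le, ← key]
    exact Finset.le_sup' (fun I' => Γ.w ((k.shift (Function.extend f l 0)).shift (E I')))
      (Finset.mem_powerset.mpr (Finset.map_subset_map.mpr (Finset.mem_powerset.mp hI')))

lemma sgn_map (I : Finset K) (i : K) : sgn (I.map f.toEmbedding) (f i) = sgn I i := by
  have : (I.map f.toEmbedding).filter (· ≤ f i) = (I.filter (· ≤ i)).map f.toEmbedding := by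
    ext j
    simp only [Finset.mem_filter, Finset.mem_map, RelEmbedding.coe_toEmbedding]
    constructor
    · rintro ⟨⟨a, ha, rfl⟩, h⟩
      exact ⟨a, ⟨ha, f.le_iff_le.mp h⟩, rfl⟩
    · rintro ⟨a, ⟨ha, h⟩, rfl⟩
      exact ⟨⟨a, ha, rfl⟩, f.le_iff_le.mpr h⟩
  rw [sgn, sgn, this, Finset.card_map]

lemma map_erase (I : Finset K) (i : K) :
    (I.erase i).map f.toEmbedding = (I.map f.toEmbedding).erase (f i) :=
  Finset.map_erase _ _ _

lemma E_singleton_map (i : K) : E ({f i} : Finset J) = Function.extend f (E {i}) 0 := by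
  rw [← E_map]
  rfl

end Incl

variable (Γ j₀)

/-! ### The operator `B̄` -/

/-- The inclusion of the vertices of `Γ∖j₀`. -/
abbrev inclDelete : {j : J // j ≠ j₀} ↪o J := OrderEmbedding.subtype _

/-- The integers `a` with `a ≡ e_{j₀} (mod 2)`. -/
abbrev Parity : Type := {a : ℤ // a ≡ Γ.e j₀ [ZMOD 2]}

variable {Γ j₀}

/-- The characteristic element `b(k) + a E_{j₀}^*` of `Γ`, where `b(∑ a_j E_{j,Γ∖j₀}^*) =
∑ a_j E_{j,Γ}^*`: its coordinates are those of `k`, together with the coordinate `a` at `j₀`. -/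
def Char.extendBy (k : (Γ.delete j₀).Char) (a : Γ.Parity j₀) : Γ.Char :=
  ⟨fun j => if hj : j ≠ j₀ then k.1 ⟨j, hj⟩ else a.1, by
    rw [isChar_iff]
    intro j
    by_cases hj : j = j₀
    · subst hj; simpa using a.2
    · rw [dif_pos hj]
      exact ((Γ.delete j₀).isChar_iff _).1 k.2 ⟨j, hj⟩⟩

lemma Char.extendBy_coe (k : (Γ.delete j₀).Char) (a : Γ.Parity j₀) (j : {j : J // j ≠ j₀}) :
    (k.extendBy a).1 j = k.1 j := by
  simp [extendBy, j.2]

lemma Char.extendBy_self (k : (Γ.delete j₀).Char) (a : Γ.Parity j₀) :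
    (k.extendBy a).1 j₀ = a := by
  simp [extendBy]

lemma Char.extendBy_injective :
    Function.Injective fun p : (Γ.delete j₀).Char × Γ.Parity j₀ => p.1.extendBy p.2 := by
  rintro ⟨k, a⟩ ⟨k', a'⟩ h
  have h' : (k.extendBy a).1 = (k'.extendBy a').1 := congrArg Subtype.val h
  refine Prod.ext (Char.ext (funext fun j => ?_)) (Subtype.ext ?_)
  · have := congrFun h' j
    rwa [extendBy_coe, extendBy_coe] at this
  · have := congrFun h' j₀
    rwa [extendBy_self, extendBy_self] at this

/-- Translation of the parameter `a` by an even number. -/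
def parityShift (n : ℤ) : Γ.Parity j₀ ≃ Γ.Parity j₀ where
  toFun a := ⟨a.1 - 2 * n, by
    have h := a.2
    rw [Int.ModEq] at h ⊢
    omega⟩
  invFun a := ⟨a.1 + 2 * n, by
    have h := a.2
    rw [Int.ModEq] at h ⊢
    omega⟩
  left_inv a := Subtype.ext (by simp)
  right_inv a := Subtype.ext (by simp)

lemma extend_inclDelete_self (l : {j : J // j ≠ j₀} → ℤ) :
    Function.extend (inclDelete j₀) l 0 j₀ = 0 :=
  extend_not_range l (by rintro ⟨i, hi⟩; exact i.2 hi)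

lemma Char.extendBy_shift (k : (Γ.delete j₀).Char) (a : Γ.Parity j₀) (i : {j : J // j ≠ j₀}) :
    (k.extendBy a).shift (E {(i : J)})
      = (k.shift (E {i})).extendBy (parityShift (Γ.mat j₀ i) a) := by
  have hE : ∀ j : J, Γ.mat.mulVec (E {(i : J)}) j = Γ.mat j i := by
    intro j
    have : E {(i : J)} = Pi.single (i : J) 1 := by
      ext m; simp [E, Pi.single_apply]
    rw [this, Matrix.mulVec_single_one]; rfl
  have hE' : ∀ j, (Γ.delete j₀).mat.mulVec (E {i}) j = Γ.mat j i := by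
    intro j
    have : E {i} = Pi.single i 1 := by
      ext m; simp [E, Pi.single_apply]
    rw [this, Matrix.mulVec_single_one]; exact delete_mat _ _ _ _
  apply Char.ext
  ext j
  by_cases hj : j = j₀
  · subst hj
    rw [extendBy_self]
    simp only [shift_val, Pi.add_apply, extendBy_self, toDual, Pi.smul_apply, Pi.neg_apply, hE,
      parityShift, Equiv.coe_fn_mk]
    simp only [nsmul_eq_mul]
    push_cast
    ring
  · have h1 := extendBy_coe (k.shift (E {i})) (parityShift (Γ.mat j₀ i) a) ⟨j, hj⟩
    have h2 := extendBy_coe k a ⟨j, hj⟩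
    simp only at h1 h2
    rw [h1]
    simp only [shift_val, Pi.add_apply, h2, toDual, Pi.smul_apply, Pi.neg_apply, hE, hE']

/-- The restriction `R(E_{j₀}) ∈ L'(Γ∖j₀)` of `E_{j₀}`. The restriction `R : L'(Γ) → L'(Γ∖j₀)`,
`E_{j,Γ}^* ↦ E_{j,Γ∖j₀}^*` for `j ≠ j₀` and `E_{j₀,Γ}^* ↦ 0`, forgets the coordinate at `j₀`. -/
def restrictE (Γ : PlumbingGraph J) (j₀ : J) : {j : J // j ≠ j₀} → ℤ :=
  fun j => Γ.toDual (E {j₀}) j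

/-- The number `n(k, a) = (k - r_{[k]}, R(E_{j₀})) + a + e_{j₀}`; it is an even integer if `r_{[k]}` is
a representative of the class `[k]`. -/
def signExponent (r : (Γ.delete j₀).CharClass → (Γ.delete j₀).Char) (k : (Γ.delete j₀).Char)
    (a : Γ.Parity j₀) : ℚ :=
  (Γ.delete j₀).dualForm (k.1 - (r ((Γ.delete j₀).charClass k)).1) (restrictE Γ j₀) + a.1 + Γ.e j₀

/-- The sign `(-1)^{n(k,a)/2}`. -/
def bSign (r : (Γ.delete j₀).CharClass → (Γ.delete j₀).Char) (k : (Γ.delete j₀).Char)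
    (a : Γ.Parity j₀) : ℤ :=
  ((Int.negOnePow ⌊signExponent r k a / 2⌋ : ℤˣ) : ℤ)

lemma bSign_shift (hdel : (Γ.delete j₀).Nondegenerate)
    (r : (Γ.delete j₀).CharClass → (Γ.delete j₀).Char) (k : (Γ.delete j₀).Char)
    (a : Γ.Parity j₀) (i : {j : J // j ≠ j₀}) :
    bSign r (k.shift (E {i})) (parityShift (Γ.mat j₀ i) a) = bSign r k a := by
  have hcl : (Γ.delete j₀).charClass (k.shift (E {i})) = (Γ.delete j₀).charClass k :=
    Quotient.sound (s := (Γ.delete j₀).charSetoid) (Setoid.symm' _ ⟨_, rfl⟩)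
  have hR : (Γ.delete j₀).dualForm ((Γ.delete j₀).toDual (E {i})) (restrictE Γ j₀)
      = Γ.mat j₀ i := by
    rw [dualForm_comm, dualForm_toDual _ hdel]
    have e1 : restrictE Γ j₀ ⬝ᵥ E {i} = restrictE Γ j₀ i := by
      have : E {i} = Pi.single i 1 := by
        ext m; simp [E, Pi.single_apply]
      rw [this]; simp
    have e2 : restrictE Γ j₀ i = -Γ.mat j₀ i := by
      have : E {j₀} = Pi.single j₀ 1 := by
        ext m; simp [E, Pi.single_apply]
      rw [restrictE, toDual, this, Matrix.mulVec_single_one, Pi.neg_apply, mat_symm]; rfl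
    rw [e1, e2]
    push_cast
    ring
  have : signExponent r (k.shift (E {i})) (parityShift (Γ.mat j₀ i) a) = signExponent r k a := by
    rw [signExponent, signExponent, hcl, Char.shift_val, add_sub_right_comm, dualForm_add_left,
      two_smul, dualForm_add_left, hR]
    simp only [parityShift, Equiv.coe_fn_mk]
    push_cast
    ring
  rw [bSign, bSign, this]

/-- The operator `(B̄^q φ)(k, I) = ∑_{a ≡ e_{j₀} (2)} (-1)^{n(k,a)/2} φ(b(k) + a E_{j₀}^*, I)`. The sum
is finite for `φ` of finite support. -/
def bFun (r : (Γ.delete j₀).CharClass → (Γ.delete j₀).Char) (φ : Γ.Cube → TPlus) :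
    (Γ.delete j₀).Cube → TPlus :=
  fun c => ∑ᶠ a : Γ.Parity j₀,
    bSign r c.1 a • φ (c.1.extendBy a, c.2.map (inclDelete j₀).toEmbedding)

lemma finite_support_smul {ι R : Type*} [SMulZeroClass R TPlus] {f : ι → TPlus}
    (hf : (Function.support f).Finite) (g : ι → R) :
    (Function.support fun a => g a • f a).Finite :=
  hf.subset fun a ha h => ha (by simp only [h, smul_zero])

lemma exists_of_finsum_ne_zero {ι : Type*} {f : ι → TPlus} (h : ∑ᶠ a, f a ≠ 0) :
    ∃ a, f a ≠ 0 := by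
  by_contra! hcon
  exact h (finsum_eq_zero_of_forall_eq_zero hcon)

lemma finite_extendBy {φ : Γ.Cube → TPlus} (hφ : (Function.support φ).Finite)
    (k : (Γ.delete j₀).Char) (I : Finset J) :
    (Function.support fun a : Γ.Parity j₀ => φ (k.extendBy a, I)).Finite := by
  refine hφ.preimage (f := fun a : Γ.Parity j₀ => ((k.extendBy a, I) : Γ.Cube)) fun a _ a' _ h => ?_
  have h1 : k.extendBy a = k.extendBy a' := congrArg Prod.fst h
  have := Char.extendBy_injective (a₁ := (k, a)) (a₂ := (k, a')) h1
  exact congrArg Prod.snd this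

lemma bFun_mem (r : (Γ.delete j₀).CharClass → (Γ.delete j₀).Char) {q : ℕ} {φ : Γ.Cube → TPlus}
    (hφ : φ ∈ Γ.cochains q) : bFun r φ ∈ (Γ.delete j₀).cochains q := by
  have key : ∀ c, bFun r φ c ≠ 0 →
      ∃ a : Γ.Parity j₀, φ (c.1.extendBy a, c.2.map (inclDelete j₀).toEmbedding) ≠ 0 := by
    intro c hc
    obtain ⟨a, ha⟩ := exists_of_finsum_ne_zero hc
    exact ⟨a, fun h => ha (by rw [h, smul_zero])⟩
  constructor
  · have hfin := hφ.1.preimage (f := fun p : (Γ.delete j₀).Cube × Γ.Parity j₀ =>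
      ((p.1.1.extendBy p.2, p.1.2.map (inclDelete j₀).toEmbedding) : Γ.Cube)) (by
        rintro ⟨⟨k, I⟩, a⟩ - ⟨⟨k', I'⟩, a'⟩ - h
        have h1 : k.extendBy a = k'.extendBy a' := congrArg Prod.fst h
        have h2 : I.map (inclDelete j₀).toEmbedding = I'.map (inclDelete j₀).toEmbedding :=
          congrArg Prod.snd h
        have h3 := Char.extendBy_injective (a₁ := (k, a)) (a₂ := (k', a')) h1
        rw [Prod.mk.injEq] at h3
        rw [h3.1, h3.2, Finset.map_injective _ h2])
    refine (hfin.image Prod.fst).subset fun c hc => ?_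
    obtain ⟨a, ha⟩ := key c hc
    exact ⟨(c, a), ha, rfl⟩
  · intro c hc
    obtain ⟨a, ha⟩ := key c hc
    rw [← hφ.2 _ ha, Finset.card_map]

/-- `B̄^q : ℱ^q(Γ) → ℱ^q(Γ∖j₀)`. -/
def bHom (r : (Γ.delete j₀).CharClass → (Γ.delete j₀).Char) (q : ℕ) :
    Γ.cochains q →ₗ[ℤ[X]] (Γ.delete j₀).cochains q where
  toFun φ := ⟨bFun r φ.1, bFun_mem r φ.2⟩
  map_add' φ ψ := by
    refine Subtype.ext (funext fun c => ?_)
    simp only [bFun, Submodule.coe_add, Pi.add_apply, smul_add]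
    exact finsum_add_distrib (finite_support_smul (finite_extendBy φ.2.1 c.1 _) _)
      (finite_support_smul (finite_extendBy ψ.2.1 c.1 _) _)
  map_smul' p φ := by
    refine Subtype.ext (funext fun c => ?_)
    simp only [bFun, Submodule.coe_smul, Pi.smul_apply, RingHom.id_apply]
    rw [smul_finsum' p (finite_support_smul (finite_extendBy φ.2.1 c.1 _) _)]
    exact finsum_congr fun a => smul_comm _ _ _

lemma deltaDir_bFun (hΓ : Γ.Nondegenerate) (hdel : (Γ.delete j₀).Nondegenerate)
    (r : (Γ.delete j₀).CharClass → (Γ.delete j₀).Char) {φ : Γ.Cube → TPlus}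
    (hφ : (Function.support φ).Finite) (k : (Γ.delete j₀).Char) (I : Finset {j : J // j ≠ j₀})
    (i : {j : J // j ≠ j₀}) :
    (Γ.delete j₀).deltaDir i (bFun r φ) (k, I) = ∑ᶠ a : Γ.Parity j₀, bSign r k a •
      Γ.deltaDir i φ (k.extendBy a, I.map (inclDelete j₀).toEmbedding) := by
  have hM : ∀ i j, (Γ.delete j₀).mat i j = Γ.mat (inclDelete j₀ i) (inclDelete j₀ j) :=
    Γ.delete_mat j₀
  have hw0 : ∀ (a : Γ.Parity j₀) (I' : Finset {j : J // j ≠ j₀}),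
      Γ.wCube (k.extendBy a, I'.map (inclDelete j₀).toEmbedding)
        = (Γ.delete j₀).wCube (k, I') + (Γ.w (k.extendBy a) - (Γ.delete j₀).w k) := by
    intro a I'
    have := wCube_extend hΓ hdel hM (k.extendBy a) k (k.extendBy_coe a) 0 I'
    rwa [Function.extend_zero, Char.shift_zero, Char.shift_zero] at this
  have hw1 : ∀ (a : Γ.Parity j₀) (I' : Finset {j : J // j ≠ j₀}),
      Γ.wCube ((k.extendBy a).shift (E {(i : J)}), I'.map (inclDelete j₀).toEmbedding)
        = (Γ.delete j₀).wCube (k.shift (E {i}), I')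
          + (Γ.w (k.extendBy a) - (Γ.delete j₀).w k) := by
    intro a I'
    have := wCube_extend hΓ hdel hM (k.extendBy a) k (k.extendBy_coe a) (E {i}) I'
    rwa [← E_singleton_map] at this
  rw [deltaDir_apply_of_mem_iff _ i _ k I (I.erase i) fun _ => Finset.mem_erase]
  have hf0 : (Function.support fun a : Γ.Parity j₀ =>
      bSign r k a • φ (k.extendBy a, (I.erase i).map (inclDelete j₀).toEmbedding)).Finite :=
    finite_support_smul (finite_extendBy hφ k _) _
  have hf1 : (Function.support fun a : Γ.Parity j₀ => bSign r k a •
      φ ((k.extendBy a).shift (E {(i : J)}),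
        (I.erase i).map (inclDelete j₀).toEmbedding)).Finite := by
    have h1 := finite_extendBy hφ (k.shift (E {i}))
      ((I.erase i).map (inclDelete j₀).toEmbedding)
    have h2 := h1.preimage (f := parityShift (Γ.mat j₀ i)) (Equiv.injective _).injOn
    refine h2.subset fun a ha h => ha ?_
    simp only at h
    simp only [Char.extendBy_shift, h, smul_zero]
  have e1 : bFun r φ (k.shift (E {i}), I.erase i) = ∑ᶠ a : Γ.Parity j₀, bSign r k a •
      φ ((k.extendBy a).shift (E {(i : J)}), (I.erase i).map (inclDelete j₀).toEmbedding) := by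
    rw [bFun, ← finsum_comp_equiv (parityShift (Γ.mat j₀ i))]
    refine finsum_congr fun a => ?_
    rw [bSign_shift hdel, Char.extendBy_shift]
  rw [e1, bFun, smul_finsum' _ hf0, smul_finsum' _ hf1, ← finsum_sub_distrib]
  · refine finsum_congr fun a => ?_
    rw [deltaDir_apply, hw0]
    have he : (I.map (inclDelete j₀).toEmbedding).erase (i : J)
        = (I.erase i).map (inclDelete j₀).toEmbedding := (map_erase I i).symm
    rw [he, hw0, hw1, add_sub_add_right_eq_sub, add_sub_add_right_eq_sub, smul_sub,
      smul_comm (bSign r k a), smul_comm (bSign r k a)]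
  · exact finite_support_smul hf0 _
  · exact finite_support_smul hf1 _

lemma delta_bFun (hΓ : Γ.Nondegenerate) (hdel : (Γ.delete j₀).Nondegenerate)
    (r : (Γ.delete j₀).CharClass → (Γ.delete j₀).Char) {q : ℕ} {φ : Γ.Cube → TPlus}
    (hφ : φ ∈ Γ.cochains q) : (Γ.delete j₀).delta (bFun r φ) = bFun r (Γ.delta φ) := by
  ext ⟨k, I⟩
  rw [delta_apply, bFun]
  simp only [delta_apply, Finset.sum_map, Finset.smul_sum]
  have hdir : ∀ i : {j : J // j ≠ j₀}, (Function.support fun a : Γ.Parity j₀ => bSign r k a •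
      Γ.deltaDir i φ (k.extendBy a, I.map (inclDelete j₀).toEmbedding)).Finite := by
    intro i
    have h1 := finite_extendBy hφ.1 k ((I.map (inclDelete j₀).toEmbedding).erase (i : J))
    have h2 := (finite_extendBy hφ.1 (k.shift (E {i}))
      ((I.map (inclDelete j₀).toEmbedding).erase (i : J))).preimage
        (f := parityShift (Γ.mat j₀ i)) (Equiv.injective _).injOn
    refine (h1.union h2).subset fun a ha => ?_
    by_contra hcon
    simp only [Set.mem_union, Function.mem_support, Set.mem_preimage, not_or, not_not] at hcon
    refine ha ?_
    simp only [deltaDir_apply, Char.extendBy_shift, hcon.1, hcon.2, smul_zero, sub_zero]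
  rw [finsum_sum_comm]
  · refine Finset.sum_congr rfl fun i _ => ?_
    rw [deltaDir_bFun hΓ hdel r hφ.1, smul_finsum' _ (hdir i)]
    refine finsum_congr fun a => ?_
    have hs : sgn (I.map (inclDelete j₀).toEmbedding) (i : J) = sgn I i :=
      sgn_map (f := inclDelete j₀) I i
    simp only [RelEmbedding.coe_toEmbedding, OrderEmbedding.subtype_apply, hs]
    exact smul_comm _ _ _
  · intro i _
    refine (hdir i).subset fun a ha h => ha ?_
    simp only [RelEmbedding.coe_toEmbedding, OrderEmbedding.subtype_apply]
    rw [smul_comm]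
    simp only at h
    rw [h, smul_zero]

/-- The morphism of complexes `B̄^* : ℱ^*(Γ) → ℱ^*(Γ∖j₀)` (for a choice `r` of representatives of the
classes of characteristic elements of `Γ∖j₀`). -/
def bMap (hΓ : Γ.Nondegenerate) (hdel : (Γ.delete j₀).Nondegenerate)
    (r : (Γ.delete j₀).CharClass → (Γ.delete j₀).Char) :
    Γ.cochainComplex ⟶ (Γ.delete j₀).cochainComplex :=
  CochainComplex.ofHom (fun q => ModuleCat.ofHom (bHom r q)) fun q => by
    rw [cochainComplex_d, cochainComplex_d]
    exact ModuleCat.hom_ext (LinearMap.ext fun φ => Subtype.ext (delta_bFun hΓ hdel r φ.2))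

/-! ### The operator `A` -/

/-- The inclusion of the vertices of `Γ` into the vertices of `Γ^b`. -/
abbrev inclAttach : J ↪o WithTop J := WithTop.coeOrderHom

/-- Odd integers. -/
abbrev OddInt : Type := {a : ℤ // Odd a}

variable (j₀) in
/-- The characteristic element `b(k) + a E_{new}^*` of `Γ^b`, for `k ∈ Char(Γ)` and `a` odd (the
operator `b` for the pair `Γ = Γ^b∖new`). -/
def Char.attachBy (k : Γ.Char) (a : OddInt) : (Γ.attach j₀).Char :=
  ⟨WithTop.recTopCoe a.1 k.1, by
    rw [isChar_iff]
    intro x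
    induction x using WithTop.recTopCoe with
    | top =>
      obtain ⟨m, hm⟩ := a.2
      change a.1 ≡ -1 [ZMOD 2]
      rw [Int.ModEq]
      omega
    | coe j => exact (Γ.isChar_iff _).1 k.2 j⟩

/-- The map `π_* : Char(Γ^b) → Char(Γ_{j₀}^+)` of blowing down the new vertex. Since
`(π_* x, E_j) = (x, π^* E_j)` with `π^* E_j = E_j` for `j ≠ j₀` and `π^* E_{j₀} = E_{j₀} + E_{new}`, it
maps `∑ a_j E_j^* + a E_{new}^*` to `∑ a_j E_j^* + a E_{j₀}^*`. -/
def Char.blowDown (k : (Γ.attach j₀).Char) : (Γ.incr j₀).Char :=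
  ⟨fun j => k.1 j + if j = j₀ then k.1 ⊤ else 0, by
    rw [isChar_iff]
    intro j
    have h1 := ((Γ.attach j₀).isChar_iff _).1 k.2 j
    have h2 := ((Γ.attach j₀).isChar_iff _).1 k.2 ⊤
    change k.1 j ≡ Γ.e j [ZMOD 2] at h1
    change k.1 ⊤ ≡ -1 [ZMOD 2] at h2
    by_cases hj : j = j₀
    · subst hj
      simp only [incr, Function.update_self, if_true]
      rw [Int.ModEq] at *
      omega
    · simpa only [incr, Function.update_of_ne hj, hj, if_false, add_zero] using h1⟩

lemma Char.blowDown_apply (k : (Γ.attach j₀).Char) (j : J) :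
    k.blowDown.1 j = k.1 j + if j = j₀ then k.1 ⊤ else 0 := rfl

lemma Char.attachBy_top (k : Γ.Char) (a : OddInt) : (k.attachBy j₀ a).1 ⊤ = a.1 := rfl

lemma Char.attachBy_coe (k : Γ.Char) (a : OddInt) (j : J) :
    (k.attachBy j₀ a).1 (inclAttach j) = k.1 j := rfl

/-- Translation of the parameter `a` by an even number. -/
def oddShift (n : ℤ) : OddInt ≃ OddInt where
  toFun a := ⟨a.1 - 2 * n, by
    obtain ⟨m, hm⟩ := a.2
    exact ⟨m - n, by omega⟩⟩
  invFun a := ⟨a.1 + 2 * n, by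
    obtain ⟨m, hm⟩ := a.2
    exact ⟨m + n, by omega⟩⟩
  left_inv a := Subtype.ext (by simp)
  right_inv a := Subtype.ext (by simp)

lemma extend_inclAttach_top (l : J → ℤ) : Function.extend inclAttach l 0 ⊤ = 0 :=
  extend_not_range l (by rintro ⟨i, hi⟩; exact WithTop.coe_ne_top hi)

lemma extend_inclAttach_coe (l : J → ℤ) (j : J) :
    Function.extend inclAttach l 0 (j : WithTop J) = l j :=
  extend_map (f := inclAttach) l j

lemma attach_mat_mulVec_extend_top (l : J → ℤ) :
    (Γ.attach j₀).mat.mulVec (Function.extend inclAttach l 0) ⊤ = l j₀ := by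
  simp only [Matrix.mulVec, dotProduct, sum_withTop, extend_inclAttach_top, extend_inclAttach_coe,
    attach_mat_top_coe]
  simp

lemma attach_mat_mulVec_extend_coe (l : J → ℤ) (j : J) :
    (Γ.attach j₀).mat.mulVec (Function.extend inclAttach l 0) (j : WithTop J)
      = Γ.mat.mulVec l j :=
  mulVec_extend (f := inclAttach) (fun i j => (Γ.attach_mat_coe j₀ i j).symm) l j

lemma Char.attachBy_shift (k : Γ.Char) (a : OddInt) (l : J → ℤ) :
    (k.attachBy j₀ a).shift (Function.extend inclAttach l 0)
      = (k.shift l).attachBy j₀ (oddShift (l j₀) a) := by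
  apply Char.ext
  ext x
  induction x using WithTop.recTopCoe with
  | top =>
    rw [attachBy_top, shift_apply, attachBy_top, attach_mat_mulVec_extend_top]
    rfl
  | coe j =>
    have h1 := attachBy_coe (j₀ := j₀) (k.shift l) (oddShift (l j₀) a) j
    have h2 := attachBy_coe (j₀ := j₀) k a j
    rw [WithTop.coeOrderHom_apply] at h1 h2
    rw [h1, shift_apply, shift_apply, h2, attach_mat_mulVec_extend_coe]

lemma Char.blowDown_shift (k : (Γ.attach j₀).Char) (l : J → ℤ) :
    (k.shift (Function.extend inclAttach l 0)).blowDown = k.blowDown.shift l := by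
  apply Char.ext
  ext j
  simp only [blowDown_apply, shift_apply, attach_mat_mulVec_extend_top,
    attach_mat_mulVec_extend_coe, incr_mat_mulVec]
  by_cases hj : j = j₀
  · simp only [hj, if_true]; ring
  · simp only [hj, if_false]; ring

lemma w_attach (h : (Γ.incr j₀).Nondegenerate) (k : (Γ.attach j₀).Char) :
    (Γ.attach j₀).w k = (Γ.incr j₀).w k.blowDown + (((k.1 ⊤ : ℤ) : ℚ) ^ 2 - 1) / 8 := by
  set u : J → ℚ := (Γ.incr j₀).matQ⁻¹.mulVec fun j => (k.blowDown.1 j : ℚ) with hu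
  have hMu : (Γ.incr j₀).matQ.mulVec u = fun j => (k.blowDown.1 j : ℚ) := by
    rw [hu, Matrix.mulVec_mulVec, Matrix.mul_nonsing_inv _ (isUnit_iff_ne_zero.mpr h),
      Matrix.one_mulVec]
  set v : WithTop J → ℚ := WithTop.recTopCoe (u j₀ - k.1 ⊤) u with hv
  have hvt : v ⊤ = u j₀ - k.1 ⊤ := rfl
  have hvc : ∀ j : J, v j = u j := fun j => rfl
  have hbd : ∀ j, k.blowDown.1 j = k.1 j + if j = j₀ then k.1 ⊤ else 0 := fun j => rfl
  have hMv : (Γ.attach j₀).matQ.mulVec v = fun x => (k.1 x : ℚ) := by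
    ext x
    induction x using WithTop.recTopCoe with
    | top => rw [attach_matQ_mulVec_top, hvt, hvc]; ring
    | coe j =>
      have h1 := congrFun hMu j
      simp only [incr_matQ_mulVec, hbd] at h1
      rw [attach_matQ_mulVec_coe]
      simp only [hvc, hvt]
      by_cases hj : j = j₀
      · simp only [hj, if_true] at h1 ⊢; push_cast at h1; linarith
      · simp only [hj, if_false] at h1 ⊢; push_cast at h1; linarith
  have e1 := (Γ.attach j₀).dualForm_eq (Nondegenerate.attach h) k.1 k.1 v hMv
  have e2 := (Γ.incr j₀).dualForm_eq h k.blowDown.1 k.blowDown.1 u hMu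
  have e3 : (fun x => (k.1 x : ℚ)) ⬝ᵥ v
      = (fun j => (k.blowDown.1 j : ℚ)) ⬝ᵥ u - ((k.1 ⊤ : ℤ) : ℚ) ^ 2 := by
    have : ∀ j : J, ((k.1 j + if j = j₀ then k.1 ⊤ else 0 : ℤ) : ℚ) * u j
        = (k.1 j : ℚ) * u j + if j = j₀ then (k.1 ⊤ : ℚ) * u j else 0 := by
      intro j
      by_cases hj : j = j₀ <;> simp [hj, add_mul]
    simp only [dotProduct, sum_withTop, hvt, hvc, hbd, this, Finset.sum_add_distrib]
    simp
    ring
  have hc : (Fintype.card (WithTop J) : ℚ) = Fintype.card J + 1 := by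
    have : Fintype.card (WithTop J) = Fintype.card J + 1 := Fintype.card_option
    rw [this]; push_cast; rfl
  rw [w, w, e1, e2, e3, hc]
  ring

/-- The exponent `w_{Γ^b}(k', I) - w_{Γ^+}(π_*(k'), I)` for `k' = b(k) + a E_{new}^*`. -/
def aExp (j₀ : J) (k : Γ.Char) (a : OddInt) (I : Finset J) : ℚ :=
  (Γ.attach j₀).wCube (k.attachBy j₀ a, I.map inclAttach.toEmbedding)
    - (Γ.incr j₀).wCube ((k.attachBy j₀ a).blowDown, I)

lemma odd_sq (a : OddInt) : ∃ n : ℕ, (((a.1 : ℤ) : ℚ) ^ 2 - 1) / 8 = n := by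
  obtain ⟨m, hm⟩ := a.2
  obtain ⟨c, hc⟩ := Int.even_mul_succ_self m
  have hc0 : 0 ≤ c := by
    rcases le_or_gt 0 m with h | h <;> nlinarith
  lift c to ℕ using hc0
  refine ⟨c, ?_⟩
  have hc' : (m : ℚ) * (m + 1) = c + c := by exact_mod_cast hc
  rw [hm]
  push_cast
  linarith

lemma w_attachBy_shift (h : (Γ.incr j₀).Nondegenerate) (k : Γ.Char) (a : OddInt) (l : J → ℤ) :
    (Γ.attach j₀).w ((k.attachBy j₀ a).shift (Function.extend inclAttach l 0))
      = (Γ.incr j₀).w ((k.attachBy j₀ a).blowDown.shift l)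
        + ((((oddShift (l j₀) a).1 : ℤ) : ℚ) ^ 2 - 1) / 8 := by
  rw [w_attach h, Char.blowDown_shift, Char.attachBy_shift, Char.attachBy_top]

lemma aExp_ge (h : (Γ.incr j₀).Nondegenerate) (k : Γ.Char) (a : OddInt) (I : Finset J) :
    ∃ n : ℤ, (n = 0 ∨ n = 1) ∧ ((((oddShift n a).1 : ℤ) : ℚ) ^ 2 - 1) / 8 ≤ aExp j₀ k a I := by
  obtain ⟨I', hI', he⟩ := Finset.exists_mem_eq_sup' (s := I.powerset)
    ⟨∅, Finset.empty_mem_powerset _⟩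
    fun I' => (Γ.incr j₀).w ((k.attachBy j₀ a).blowDown.shift (E I'))
  refine ⟨E I' j₀, ?_, ?_⟩
  · by_cases hj : j₀ ∈ I' <;> simp [E, hj]
  · have h1 := w_attachBy_shift h k a (E I')
    have h2 : (Γ.attach j₀).w ((k.attachBy j₀ a).shift (Function.extend inclAttach (E I') 0))
        ≤ (Γ.attach j₀).wCube (k.attachBy j₀ a, I.map inclAttach.toEmbedding) := by
      rw [← E_map]
      exact Finset.le_sup' (fun I' => (Γ.attach j₀).w ((k.attachBy j₀ a).shift (E I')))
        (Finset.mem_powerset.mpr (Finset.map_subset_map.mpr (Finset.mem_powerset.mp hI')))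
    have h3 : (Γ.incr j₀).wCube ((k.attachBy j₀ a).blowDown, I)
        = (Γ.incr j₀).w ((k.attachBy j₀ a).blowDown.shift (E I')) := he
    rw [aExp, h3]
    linarith

lemma aExp_nonneg (h : (Γ.incr j₀).Nondegenerate) (k : Γ.Char) (a : OddInt) (I : Finset J) :
    0 ≤ aExp j₀ k a I := by
  obtain ⟨n, -, hn⟩ := aExp_ge h k a I
  obtain ⟨m, hm⟩ := odd_sq (oddShift n a)
  rw [hm] at hn
  exact le_trans (Nat.cast_nonneg m) hn

lemma aExp_int (h : (Γ.incr j₀).Nondegenerate) (k : Γ.Char) (a : OddInt) (I : Finset J) :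
    ∃ n : ℤ, aExp j₀ k a I = n := by
  obtain ⟨m, hm⟩ := (Γ.attach j₀).wCube_sub_w_int (k.attachBy j₀ a) 0
    (I.map inclAttach.toEmbedding)
  obtain ⟨n, hn⟩ := (Γ.incr j₀).wCube_sub_w_int (k.attachBy j₀ a).blowDown 0 I
  obtain ⟨t, ht⟩ := odd_sq a
  have h1 := w_attach h (k.attachBy j₀ a)
  rw [Char.attachBy_top, ht] at h1
  rw [Char.shift_zero] at hm hn
  refine ⟨m - n + t, ?_⟩
  rw [aExp]
  push_cast
  linarith

lemma aExp_eq (h : (Γ.incr j₀).Nondegenerate) (k : Γ.Char) (a : OddInt) {I : Finset J}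
    (hI : j₀ ∉ I) : aExp j₀ k a I = (((a.1 : ℤ) : ℚ) ^ 2 - 1) / 8 := by
  have key : ∀ I' ⊆ I, (Γ.attach j₀).w ((k.attachBy j₀ a).shift (E (I'.map inclAttach.toEmbedding)))
      = (Γ.incr j₀).w ((k.attachBy j₀ a).blowDown.shift (E I'))
        + (((a.1 : ℤ) : ℚ) ^ 2 - 1) / 8 := by
    intro I' hI'
    have h0 : E I' j₀ = 0 := if_neg fun hj => hI (hI' hj)
    rw [E_map, w_attachBy_shift h, h0]
    simp [oddShift]
  rw [aExp, sub_eq_iff_eq_add']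
  apply le_antisymm
  · refine Finset.sup'_le _ _ fun I' hI' => ?_
    obtain ⟨I'', hI'', rfl⟩ := Finset.subset_map_iff.mp (Finset.mem_powerset.mp hI')
    rw [key _ hI'']
    gcongr
    exact Finset.le_sup' (fun I' => (Γ.incr j₀).w ((k.attachBy j₀ a).blowDown.shift (E I')))
      (Finset.mem_powerset.mpr hI'')
  · rw [← le_sub_iff_add_le]
    refine Finset.sup'_le _ _ fun I' hI' => ?_
    rw [le_sub_iff_add_le, ← key _ (Finset.mem_powerset.mp hI')]
    exact Finset.le_sup' (fun I' => (Γ.attach j₀).w ((k.attachBy j₀ a).shift (E I')))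
      (Finset.mem_powerset.mpr (Finset.map_subset_map.mpr (Finset.mem_powerset.mp hI')))

lemma finite_aExp_lt (h : (Γ.incr j₀).Nondegenerate) (N : ℕ) :
    {a : OddInt | ∃ (k : Γ.Char) (I : Finset J), aExp j₀ k a I < N}.Finite := by
  have hfin : (Set.Icc (-(8 * N + 10) : ℤ) (8 * N + 10)).Finite := Set.finite_Icc _ _
  refine Set.Finite.of_finite_image (f := Subtype.val) (hfin.subset ?_) Subtype.val_injective.injOn
  rintro _ ⟨a, ⟨k, I, hlt⟩, rfl⟩
  obtain ⟨n, hn, hle⟩ := aExp_ge h k a I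
  have h1 : (((oddShift n a).1 : ℤ) : ℚ) ^ 2 < 8 * N + 1 := by linarith
  have h2 : (a.1 - 2 * n) ^ 2 < 8 * (N : ℤ) + 1 := by
    have : (oddShift n a).1 = a.1 - 2 * n := rfl
    rw [this] at h1
    exact_mod_cast h1
  have hN : (0 : ℤ) ≤ N := Int.natCast_nonneg N
  constructor
  · by_contra hcon
    rcases hn with rfl | rfl <;> nlinarith
  · by_contra hcon
    rcases hn with rfl | rfl <;> nlinarith

lemma exists_pow_smul_eq_zero {ι : Type*} {φ : ι → TPlus} (hφ : (Function.support φ).Finite) :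
    ∃ N : ℕ, ∀ c, (X ^ N : ℤ[X]) • φ c = 0 := by
  choose N hN using fun c => TPlus.exists_pow_smul_eq_zero (φ c)
  obtain ⟨M, hM⟩ := (hφ.image N).bddAbove
  refine ⟨M, fun c => ?_⟩
  by_cases hc : φ c = 0
  · rw [hc, smul_zero]
  · exact pow_smul_eq_zero_of_le (hN c) (hM ⟨c, hc, rfl⟩)

/-- The operator `A^q`, i.e. the composition of `φ ↦ φ ∘ π_*^h` and `φ ↦ φ ∘ B_q` through the complex of
`Γ^b`: `(A^q φ)(k, I) = ∑_{a odd} U^{w_{Γ^b}(k_a, I) - w_{Γ^+}(π_*(k_a), I)} φ(π_*(k_a), I)`, where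
`k_a = b(k) + a E_{new}^*`. The sum is finite for `φ` of finite support. -/
def aFun (φ : (Γ.incr j₀).Cube → TPlus) : Γ.Cube → TPlus :=
  fun c => ∑ᶠ a : OddInt, uPow (aExp j₀ c.1 a c.2) • φ ((c.1.attachBy j₀ a).blowDown, c.2)

lemma Char.blowDown_attachBy_injective (a : OddInt) :
    Function.Injective fun k : Γ.Char => (k.attachBy j₀ a).blowDown := by
  intro k k' h
  apply Char.ext
  ext j
  have h1 := congrFun (congrArg Subtype.val h) j
  simp only [blowDown_apply, attachBy_top, add_left_inj] at h1
  exact h1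

lemma finite_blowDown {φ : (Γ.incr j₀).Cube → TPlus} (hφ : (Function.support φ).Finite)
    (k : Γ.Char) (I : Finset J) :
    (Function.support fun a : OddInt => φ ((k.attachBy j₀ a).blowDown, I)).Finite := by
  refine hφ.preimage
    (f := fun a : OddInt => (((k.attachBy j₀ a).blowDown, I) : (Γ.incr j₀).Cube))
    fun a _ a' _ h => ?_
  have h1 : (k.attachBy j₀ a).blowDown = (k.attachBy j₀ a').blowDown := congrArg Prod.fst h
  have h2 : (k.attachBy j₀ a).blowDown.1 j₀ = (k.attachBy j₀ a').blowDown.1 j₀ := by rw [h1]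
  have h3 : ∀ a : OddInt, (k.attachBy j₀ a).blowDown.1 j₀ = k.1 j₀ + a.1 := by
    intro a
    change k.1 j₀ + (if j₀ = j₀ then a.1 else 0) = _
    rw [if_pos rfl]
  rw [h3, h3] at h2
  exact Subtype.ext (add_left_cancel h2)

lemma aFun_mem (h : (Γ.incr j₀).Nondegenerate) {q : ℕ} {φ : (Γ.incr j₀).Cube → TPlus}
    (hφ : φ ∈ (Γ.incr j₀).cochains q) : aFun φ ∈ Γ.cochains q := by
  have key : ∀ c, aFun φ c ≠ 0 → ∃ a : OddInt,
      uPow (aExp j₀ c.1 a c.2) • φ ((c.1.attachBy j₀ a).blowDown, c.2) ≠ 0 :=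
    fun c hc => exists_of_finsum_ne_zero hc
  constructor
  · obtain ⟨N, hN⟩ := exists_pow_smul_eq_zero hφ.1
    have hfin : (⋃ a ∈ {a : OddInt | ∃ (k : Γ.Char) (I : Finset J), aExp j₀ k a I < N},
        (fun c : Γ.Cube => (((c.1.attachBy j₀ a).blowDown, c.2) : (Γ.incr j₀).Cube)) ⁻¹'
          Function.support φ).Finite := by
      refine (finite_aExp_lt h N).biUnion fun a _ => hφ.1.preimage ?_
      rintro ⟨k, I⟩ - ⟨k', I'⟩ - heq
      have h1 := Char.blowDown_attachBy_injective a (congrArg Prod.fst heq)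
      have h2 : I = I' := congrArg Prod.snd heq
      exact Prod.ext h1 h2
    refine hfin.subset fun c hc => ?_
    obtain ⟨a, ha⟩ := key c hc
    simp only [Set.mem_iUnion]
    refine ⟨a, ⟨c.1, c.2, ?_⟩, fun h0 => ha ?_⟩
    · by_contra hge
      exact ha (pow_smul_eq_zero_of_le (hN _) (Nat.le_floor (not_lt.mp hge)))
    · simp only at h0
      rw [h0, smul_zero]
  · intro c hc
    obtain ⟨a, ha⟩ := key c hc
    exact hφ.2 ((c.1.attachBy j₀ a).blowDown, c.2) fun h0 => ha (by rw [h0, smul_zero])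

/-- `A^q : ℱ^q(Γ_{j₀}^+) → ℱ^q(Γ)`. -/
def aHom (h : (Γ.incr j₀).Nondegenerate) (q : ℕ) :
    (Γ.incr j₀).cochains q →ₗ[ℤ[X]] Γ.cochains q where
  toFun φ := ⟨aFun φ.1, aFun_mem h φ.2⟩
  map_add' φ ψ := by
    refine Subtype.ext (funext fun c => ?_)
    simp only [aFun, Submodule.coe_add, Pi.add_apply, smul_add]
    exact finsum_add_distrib (finite_support_smul (finite_blowDown φ.2.1 c.1 _) _)
      (finite_support_smul (finite_blowDown ψ.2.1 c.1 _) _)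
  map_smul' p φ := by
    refine Subtype.ext (funext fun c => ?_)
    simp only [aFun, Submodule.coe_smul, Pi.smul_apply, RingHom.id_apply]
    rw [smul_finsum' p (finite_support_smul (finite_blowDown φ.2.1 c.1 _) _)]
    exact finsum_congr fun a => smul_comm _ _ _

lemma deltaDir_aFun (hΓ : Γ.Nondegenerate) (h : (Γ.incr j₀).Nondegenerate)
    {φ : (Γ.incr j₀).Cube → TPlus} (hφ : (Function.support φ).Finite) (k : Γ.Char)
    {I : Finset J} {i : J} (hi : i ∈ I) :
    Γ.deltaDir i (aFun φ) (k, I) = ∑ᶠ a : OddInt, uPow (aExp j₀ k a I) •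
      (Γ.incr j₀).deltaDir i φ ((k.attachBy j₀ a).blowDown, I) := by
  have hb := Nondegenerate.attach h
  have hM : ∀ i j, Γ.mat i j = (Γ.attach j₀).mat (inclAttach i) (inclAttach j) :=
    fun i j => (Γ.attach_mat_coe j₀ i j).symm
  have hw : ∀ (a : OddInt) (l : J → ℤ) (I' : Finset J),
      (Γ.attach j₀).wCube ((k.shift l).attachBy j₀ (oddShift (l j₀) a),
        I'.map inclAttach.toEmbedding)
        = Γ.wCube (k.shift l, I') + ((Γ.attach j₀).w (k.attachBy j₀ a) - Γ.w k) := by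
    intro a l I'
    rw [← Char.attachBy_shift]
    exact wCube_extend hb hΓ hM (k.attachBy j₀ a) k (k.attachBy_coe a) l I'
  have hw0 : ∀ (a : OddInt) (I' : Finset J),
      (Γ.attach j₀).wCube (k.attachBy j₀ a, I'.map inclAttach.toEmbedding)
        = Γ.wCube (k, I') + ((Γ.attach j₀).w (k.attachBy j₀ a) - Γ.w k) := by
    intro a I'
    have := wCube_extend hb hΓ hM (k.attachBy j₀ a) k (k.attachBy_coe a) 0 I'
    rwa [Function.extend_zero, Char.shift_zero, Char.shift_zero] at this
  set σ : OddInt ≃ OddInt := oddShift (E {i} j₀) with hσ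
  have hbs : ∀ a, ((k.shift (E {i})).attachBy j₀ (σ a)).blowDown
      = (k.attachBy j₀ a).blowDown.shift (E {i}) := by
    intro a
    rw [← Char.blowDown_shift, Char.attachBy_shift]
  have hf0 := finite_support_smul (finite_blowDown hφ k (I.erase i))
    fun a => uPow (aExp j₀ k a (I.erase i))
  have hf1 : (Function.support fun a : OddInt =>
      uPow (aExp j₀ (k.shift (E {i})) (σ a) (I.erase i)) •
        φ ((k.attachBy j₀ a).blowDown.shift (E {i}), I.erase i)).Finite := by
    refine finite_support_smul ?_ _
    have := (finite_blowDown hφ (k.shift (E {i})) (I.erase i)).preimage (f := σ)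
      σ.injective.injOn
    refine this.subset fun a ha h0 => ha ?_
    simp only [hbs] at h0
    exact h0
  have e1 : aFun φ (k.shift (E {i}), I.erase i) = ∑ᶠ a : OddInt,
      uPow (aExp j₀ (k.shift (E {i})) (σ a) (I.erase i)) •
        φ ((k.attachBy j₀ a).blowDown.shift (E {i}), I.erase i) := by
    rw [aFun, ← finsum_comp_equiv σ]
    refine finsum_congr fun a => ?_
    rw [hbs]
  have a0 : ∀ {Δ : PlumbingGraph J} (k : Δ.Char), 0 ≤ Δ.wCube (k, I) - Δ.wCube (k, I.erase i) :=
    fun k => sub_nonneg.mpr (wCube_mono _ k (Finset.erase_subset _ _))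
  have a1 : ∀ {Δ : PlumbingGraph J} (k : Δ.Char),
      0 ≤ Δ.wCube (k, I) - Δ.wCube (k.shift (E {i}), I.erase i) :=
    fun k => sub_nonneg.mpr (wCube_shift_le _ k hi)
  have b0 : ∀ {Δ : PlumbingGraph J} (k : Δ.Char),
      ∃ n : ℤ, Δ.wCube (k, I) - Δ.wCube (k, I.erase i) = n := by
    intro Δ k
    simpa [Char.shift_zero] using Δ.wCube_sub_int k 0 I (I.erase i)
  have b1 : ∀ {Δ : PlumbingGraph J} (k : Δ.Char),
      ∃ n : ℤ, Δ.wCube (k, I) - Δ.wCube (k.shift (E {i}), I.erase i) = n :=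
    fun {Δ} k => Δ.wCube_sub_int k (E {i}) I (I.erase i)
  rw [deltaDir_apply, e1, aFun, smul_finsum' _ hf0, smul_finsum' _ hf1, ← finsum_sub_distrib]
  · refine finsum_congr fun a => ?_
    rw [deltaDir_apply, smul_sub]
    simp only [smul_smul]
    rw [uPow_mul (a0 _) (aExp_nonneg h _ _ _) (b0 _) (aExp_int h _ _ _),
      uPow_mul (a1 _) (aExp_nonneg h _ _ _) (b1 _) (aExp_int h _ _ _),
      uPow_mul (aExp_nonneg h _ _ _) (a0 _) (aExp_int h _ _ _) (b0 _),
      uPow_mul (aExp_nonneg h _ _ _) (a1 _) (aExp_int h _ _ _) (b1 _)]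
    congr 3
    · rw [aExp, aExp, hw0, hw0]
      ring
    · rw [aExp, aExp, hbs, hσ, hw, hw0]
      ring
  · exact finite_support_smul hf0 _
  · exact finite_support_smul hf1 _

lemma delta_aFun (hΓ : Γ.Nondegenerate) (h : (Γ.incr j₀).Nondegenerate) {q : ℕ}
    {φ : (Γ.incr j₀).Cube → TPlus} (hφ : φ ∈ (Γ.incr j₀).cochains q) :
    Γ.delta (aFun φ) = aFun ((Γ.incr j₀).delta φ) := by
  ext ⟨k, I⟩
  rw [delta_apply, aFun]
  simp only [delta_apply, Finset.smul_sum]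
  have hdir : ∀ i : J, (Function.support fun a : OddInt => uPow (aExp j₀ k a I) •
      (Γ.incr j₀).deltaDir i φ ((k.attachBy j₀ a).blowDown, I)).Finite := by
    intro i
    refine finite_support_smul ?_ _
    have h1 := finite_blowDown hφ.1 k (I.erase i)
    have h2 := (finite_blowDown hφ.1 (k.shift (E {i})) (I.erase i)).preimage
      (f := oddShift (E {i} j₀)) (Equiv.injective _).injOn
    refine (h1.union h2).subset fun a ha => ?_
    by_contra hcon
    simp only [Set.mem_union, Function.mem_support, Set.mem_preimage, not_or, not_not,
      ← Char.attachBy_shift, Char.blowDown_shift] at hcon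
    refine ha ?_
    simp only [deltaDir_apply, hcon.1, hcon.2, smul_zero, sub_zero]
  rw [finsum_sum_comm]
  · refine Finset.sum_congr rfl fun i hi => ?_
    rw [deltaDir_aFun hΓ h hφ.1 k hi, smul_finsum' _ (hdir i)]
    exact finsum_congr fun a => smul_comm _ _ _
  · intro i _
    have := finite_support_smul (hdir i) fun _ => sgn I i
    refine this.subset fun a ha h0 => ha ?_
    simp only at h0 ⊢
    rw [smul_comm]
    exact h0

/-- The morphism of complexes `A^* : ℱ^*(Γ_{j₀}^+) → ℱ^*(Γ)`. -/
def aMap (hΓ : Γ.Nondegenerate) (h : (Γ.incr j₀).Nondegenerate) :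
    (Γ.incr j₀).cochainComplex ⟶ Γ.cochainComplex :=
  CochainComplex.ofHom (fun q => ModuleCat.ofHom (aHom h q)) fun q => by
    rw [cochainComplex_d, cochainComplex_d]
    exact ModuleCat.hom_ext (LinearMap.ext fun φ => Subtype.ext (delta_aFun hΓ h φ.2))

/-! ### The surgery sequence -/

lemma bFun_aFun (h : (Γ.incr j₀).Nondegenerate)
    (r : (Γ.delete j₀).CharClass → (Γ.delete j₀).Char) {q : ℕ} {φ : (Γ.incr j₀).Cube → TPlus}
    (hφ : φ ∈ (Γ.incr j₀).cochains q) : bFun r (aFun φ) = 0 := by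
  ext ⟨k, I⟩
  set I' : Finset J := I.map (inclDelete j₀).toEmbedding with hI'
  have hj₀ : j₀ ∉ I' := by
    intro hj
    obtain ⟨i, -, hi⟩ := Finset.mem_map.mp hj
    exact i.2 hi
  set F : Γ.Parity j₀ × OddInt → TPlus := fun p => bSign r k p.1 •
    uPow (aExp j₀ (k.extendBy p.1) p.2 I') • φ (((k.extendBy p.1).attachBy j₀ p.2).blowDown, I')
    with hF
  have hbd : ∀ (c : Γ.Parity j₀) (a : OddInt) (j : J),
      ((k.extendBy c).attachBy j₀ a).blowDown.1 j
        = if j = j₀ then c.1 + a.1 else (k.extendBy c).1 j := by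
    intro c a j
    rw [Char.blowDown_apply, Char.attachBy_top]
    change (k.extendBy c).1 j + _ = _
    by_cases hj : j = j₀
    · subst hj
      simp only [if_true, Char.extendBy_self]
    · simp only [hj, if_false, add_zero]
  obtain ⟨N, hN⟩ := exists_pow_smul_eq_zero hφ.1
  have hfin : (Function.support F).Finite := by
    have h1 : (⋃ a ∈ {a : OddInt | ∃ (k : Γ.Char) (I : Finset J), aExp j₀ k a I < N},
        (fun c : Γ.Parity j₀ => (c, a)) '' ((fun c : Γ.Parity j₀ =>
          ((((k.extendBy c).attachBy j₀ a).blowDown, I') : (Γ.incr j₀).Cube)) ⁻¹'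
            Function.support φ)).Finite := by
      refine (finite_aExp_lt h N).biUnion fun a _ => (hφ.1.preimage ?_).image _
      intro c _ c' _ heq
      have h1 : ((k.extendBy c).attachBy j₀ a).blowDown.1 j₀
          = ((k.extendBy c').attachBy j₀ a).blowDown.1 j₀ := by
        exact congrFun (congrArg Subtype.val (congrArg Prod.fst heq)) j₀
      rw [hbd, hbd, if_pos rfl, if_pos rfl] at h1
      exact Subtype.ext (add_right_cancel h1)
    refine h1.subset ?_
    rintro ⟨c, a⟩ hc
    simp only [Set.mem_iUnion]
    refine ⟨a, ⟨k.extendBy c, I', ?_⟩, c, fun h0 => hc ?_, rfl⟩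
    · by_contra hge
      refine hc ?_
      have : uPow (aExp j₀ (k.extendBy c) a I') •
          φ (((k.extendBy c).attachBy j₀ a).blowDown, I') = 0 :=
        pow_smul_eq_zero_of_le (hN _) (Nat.le_floor (not_lt.mp hge))
      simp only [hF, this, smul_zero]
    · simp only at h0
      simp only [hF, h0, smul_zero]
  have e1 : bFun r (aFun φ) (k, I) = ∑ᶠ p, F p := by
    rw [finsum_curry F hfin, bFun]
    refine finsum_congr fun c => ?_
    rw [aFun, smul_finsum' _ (finite_support_smul (finite_blowDown hφ.1 _ _) _)]
  rw [e1, Pi.zero_apply, finsum_eq_sum F hfin]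
  set σ : Γ.Parity j₀ × OddInt → Γ.Parity j₀ × OddInt := fun p =>
    (⟨p.1.1 + 2 * p.2.1, by
      have h := p.1.2
      rw [Int.ModEq] at h ⊢
      omega⟩, ⟨-p.2.1, p.2.2.neg⟩) with hσ
  have hFσ : ∀ p, F (σ p) = -F p := by
    rintro ⟨c, a⟩
    have hs : bSign r k (σ (c, a)).1 = -bSign r k c := by
      have : signExponent r k (σ (c, a)).1 / 2 = signExponent r k c / 2 + ((a.1 : ℤ) : ℚ) := by
        simp only [signExponent, hσ]
        push_cast
        ring
      rw [bSign, bSign, this, Int.floor_add_intCast, Int.negOnePow_add, Int.negOnePow_odd _ a.2]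
      simp
    have hk : ((k.extendBy (σ (c, a)).1).attachBy j₀ (σ (c, a)).2).blowDown
        = ((k.extendBy c).attachBy j₀ a).blowDown := by
      apply Char.ext
      ext j
      rw [hbd, hbd]
      by_cases hj : j = j₀
      · simp only [hj, if_true, hσ]; ring
      · simp only [hj, if_false]
        exact (k.extendBy_coe _ ⟨j, hj⟩).trans (k.extendBy_coe c ⟨j, hj⟩).symm
    have he : aExp j₀ (k.extendBy (σ (c, a)).1) (σ (c, a)).2 I' = aExp j₀ (k.extendBy c) a I' := by
      rw [aExp_eq h _ _ hj₀, aExp_eq h _ _ hj₀]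
      simp [hσ]
    simp only [hF]
    rw [hs, hk, he, neg_smul]
  refine Finset.sum_involution (fun p _ => σ p) ?_ ?_ ?_ ?_
  · intro p _
    rw [hFσ, add_neg_cancel]
  · rintro ⟨c, a⟩ _ _ heq
    have h1 : -a.1 = a.1 := congrArg (fun p : Γ.Parity j₀ × OddInt => p.2.1) heq
    obtain ⟨m, hm⟩ := a.2
    omega
  · intro p hp
    simp only [Set.Finite.mem_toFinset, Function.mem_support] at hp ⊢
    rw [hFσ]
    exact neg_ne_zero.mpr hp
  · rintro ⟨c, a⟩ _
    refine Prod.ext (Subtype.ext ?_) (Subtype.ext ?_)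
    · simp [hσ]
    · simp [hσ]

/-- The short sequence of complexes
`0 → ℱ^*(Γ_{j₀}^+) → ℱ^*(Γ) → ℱ^*(Γ∖j₀) → 0` with the maps `A^*` and `B̄^*`. -/
def surgerySequence (hΓ : Γ.Nondegenerate) (hdel : (Γ.delete j₀).Nondegenerate)
    (h : (Γ.incr j₀).Nondegenerate) (r : (Γ.delete j₀).CharClass → (Γ.delete j₀).Char) :
    ShortComplex (CochainComplex (ModuleCat ℤ[X]) ℕ) :=
  ShortComplex.mk (aMap hΓ h) (bMap hΓ hdel r) <| HomologicalComplex.hom_ext _ _ fun _ =>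
    ModuleCat.hom_ext (LinearMap.ext fun φ => Subtype.ext (bFun_aFun h r φ.2))

/-- The map `B̄^q : ℍ^q(Γ) → ℍ^q(Γ∖j₀)` in lattice cohomology. -/
def bCohomology (hΓ : Γ.Nondegenerate) (hdel : (Γ.delete j₀).Nondegenerate)
    (r : (Γ.delete j₀).CharClass → (Γ.delete j₀).Char) (q : ℕ) :
    Γ.latticeCohomology q ⟶ (Γ.delete j₀).latticeCohomology q :=
  HomologicalComplex.homologyMap (bMap hΓ hdel r) q

/-- The connecting map `C^q : ℍ^q(Γ∖j₀) → ℍ^{q+1}(Γ_{j₀}^+)` of the long exact cohomology sequence of the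
short exact sequence of complexes `0 → ℱ^*(Γ_{j₀}^+) → ℱ^*(Γ) → ℱ^*(Γ∖j₀) → 0`. -/
def cCohomology {hΓ : Γ.Nondegenerate} {hdel : (Γ.delete j₀).Nondegenerate}
    {h : (Γ.incr j₀).Nondegenerate} {r : (Γ.delete j₀).CharClass → (Γ.delete j₀).Char}
    (hS : (surgerySequence hΓ hdel h r).ShortExact) (q : ℕ) :
    (Γ.delete j₀).latticeCohomology q ⟶ (Γ.incr j₀).latticeCohomology (q + 1) :=
  hS.δ q (q + 1) rfl

end PlumbingGraph

end

/-!
Every element of `𝒯₀⁺` is annihilated by a power of `U`, and multiplication by `U` is surjective, so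
injectivity of `A` and exactness in the middle only have to be checked on cochains annihilated by
`U`. On these, `A` sees only the parameters with exponent `0`. Along a column
`k + 2n E_{j₀}^*` (`n ∈ ℤ`) with a fixed set of directions `I`, the value of `A φ` is then a sum of
two or three neighbouring values of `φ`. If `j₀ ∈ I`, such a column is an isomorphism; if `j₀ ∉ I`,
every entry of the column is equivalent up to sign to any given one modulo the image of `A`. Hence
the cochains supported at one entry of each column with `j₀ ∉ I` span a complement to the image of
`A`, and `B̄` is injective on them.

For the canonical submodule let `k` be an element of minimal weight in a class of `Γ ∖ j₀`. Some
extension `k + a E_{j₀}^*` has its orthogonal projection to the line of `E_{j₀}^*` in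
`[-1, 1] · E_{j₀}^*`. Negative definiteness of `Γ_{j₀}^+` gives `-1 < (E_{j₀}^*)² < 0`, and this
bound forces every other extension `K'` of a minimal element `k'` in the class of
`K = k + a E_{j₀}^*` to satisfy `w(K') - w(K) ≥ w(k') - w(k) + γ` for a fixed `γ > 0`. Let
`N + min w` be the level of a `U^N`-torsion element over a class of `Γ ∖ j₀`. Every such element
over `[k]` is then the image under `B̄⁰` of an element of `𝕋(Γ)` over `[K]` up to elements whose
level is lower by `γ`, and since `w` is bounded below, induction on the level concludes.
-/

noncomputable section

namespace LatticeCohomology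

section Torsion

variable {R M N P : Type*} [CommRing R] [AddCommGroup M] [AddCommGroup N] [AddCommGroup P]
  [Module R M] [Module R N] [Module R P] {u : R}

lemma injective_of_pow_smul_eq_zero (hM : ∀ x : M, ∃ n : ℕ, u ^ n • x = 0) (f : M →ₗ[R] N)
    (h : ∀ x, u • x = 0 → f x = 0 → x = 0) : Function.Injective f := by
  rw [injective_iff_map_eq_zero]
  intro x hx
  obtain ⟨n, hn⟩ := hM x
  induction n with
  | zero => simpa using hn
  | succ n ih =>
    refine ih (h _ ?_ ?_)
    · rwa [smul_smul, ← pow_succ']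
    · rw [map_smul, hx, smul_zero]

lemma ker_le_range_of_pow_smul_eq_zero (hM : ∀ n : ℕ, Function.Surjective fun x : M => u ^ n • x)
    (hN : ∀ y : N, ∃ n : ℕ, u ^ n • y = 0) (f : M →ₗ[R] N) (g : N →ₗ[R] P) (hgf : g ∘ₗ f = 0)
    (h : ∀ y, u • y = 0 → g y = 0 → y ∈ LinearMap.range f) :
    LinearMap.ker g ≤ LinearMap.range f := by
  intro y hy
  rw [LinearMap.mem_ker] at hy
  obtain ⟨n, hn⟩ := hN y
  induction n generalizing y with
  | zero => simp [show y = 0 by simpa using hn]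
  | succ n ih =>
    obtain ⟨x, hx⟩ := h (u ^ n • y) (by rwa [smul_smul, ← pow_succ'])
      (by rw [map_smul, hy, smul_zero])
    obtain ⟨z, rfl⟩ := hM n x
    have hz : y - f z ∈ LinearMap.range f := by
      refine ih (y := y - f z) ?_ ?_
      · rw [map_sub, hy, ← LinearMap.comp_apply, hgf, LinearMap.zero_apply, sub_zero]
      · rw [smul_sub, ← map_smul, hx, sub_self]
    exact (Submodule.sub_mem_iff_left _ (LinearMap.mem_range_self f z)).mp hz

end Torsion

lemma finsum_sub_apply_mem {ι G : Type*} [AddCommGroup G] (S : AddSubgroup G) {f : ι → G}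
    (hf : (Function.support f).Finite) (i : ι) (h : ∀ j ≠ i, f j ∈ S) :
    ∑ᶠ j, f j - f i ∈ S := by
  rw [← QuotientAddGroup.eq_iff_sub_mem, ← QuotientAddGroup.mk'_apply,
    AddMonoidHom.map_finsum _ hf]
  exact finsum_eq_single _ i fun j hj => (QuotientAddGroup.eq_zero_iff _).mpr (h j hj)

section IntSequences

variable {G : Type*} [AddCommGroup G] {f : ℤ → G}

lemma eq_zero_of_add_succ_eq_zero (hf : (Function.support f).Finite) {m : ℤ}
    (h : ∀ n, m ≤ n → f n + f (n + 1) = 0) : f m = 0 := by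
  obtain ⟨b, hb⟩ := hf.bddAbove
  have hlarge : f (max m (b + 1)) = 0 := by
    by_contra hne
    have := hb hne
    omega
  have key : ∀ n ≤ max m (b + 1), m ≤ n → f n = 0 := by
    intro n hn
    induction n, hn using Int.leInductionDown with
    | base => exact fun _ => hlarge
    | pred n _ ih =>
      intro hmn
      have := h (n - 1) hmn
      rwa [sub_add_cancel, ih (by omega), add_zero] at this
  exact key m (le_max_left _ _) le_rfl

lemma eq_zero_of_add_pred_eq_zero (hf : (Function.support f).Finite) {m : ℤ}
    (h : ∀ n ≤ m, f n + f (n - 1) = 0) : f m = 0 := by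
  have := eq_zero_of_add_succ_eq_zero (f := fun n => f (-n)) (m := -m)
    (hf.preimage neg_injective.injOn) fun n hn => by
      simpa only [neg_add, ← sub_eq_add_neg] using h (-n) (by omega)
  simpa only [neg_neg] using this

lemma eq_zero_of_add_adjacent_eq_zero (hf : (Function.support f).Finite)
    (hpos : ∀ n, 0 < n → f n + f (n + 1) = 0) (hneg : ∀ n < 0, f n + f (n - 1) = 0)
    (hzero : f (-1) + f 0 + f 1 = 0) : f = 0 := by
  have hpos' : ∀ m, 0 < m → f m = 0 := fun m hm =>
    eq_zero_of_add_succ_eq_zero hf fun n hn => hpos n (hm.trans_le hn)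
  have hneg' : ∀ m < 0, f m = 0 := fun m hm =>
    eq_zero_of_add_pred_eq_zero hf fun n hn => hneg n (hn.trans_lt hm)
  funext m
  rcases lt_trichotomy m 0 with hm | rfl | hm
  · exact hneg' m hm
  · simpa [hpos' 1 one_pos, hneg' (-1) (by norm_num)] using hzero
  · exact hpos' m hm

variable (S : AddSubgroup G)

lemma mem_of_add_succ_mem (h : ∀ n, f n + f (n + 1) ∈ S) {m : ℤ} (hm : f m ∈ S) (n : ℤ) :
    f n ∈ S := by
  induction n using Int.inductionOn' (b := m) with
  | zero => exact hm
  | succ k _ ih => exact (S.add_mem_cancel_left ih).mp (h k)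
  | pred k _ ih =>
    have := h (k - 1)
    rw [sub_add_cancel] at this
    exact (S.add_mem_cancel_right ih).mp this

lemma mem_of_add_adjacent_mem (hzero : f 0 ∈ S) (hpos : ∀ n, 0 < n → f n + f (n - 1) ∈ S)
    (hneg : ∀ n < 0, f n + f (n + 1) ∈ S) (n : ℤ) : f n ∈ S := by
  induction n using Int.inductionOn' (b := 0) with
  | zero => exact hzero
  | succ k hk ih =>
    have := hpos (k + 1) (by omega)
    rw [add_sub_cancel_right] at this
    exact (S.add_mem_cancel_right ih).mp this
  | pred k hk ih =>
    have := hneg (k - 1) (by omega)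
    rw [sub_add_cancel] at this
    exact (S.add_mem_cancel_right ih).mp this

end IntSequences

lemma mul_succ_add_max_eq_iff {h n : ℤ} : n * (n + 1) + 2 * max 0 h = 2 * max 0 (h + n) ↔
    n = 0 ∨ (n = -1 ∧ h ≤ 0) ∨ (n = 1 ∧ 0 ≤ h) := by
  by_cases h0 : n = 0
  · simp [h0]
  by_cases h1 : n = 1
  · subst h1
    omega
  by_cases h2 : n = -1
  · subst h2
    omega
  suffices 2 * max 0 n < n * (n + 1) by omega
  rcases max_cases 0 n with ⟨hmax, hn⟩ | ⟨hmax, hn⟩ <;> rw [hmax]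
  · nlinarith [show n ≤ -2 by omega]
  · nlinarith [show 2 ≤ n by omega]

lemma mem_of_forall_single_mem {ι R M : Type*} [Semiring R] [AddCommMonoid M] [Module R M]
    {P : Submodule R (ι →₀ M)} {z : ι →₀ M} (h : ∀ i, Finsupp.single i (z i) ∈ P) : z ∈ P := by
  rw [← Finsupp.sum_single z]
  exact Submodule.sum_mem _ fun i _ => h i

lemma mul_sub_sq_sub_mul_sq_le {p s n : ℚ} (hp : p ∈ Set.Ioo (-1 : ℚ) 0) (hs : |s| ≤ 1)
    (hn : 1 ≤ |n|) : p * (s - 2 * n / p) ^ 2 - p * s ^ 2 ≤ -4 * (-p⁻¹ - 1) := by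
  have hinv : 1 < -p⁻¹ := by
    rw [← inv_neg]
    exact (one_lt_inv₀ (by linarith [hp.2])).mpr (by linarith [hp.1])
  have hexpand : p * (s - 2 * n / p) ^ 2 = p * s ^ 2 - 4 * (s * n) - 4 * -p⁻¹ * |n| ^ 2 := by
    have hp0 := hp.2.ne
    rw [sq_abs]
    field_simp
    ring
  have hsn : -|n| ≤ s * n := by
    refine (neg_le_neg ?_).trans (neg_abs_le _)
    rw [abs_mul]
    exact mul_le_of_le_one_left (abs_nonneg _) hs
  rw [hexpand]
  generalize -p⁻¹ = P at hinv
  nlinarith [mul_nonneg (sub_nonneg.mpr hn) (sub_nonneg.mpr hinv.le)]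

lemma dotProduct_subtype_ne {J R : Type*} [Fintype J] [DecidableEq J] [NonUnitalNonAssocSemiring R]
    {j₀ : J} (u : J → R) {v : J → R} (hv : v j₀ = 0) :
    (fun j : {j // j ≠ j₀} => u j) ⬝ᵥ (fun j => v j) = u ⬝ᵥ v := by
  simp only [dotProduct]
  rw [Fintype.sum_eq_add_sum_subtype_ne _ j₀, hv, mul_zero, zero_add]

section Homology

variable {R : Type*} [Ring R] {ι : Type*} {c : ComplexShape ι}
  {K L : HomologicalComplex (ModuleCat R) c} {i : ι}

lemma homologyπ_mem_range_homologyMap (f : K ⟶ L) (j : ι) (hj : c.next i = j) {φ : K.X i}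
    (hφ : K.d i j φ = 0) {z : L.cycles i} (hz : L.iCycles i z = f.f i φ) :
    L.homologyπ i z ∈ LinearMap.range (HomologicalComplex.homologyMap f i).hom := by
  obtain ⟨y, hy⟩ : ∃ y : K.cycles i, K.iCycles i y = φ :=
    ⟨K.cyclesMk φ j hj hφ, K.i_cyclesMk φ j hj hφ⟩
  have hmap : HomologicalComplex.cyclesMap f i y = z := by
    apply (ModuleCat.mono_iff_injective (L.iCycles i)).mp inferInstance
    rw [hz, ← hy, ← ConcreteCategory.comp_apply, HomologicalComplex.cyclesMap_i,
      ConcreteCategory.comp_apply]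
  refine ⟨K.homologyπ i y, ?_⟩
  rw [← hmap]
  exact ConcreteCategory.congr_hom (HomologicalComplex.homologyπ_naturality f i) y

end Homology

lemma TPlus.pow_smul_surjective (n : ℕ) :
    Function.Surjective fun x : TPlus => (X ^ n : ℤ[X]) • x := by
  intro x
  obtain ⟨f, rfl⟩ := Submodule.Quotient.mk_surjective _ x
  refine ⟨Submodule.Quotient.mk (LaurentPolynomial.T (-n) * f), ?_⟩
  dsimp only
  rw [← Submodule.Quotient.mk_smul, Algebra.smul_def, LaurentPolynomial.algebraMap_eq_toLaurent,
    Polynomial.toLaurent_X_pow, ← mul_assoc, ← LaurentPolynomial.T_add, add_neg_cancel,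
    LaurentPolynomial.T_zero, one_mul]

lemma uPow_natCast (n : ℕ) : uPow n = X ^ n := by
  rw [uPow, Nat.floor_natCast]

lemma uPow_smul_of_X_smul_eq_zero {x : TPlus} (hx : (X : ℤ[X]) • x = 0) {e : ℚ} (he : 1 ≤ e) :
    uPow e • x = 0 := by
  have h1 : 1 ≤ ⌊e⌋₊ := Nat.le_floor (by exact_mod_cast he)
  exact pow_smul_eq_zero_of_le (by rwa [pow_one]) h1

end LatticeCohomology

namespace PlumbingGraph

open LatticeCohomology

variable {J : Type*} [Fintype J] [LinearOrder J] {Γ : PlumbingGraph J} {j₀ : J}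

/-! ### Columns of cubes -/

instance : DecidableEq Γ.Char :=
  inferInstanceAs (DecidableEq {a : J → ℤ // Γ.IsChar a})

lemma single_mem_cochains {c : Γ.Cube} {q : ℕ} (hc : c.2.card = q) (x : TPlus) :
    Pi.single c x ∈ Γ.cochains q := by
  have hsupp : ∀ c', (Pi.single c x : Γ.Cube → TPlus) c' ≠ 0 → c' = c := fun c' =>
    not_imp_comm.mp fun hne => Pi.single_eq_of_ne (M := fun _ => TPlus) hne x
  exact ⟨(Set.finite_singleton c).subset hsupp, fun c' h => by rw [hsupp c' h, hc]⟩

lemma mem_of_single_mem {S : Submodule ℤ[X] (Γ.Cube → TPlus)} {φ : Γ.Cube → TPlus}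
    (hφ : (Function.support φ).Finite) (h : ∀ c, φ c ≠ 0 → Pi.single c (φ c) ∈ S) : φ ∈ S := by
  have hsum : φ = ∑ c ∈ hφ.toFinset, Pi.single c (φ c) := by
    ext c
    rw [Finset.sum_apply, Finset.sum_pi_single]
    by_cases hc : φ c = 0 <;> simp [hc]
  rw [hsum]
  exact Submodule.sum_mem _ fun c hc => h c (by simpa using hc)

lemma exists_pow_smul_cochain_eq_zero {q : ℕ} (φ : Γ.cochains q) :
    ∃ N : ℕ, (X ^ N : ℤ[X]) • φ = 0 :=
  (exists_pow_smul_eq_zero φ.2.1).imp fun _ hN => Subtype.ext (funext hN)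

lemma cochains_pow_smul_surjective (q N : ℕ) :
    Function.Surjective fun φ : Γ.cochains q => (X ^ N : ℤ[X]) • φ := by
  classical
  intro φ
  choose g hg using TPlus.pow_smul_surjective N
  let ψ : Γ.Cube → TPlus := fun c => if φ.1 c = 0 then 0 else g (φ.1 c)
  have hψ : ∀ c, ψ c ≠ 0 → φ.1 c ≠ 0 := fun c hc h => hc (if_pos h)
  refine ⟨⟨ψ, φ.2.1.subset hψ, fun c hc => φ.2.2 c (hψ c hc)⟩, Subtype.ext (funext fun c => ?_)⟩
  change (X ^ N : ℤ[X]) • ψ c = φ.1 c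
  by_cases hc : φ.1 c = 0
  · simp only [ψ, if_pos hc, smul_zero, hc]
  · simp only [ψ, if_neg hc, hg]

variable (j₀) in
/-- The characteristic element `k + 2n E_{j₀}^*`; these elements form the column of `k`. -/
def Char.bump (k : Γ.Char) (n : ℤ) : Γ.Char :=
  ⟨k.1 + Pi.single j₀ (2 * n), (Γ.isChar_iff _).mpr fun j => by
    have h := (Γ.isChar_iff _).mp k.2 j
    rcases eq_or_ne j j₀ with rfl | hj
    · simpa [Int.ModEq] using h
    · simpa [hj] using h⟩

lemma Char.bump_self (k : Γ.Char) (n : ℤ) : (k.bump j₀ n).1 j₀ = k.1 j₀ + 2 * n := by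
  simp [bump]

lemma Char.bump_of_ne (k : Γ.Char) (n : ℤ) {j : J} (hj : j ≠ j₀) : (k.bump j₀ n).1 j = k.1 j := by
  simp [bump, hj]

lemma Char.bump_zero (k : Γ.Char) : k.bump j₀ 0 = k :=
  Char.ext (by simp [bump])

lemma Char.bump_bump (k : Γ.Char) (m n : ℤ) : (k.bump j₀ m).bump j₀ n = k.bump j₀ (m + n) :=
  Char.ext (by simp only [bump, add_assoc, ← Pi.single_add, mul_add])

lemma Char.bump_injective (k : Γ.Char) : Function.Injective (k.bump j₀) := by
  intro m n h
  have := congrFun (congrArg Subtype.val h) j₀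
  simp only [bump_self] at this
  omega

/-- Odd integers, the parameters of the sum defining `A`, written as `2n + 1`. -/
def oddOf : ℤ ≃ OddInt where
  toFun n := ⟨2 * n + 1, n, rfl⟩
  invFun a := (a.1 - 1) / 2
  left_inv n := by simp
  right_inv := by
    rintro ⟨_, m, rfl⟩
    simp

lemma oddOf_val (n : ℤ) : (oddOf n).1 = 2 * n + 1 := rfl

lemma oddShift_oddOf (m n : ℤ) : oddShift m (oddOf n) = oddOf (n - m) :=
  Subtype.ext (by simp only [oddShift, oddOf_val, Equiv.coe_fn_mk]; ring)

variable (j₀) in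
/-- The characteristic element of `Γ_{j₀}^+` with the coordinates of `k + E_{j₀}^*`. -/
def Char.up (k : Γ.Char) : (Γ.incr j₀).Char := (k.attachBy j₀ (oddOf 0)).blowDown

lemma Char.up_apply (k : Γ.Char) (j : J) :
    (k.up j₀).1 j = k.1 j + if j = j₀ then 1 else 0 := rfl

lemma Char.up_injective : Function.Injective fun k : Γ.Char => k.up j₀ :=
  Char.blowDown_attachBy_injective _

lemma Char.up_surjective : Function.Surjective fun k : Γ.Char => k.up j₀ := by
  intro k
  refine ⟨⟨fun j => k.1 j - if j = j₀ then 1 else 0, (Γ.isChar_iff _).mpr fun j => ?_⟩, ?_⟩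
  · have h := ((Γ.incr j₀).isChar_iff _).mp k.2 j
    rcases eq_or_ne j j₀ with rfl | hj
    · simp only [incr, Function.update_self, if_true, Int.ModEq] at h ⊢
      omega
    · simpa [hj, incr] using h
  · exact Char.ext (funext fun j => sub_add_cancel _ _)

lemma Char.blowDown_attachBy (k : Γ.Char) (n : ℤ) :
    (k.attachBy j₀ (oddOf n)).blowDown = (k.bump j₀ n).up j₀ := by
  refine Char.ext (funext fun j => ?_)
  rw [up_apply, blowDown_apply, attachBy_top, oddOf_val]
  change k.1 j + _ = _
  rcases eq_or_ne j j₀ with rfl | hj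
  · simp only [if_true, bump_self]
    ring
  · simp only [hj, if_false, bump_of_ne _ _ hj]

lemma aFun_eq (φ : (Γ.incr j₀).Cube → TPlus) (k : Γ.Char) (I : Finset J) :
    aFun φ (k, I) = ∑ᶠ n : ℤ, uPow (aExp j₀ k (oddOf n) I) • φ ((k.bump j₀ n).up j₀, I) := by
  rw [aFun, ← finsum_comp_equiv oddOf]
  simp only [Char.blowDown_attachBy]

lemma w_shift_le_wCube (k : Γ.Char) {I I' : Finset J} (hI' : I' ⊆ I) :
    Γ.w (k.shift (E I')) ≤ Γ.wCube (k, I) :=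
  Finset.le_sup' (fun I' => Γ.w (k.shift (E I'))) (Finset.mem_powerset.mpr hI')

lemma wCube_le_iff {k : Γ.Char} {I : Finset J} {c : ℚ} :
    Γ.wCube (k, I) ≤ c ↔ ∀ I' ⊆ I, Γ.w (k.shift (E I')) ≤ c :=
  (Finset.sup'_le_iff _ _).trans (by simp only [Finset.mem_powerset])

lemma wCube_eq_add_of_forall {k k' : Γ.Char} {I : Finset J} {c : ℚ}
    (h : ∀ I' ⊆ I, Γ.w (k'.shift (E I')) = Γ.w (k.shift (E I')) + c) :
    Γ.wCube (k', I) = Γ.wCube (k, I) + c := by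
  refine eq_of_forall_ge_iff fun b => ?_
  rw [← le_sub_iff_add_le, wCube_le_iff, wCube_le_iff]
  refine forall₂_congr fun I' hI' => ?_
  rw [h I' hI', le_sub_iff_add_le]

lemma wCube_eq_max (k : Γ.Char) {I : Finset J} (hI : j₀ ∈ I) :
    Γ.wCube (k, I) = max (Γ.wCube (k, I.erase j₀)) (Γ.wCube (k.shift (E {j₀}), I.erase j₀)) := by
  refine le_antisymm (wCube_le_iff.mpr fun I' hI' => ?_)
    (max_le (Γ.wCube_mono k (Finset.erase_subset _ _)) (Γ.wCube_shift_le k hI))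
  by_cases hj : j₀ ∈ I'
  · refine le_max_of_le_right ?_
    rw [← Finset.insert_erase hj, E_insert (Finset.notMem_erase _ _), ← Char.shift_shift]
    exact w_shift_le_wCube _ (Finset.erase_subset_erase _ hI')
  · exact le_max_of_le_left (w_shift_le_wCube _ (Finset.subset_erase.mpr ⟨hI', hj⟩))

variable (j₀) in
/-- The weight of the far face of the cube `(k, I)` in the direction `j₀ ∈ I` minus the weight of
its near face, an integer. -/
def Char.height (k : Γ.Char) (I : Finset J) : ℤ :=
  ⌊Γ.wCube (k.shift (E {j₀}), I.erase j₀) - Γ.wCube (k, I.erase j₀)⌋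

lemma Char.cast_height (k : Γ.Char) (I : Finset J) : (k.height j₀ I : ℚ)
    = Γ.wCube (k.shift (E {j₀}), I.erase j₀) - Γ.wCube (k, I.erase j₀) := by
  obtain ⟨n, hn⟩ := Γ.wCube_sub_int k (E {j₀}) (I.erase j₀) (I.erase j₀)
  have hn' : Γ.wCube (k.shift (E {j₀}), I.erase j₀) - Γ.wCube (k, I.erase j₀) = (-n : ℤ) := by
    rw [Int.cast_neg, ← hn, neg_sub]
  rw [height, hn', Int.floor_intCast]

lemma w_bump_shift (hΓ : Γ.Nondegenerate) (k : Γ.Char) (n : ℤ) (l : J → ℤ) :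
    Γ.w ((k.bump j₀ n).shift l)
      = Γ.w (k.shift l) + (Γ.w (k.bump j₀ n) - Γ.w k + (n * l j₀ : ℤ)) := by
  have hdot : (k.bump j₀ n).1 ⬝ᵥ l = k.1 ⬝ᵥ l + 2 * n * l j₀ := by
    rw [Char.bump, add_dotProduct, single_dotProduct]
  rw [w_shift _ hΓ, w_shift _ hΓ, hdot]
  push_cast
  ring

lemma Char.height_bump (hΓ : Γ.Nondegenerate) (k : Γ.Char) (n : ℤ) (I : Finset J) :
    (k.bump j₀ n).height j₀ I = k.height j₀ I + n := by
  have hE : ∀ I' ⊆ I.erase j₀, E I' j₀ = 0 := fun I' hI' =>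
    if_neg fun hj => Finset.notMem_erase _ _ (hI' hj)
  have hnear : Γ.wCube (k.bump j₀ n, I.erase j₀)
      = Γ.wCube (k, I.erase j₀) + (Γ.w (k.bump j₀ n) - Γ.w k) :=
    wCube_eq_add_of_forall fun I' hI' => by
      rw [w_bump_shift hΓ, hE I' hI', mul_zero, Int.cast_zero, add_zero]
  have hfar : Γ.wCube ((k.bump j₀ n).shift (E {j₀}), I.erase j₀)
      = Γ.wCube (k.shift (E {j₀}), I.erase j₀) + (Γ.w (k.bump j₀ n) - Γ.w k + n) :=
    wCube_eq_add_of_forall fun I' hI' => by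
      have h1 : (E {j₀} + E I') j₀ = 1 := by
        rw [Pi.add_apply, hE I' hI', E, if_pos (Finset.mem_singleton_self _), add_zero]
      rw [Char.shift_shift, Char.shift_shift, w_bump_shift hΓ, h1, mul_one]
  have : ((k.bump j₀ n).height j₀ I : ℚ) = (k.height j₀ I + n : ℤ) := by
    rw [Int.cast_add, cast_height, cast_height, hnear, hfar]
    ring
  exact_mod_cast this

lemma Char.exists_bump_eq_height_eq_zero (hΓ : Γ.Nondegenerate) (k : Γ.Char) (I : Finset J) :
    ∃ (k' : Γ.Char) (m : ℤ), k'.bump j₀ m = k ∧ k'.height j₀ I = 0 := by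
  refine ⟨k.bump j₀ (-k.height j₀ I), k.height j₀ I, ?_, ?_⟩
  · rw [bump_bump, neg_add_cancel, bump_zero]
  · rw [height_bump hΓ, add_neg_cancel]

lemma aExp_of_notMem (h : (Γ.incr j₀).Nondegenerate) (k : Γ.Char) (n : ℤ) {I : Finset J}
    (hI : j₀ ∉ I) : aExp j₀ k (oddOf n) I = n * (n + 1) / 2 := by
  rw [aExp_eq h _ _ hI, oddOf_val]
  push_cast
  ring

lemma aExp_of_mem (hΓ : Γ.Nondegenerate) (h : (Γ.incr j₀).Nondegenerate) (k : Γ.Char) (n : ℤ)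
    {I : Finset J} (hI : j₀ ∈ I) : aExp j₀ k (oddOf n) I
      = n * (n + 1) / 2 + max 0 (k.height j₀ I) - max 0 (k.height j₀ I + n) := by
  set c : ℚ := (Γ.attach j₀).w (k.attachBy j₀ (oddOf n)) - Γ.w k
  have hattach : ∀ l I, (Γ.attach j₀).wCube ((k.attachBy j₀ (oddOf n)).shift
      (Function.extend inclAttach l 0), I.map inclAttach.toEmbedding)
        = Γ.wCube (k.shift l, I) + c :=
    wCube_extend (Nondegenerate.attach h) hΓ (fun i j => (Γ.attach_mat_coe j₀ i j).symm)
      _ k (k.attachBy_coe _)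
  have hattach_zero : ∀ I, (Γ.attach j₀).wCube
      (k.attachBy j₀ (oddOf n), I.map inclAttach.toEmbedding) = Γ.wCube (k, I) + c := by
    simpa only [Function.extend_zero, Char.shift_zero] using hattach 0
  have hB : j₀ ∉ I.erase j₀ := Finset.notMem_erase _ _
  have hnear := aExp_of_notMem h k n hB
  have hfar := aExp_of_notMem h (k.shift (E {j₀})) (n - 1) hB
  have hE : E {j₀} j₀ = 1 := if_pos (Finset.mem_singleton_self _)
  have hshift := Char.attachBy_shift (j₀ := j₀) k (oddOf n) (E {j₀})
  rw [hE, oddShift_oddOf] at hshift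
  rw [aExp, hattach_zero, sub_eq_iff_eq_add'] at hnear
  rw [aExp, ← hshift, hattach, Char.blowDown_shift, sub_eq_iff_eq_add'] at hfar
  have hheight := k.cast_height (j₀ := j₀) I
  rw [aExp, hattach_zero, wCube_eq_max k hI, wCube_eq_max _ hI]
  push_cast at hfar
  set v := Γ.wCube (k, I.erase j₀)
  rw [show Γ.wCube (k.shift (E {j₀}), I.erase j₀) = v + k.height j₀ I by linarith] at hfar ⊢
  rw [show (Γ.incr j₀).wCube ((k.attachBy j₀ (oddOf n)).blowDown, I.erase j₀)
      = v + c - n * (n + 1) / 2 + 0 by linarith,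
    show (Γ.incr j₀).wCube ((k.attachBy j₀ (oddOf n)).blowDown.shift (E {j₀}), I.erase j₀)
      = v + c - n * (n + 1) / 2 + (k.height j₀ I + n) by linarith,
    max_add_add_left]
  nth_rw 1 [← add_zero v]
  rw [max_add_add_left]
  push_cast
  ring

/-! ### Injectivity of `A` -/

lemma aExp_eq_zero_iff_of_notMem (h : (Γ.incr j₀).Nondegenerate) (k : Γ.Char) (n : ℤ)
    {I : Finset J} (hI : j₀ ∉ I) : aExp j₀ k (oddOf n) I = 0 ↔ n = 0 ∨ n = -1 := by
  rw [aExp_of_notMem h k n hI, div_eq_zero_iff, or_iff_left two_ne_zero, mul_eq_zero,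
    Int.cast_eq_zero, ← eq_neg_iff_add_eq_zero]
  norm_cast

lemma aExp_eq_zero_iff_of_mem (hΓ : Γ.Nondegenerate) (h : (Γ.incr j₀).Nondegenerate) (k : Γ.Char)
    (n : ℤ) {I : Finset J} (hI : j₀ ∈ I) : aExp j₀ k (oddOf n) I = 0 ↔
      n = 0 ∨ (n = -1 ∧ k.height j₀ I ≤ 0) ∨ (n = 1 ∧ 0 ≤ k.height j₀ I) := by
  rw [aExp_of_mem hΓ h k n hI, ← mul_succ_add_max_eq_iff, sub_eq_zero, ← @Int.cast_inj ℚ]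
  push_cast
  constructor <;> intro <;> linarith

lemma one_le_aExp (h : (Γ.incr j₀).Nondegenerate) {k : Γ.Char} {a : OddInt} {I : Finset J}
    (hne : aExp j₀ k a I ≠ 0) : 1 ≤ aExp j₀ k a I := by
  have hpos := (aExp_nonneg h k a I).lt_of_ne' hne
  obtain ⟨n, hn⟩ := aExp_int h k a I
  rw [hn] at hpos ⊢
  exact_mod_cast hpos

lemma uPow_aExp_smul (h : (Γ.incr j₀).Nondegenerate) {x : TPlus} (hx : (X : ℤ[X]) • x = 0)
    (k : Γ.Char) (a : OddInt) (I : Finset J) :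
    uPow (aExp j₀ k a I) • x = if aExp j₀ k a I = 0 then x else 0 := by
  split_ifs with h0
  · rw [h0, uPow, Nat.floor_zero, pow_zero, one_smul]
  · exact uPow_smul_of_X_smul_eq_zero hx (one_le_aExp h h0)

lemma aFun_eq_sum_of_X_smul_eq_zero (h : (Γ.incr j₀).Nondegenerate)
    {φ : (Γ.incr j₀).Cube → TPlus} (hφ : ∀ c, (X : ℤ[X]) • φ c = 0) (k : Γ.Char) (I : Finset J)
    {s : Finset ℤ} (hs : ∀ n, n ∈ s ↔ aExp j₀ k (oddOf n) I = 0) :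
    aFun φ (k, I) = ∑ n ∈ s, φ ((k.bump j₀ n).up j₀, I) := by
  simp only [aFun_eq, uPow_aExp_smul h (hφ _), ← hs]
  refine (finsum_eq_sum_of_support_subset (s := s) _ fun n hn => ?_).trans
    (Finset.sum_congr rfl fun n hn => if_pos hn)
  exact by_contra fun hns => hn (if_neg hns)

lemma aFun_single_eq_sum_of_X_smul_eq_zero (h : (Γ.incr j₀).Nondegenerate) {x : TPlus}
    (hx : (X : ℤ[X]) • x = 0) (k : Γ.Char) (I : Finset J) {s : Finset ℤ}
    (hs : ∀ n, n ∈ s ↔ aExp j₀ (k.bump j₀ n) (oddOf (-n)) I = 0) :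
    aFun (Pi.single (k.up j₀, I) x) = ∑ n ∈ s, Pi.single (k.bump j₀ n, I) x := by
  funext ⟨k', I'⟩
  rw [aFun_eq, Finset.sum_apply]
  by_cases hcol : ∃ n, (k', I') = (k.bump j₀ n, I)
  · obtain ⟨n, hn⟩ := hcol
    obtain ⟨rfl, rfl⟩ := Prod.mk.inj hn
    have hbump : ∀ m, (((k.bump j₀ n).bump j₀ m).up j₀, I') = (k.up j₀, I') ↔ m = -n := by
      intro m
      rw [Prod.mk.injEq, and_iff_left rfl, Char.up_injective.eq_iff, Char.bump_bump]
      nth_rw 2 [← k.bump_zero (j₀ := j₀)]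
      rw [k.bump_injective.eq_iff]
      omega
    rw [finsum_eq_single _ (-n) fun m hm => by
        rw [Pi.single_eq_of_ne (mt (hbump m).mp hm), smul_zero],
      (hbump _).mpr rfl, Pi.single_eq_same, uPow_aExp_smul h hx, ← if_congr (hs n) rfl rfl]
    simp [Pi.single_apply, k.bump_injective.eq_iff]
  · push Not at hcol
    rw [Finset.sum_eq_zero fun n _ => Pi.single_eq_of_ne (M := fun _ => TPlus) (hcol n) x]
    refine finsum_eq_zero_of_forall_eq_zero fun n => ?_
    rw [Pi.single_eq_of_ne, smul_zero]
    intro heq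
    obtain ⟨hk, rfl⟩ := Prod.mk.inj heq
    refine hcol (-n) (congrArg (·, I') ?_)
    rw [← Char.up_injective hk, Char.bump_bump, add_neg_cancel, Char.bump_zero]

lemma eq_zero_of_aFun_eq_zero (hΓ : Γ.Nondegenerate) (h : (Γ.incr j₀).Nondegenerate)
    {φ : (Γ.incr j₀).Cube → TPlus} (hfin : (Function.support φ).Finite)
    (hφ : ∀ c, (X : ℤ[X]) • φ c = 0) (hA : aFun φ = 0) : φ = 0 := by
  funext ⟨k, I⟩
  obtain ⟨k, rfl⟩ := Char.up_surjective k
  obtain ⟨k, m, rfl, hk⟩ := k.exists_bump_eq_height_eq_zero hΓ (j₀ := j₀) I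
  set f : ℤ → TPlus := fun n => φ ((k.bump j₀ n).up j₀, I) with hf
  have hffin : (Function.support f).Finite := by
    refine hfin.preimage fun m _ n _ hmn => ?_
    exact k.bump_injective (Char.up_injective (congrArg Prod.fst hmn))
  have hrow : ∀ (n : ℤ) (s : Finset ℤ),
      (∀ i, i ∈ s ↔ aExp j₀ (k.bump j₀ n) (oddOf i) I = 0) → ∑ i ∈ s, f (n + i) = 0 := by
    intro n s hs
    have hsum := aFun_eq_sum_of_X_smul_eq_zero h hφ (k.bump j₀ n) I hs
    rw [hA, Pi.zero_apply] at hsum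
    simpa only [hf, Char.bump_bump] using hsum.symm
  suffices f = 0 from congrFun this m
  by_cases hI : j₀ ∈ I
  · have hzero : ∀ n i, aExp j₀ (k.bump j₀ n) (oddOf i) I = 0 ↔
        i = 0 ∨ (i = -1 ∧ n ≤ 0) ∨ (i = 1 ∧ 0 ≤ n) := fun n i => by
      rw [aExp_eq_zero_iff_of_mem hΓ h _ _ hI, Char.height_bump hΓ, hk, zero_add]
    refine eq_zero_of_add_adjacent_eq_zero hffin (fun n hn => ?_) (fun n hn => ?_) ?_
    · simpa using hrow n {0, 1} fun i => by rw [hzero]; simp; omega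
    · simpa [sub_eq_add_neg] using hrow n {0, -1} fun i => by rw [hzero]; simp; omega
    · simpa [add_assoc] using hrow 0 {-1, 0, 1} fun i => by rw [hzero]; simp; omega
  · funext n
    refine eq_zero_of_add_pred_eq_zero hffin fun n _ => ?_
    simpa [sub_eq_add_neg] using hrow n {0, -1} fun i => by
      rw [aExp_eq_zero_iff_of_notMem h _ _ hI]
      simp

lemma aHom_injective (hΓ : Γ.Nondegenerate) (h : (Γ.incr j₀).Nondegenerate) (q : ℕ) :
    Function.Injective (aHom h q) :=
  injective_of_pow_smul_eq_zero exists_pow_smul_cochain_eq_zero _ fun φ hX hA =>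
    Subtype.ext (eq_zero_of_aFun_eq_zero hΓ h φ.2.1 (congrFun (congrArg Subtype.val hX))
      (congrArg Subtype.val hA))

/-! ### Exactness in the middle and surjectivity of `B̄` -/

variable (Γ j₀) in
/-- The `q`-cochains supported at the cubes `(k, I)` with `j₀ ∉ I` and `(k, E_{j₀}) = -e_{j₀}`. They
form a complement to the image of `A` on which `B̄` is injective. -/
def baseCochains (q : ℕ) : Submodule ℤ[X] (Γ.Cube → TPlus) where
  carrier := {φ | φ ∈ Γ.cochains q ∧ ∀ c, φ c ≠ 0 → j₀ ∉ c.2 ∧ c.1.1 j₀ = Γ.e j₀}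
  zero_mem' := ⟨zero_mem _, fun _ hc => absurd rfl hc⟩
  add_mem' {φ ψ} hφ hψ := ⟨add_mem hφ.1 hψ.1, fun c hc =>
    (Function.support_add φ ψ hc).elim (hφ.2 c) (hψ.2 c)⟩
  smul_mem' u _ hφ := ⟨Submodule.smul_mem _ u hφ.1, fun c hc =>
    hφ.2 c (right_ne_zero_of_smul (a := u) hc)⟩

lemma single_mem_baseCochains {k : Γ.Char} {I : Finset J} (hk : k.1 j₀ = Γ.e j₀) (hI : j₀ ∉ I)
    (x : TPlus) : Pi.single (k, I) x ∈ Γ.baseCochains j₀ I.card := by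
  refine ⟨single_mem_cochains rfl x, fun c hc => ?_⟩
  obtain rfl : c = (k, I) := by
    by_contra hne
    exact hc (Pi.single_eq_of_ne (M := fun _ => TPlus) hne x)
  exact ⟨hI, hk⟩

lemma sum_single_bump_mem_range (h : (Γ.incr j₀).Nondegenerate) {x : TPlus}
    (hx : (X : ℤ[X]) • x = 0) (k : Γ.Char) (I : Finset J) {s : Finset ℤ}
    (hs : ∀ n, n ∈ s ↔ aExp j₀ (k.bump j₀ n) (oddOf (-n)) I = 0) :
    ∑ n ∈ s, Pi.single (k.bump j₀ n, I) x
      ∈ LinearMap.range ((Γ.cochains I.card).subtype ∘ₗ aHom h I.card) :=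
  ⟨⟨_, single_mem_cochains (c := (k.up j₀, I)) rfl x⟩,
    aFun_single_eq_sum_of_X_smul_eq_zero h hx k I hs⟩

lemma single_mem_range_of_mem (hΓ : Γ.Nondegenerate) (h : (Γ.incr j₀).Nondegenerate) {x : TPlus}
    (hx : (X : ℤ[X]) • x = 0) (k : Γ.Char) {I : Finset J} (hI : j₀ ∈ I) :
    Pi.single (k, I) x ∈ LinearMap.range ((Γ.cochains I.card).subtype ∘ₗ aHom h I.card) := by
  set S := LinearMap.range ((Γ.cochains I.card).subtype ∘ₗ aHom h I.card)
  have hcol : ∀ (k : Γ.Char) (s : Finset ℤ), (∀ n, n ∈ s ↔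
      n = 0 ∨ (n = 1 ∧ k.height j₀ I < 0) ∨ (n = -1 ∧ 0 < k.height j₀ I)) →
      ∑ n ∈ s, Pi.single (k.bump j₀ n, I) x ∈ S := fun k s hs => by
    refine sum_single_bump_mem_range h hx k I fun n => ?_
    rw [hs, aExp_eq_zero_iff_of_mem hΓ h _ _ hI, Char.height_bump hΓ]
    omega
  obtain ⟨k, m, rfl, hk⟩ := k.exists_bump_eq_height_eq_zero hΓ (j₀ := j₀) I
  have hcol' : ∀ (n : ℤ) (s : Finset ℤ),
      (∀ i, i ∈ s ↔ i = 0 ∨ (i = 1 ∧ n < 0) ∨ (i = -1 ∧ 0 < n)) →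
      ∑ i ∈ s, Pi.single (k.bump j₀ (n + i), I) x ∈ S := fun n s hs => by
    simpa only [Char.bump_bump] using
      hcol (k.bump j₀ n) s (by simpa [Char.height_bump hΓ, hk] using hs)
  refine mem_of_add_adjacent_mem (f := fun n => Pi.single (k.bump j₀ n, I) x) S.toAddSubgroup
    ?_ (fun n hn => ?_) (fun n hn => ?_) m
  · simpa using hcol' 0 {0} (by simp)
  · simpa [sub_eq_add_neg] using hcol' n {0, -1} fun i => by simp; omega
  · simpa using hcol' n {0, 1} fun i => by simp; omega

lemma single_mem_range_sup_baseCochains_of_notMem (h : (Γ.incr j₀).Nondegenerate) {x : TPlus}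
    (hx : (X : ℤ[X]) • x = 0) (k : Γ.Char) {I : Finset J} (hI : j₀ ∉ I) :
    Pi.single (k, I) x ∈ LinearMap.range ((Γ.cochains I.card).subtype ∘ₗ aHom h I.card)
      ⊔ Γ.baseCochains j₀ I.card := by
  obtain ⟨m, hm⟩ : (2 : ℤ) ∣ k.1 j₀ - Γ.e j₀ := ((Γ.isChar_iff _).mp k.2 j₀).symm.dvd
  have hbase := single_mem_baseCochains (k := k.bump j₀ (-m))
    (by rw [Char.bump_self]; linarith) hI x
  have hall := mem_of_add_succ_mem (f := fun n => Pi.single (k.bump j₀ n, I) x)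
    (LinearMap.range ((Γ.cochains I.card).subtype ∘ₗ aHom h I.card)
      ⊔ Γ.baseCochains j₀ I.card).toAddSubgroup (fun n => ?_) (Submodule.mem_sup_right hbase) 0
  · rwa [Char.bump_zero] at hall
  · refine Submodule.mem_sup_left ?_
    have hpair := sum_single_bump_mem_range h hx (k.bump j₀ n) I (s := {0, 1}) fun i => by
      rw [aExp_eq_zero_iff_of_notMem h _ _ hI]
      simp only [Finset.mem_insert, Finset.mem_singleton]
      omega
    simpa [Char.bump_bump] using hpair

lemma mem_range_sup_baseCochains (hΓ : Γ.Nondegenerate) (h : (Γ.incr j₀).Nondegenerate) {q : ℕ}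
    {φ : Γ.cochains q} (hφ : (X : ℤ[X]) • φ = 0) :
    φ.1 ∈ LinearMap.range ((Γ.cochains q).subtype ∘ₗ aHom h q) ⊔ Γ.baseCochains j₀ q := by
  refine mem_of_single_mem φ.2.1 fun ⟨k, I⟩ hc => ?_
  obtain rfl := φ.2.2 _ hc
  have hx := congrFun (congrArg Subtype.val hφ) (k, I)
  by_cases hI : j₀ ∈ I
  · exact Submodule.mem_sup_left (single_mem_range_of_mem hΓ h hx k hI)
  · exact single_mem_range_sup_baseCochains_of_notMem h hx k hI

lemma bSign_mul_self (r : (Γ.delete j₀).CharClass → (Γ.delete j₀).Char) (k : (Γ.delete j₀).Char)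
    (a : Γ.Parity j₀) : bSign r k a * bSign r k a = 1 := by
  rw [bSign, ← Units.val_mul, Int.units_mul_self, Units.val_one]

lemma bSign_smul_bSign_smul (r : (Γ.delete j₀).CharClass → (Γ.delete j₀).Char)
    (k : (Γ.delete j₀).Char) (a : Γ.Parity j₀) (x : TPlus) :
    bSign r k a • bSign r k a • x = x := by
  rw [smul_smul, bSign_mul_self, one_smul]

variable (j₀) in
/-- The restriction of a characteristic element to `Γ ∖ j₀`. -/
def Char.restrict (k : Γ.Char) : (Γ.delete j₀).Char :=
  ⟨fun j => k.1 j, ((Γ.delete j₀).isChar_iff _).mpr fun j => (Γ.isChar_iff _).mp k.2 j⟩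

lemma Char.restrict_extendBy (k : Γ.Char) (a : Γ.Parity j₀) (ha : k.1 j₀ = a.1) :
    (k.restrict j₀).extendBy a = k := by
  refine Char.ext (funext fun j => ?_)
  rcases eq_or_ne j j₀ with rfl | hj
  · rw [extendBy_self, ha]
  · exact extendBy_coe _ _ ⟨j, hj⟩

omit [Fintype J] in
lemma exists_map_inclDelete {I : Finset J} (hI : j₀ ∉ I) :
    ∃ I' : Finset {j : J // j ≠ j₀}, I'.map (inclDelete j₀).toEmbedding = I :=
  ⟨I.subtype _, Finset.subtype_map_of_mem fun _ hj => ne_of_mem_of_not_mem hj hI⟩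

lemma eq_zero_of_mem_baseCochains (r : (Γ.delete j₀).CharClass → (Γ.delete j₀).Char) {q : ℕ}
    {φ : Γ.Cube → TPlus} (hφ : φ ∈ Γ.baseCochains j₀ q) (hb : bFun r φ = 0) : φ = 0 := by
  funext ⟨k, I⟩
  by_contra hne
  obtain ⟨hI, hk⟩ := hφ.2 _ hne
  obtain ⟨I, rfl⟩ := exists_map_inclDelete hI
  set a : Γ.Parity j₀ := ⟨Γ.e j₀, rfl⟩
  have hsum := congrFun hb (k.restrict j₀, I)
  rw [bFun, finsum_eq_single _ a, Char.restrict_extendBy k a hk] at hsum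
  · refine hne ?_
    rw [← bSign_smul_bSign_smul r (k.restrict j₀) a (φ _), hsum, Pi.zero_apply, smul_zero,
      Pi.zero_apply]
  · intro b hb
    by_contra h0
    exact hb (Subtype.ext ((Char.extendBy_self _ b).symm.trans
      (hφ.2 _ fun h => h0 (by rw [h, smul_zero])).2))

lemma bHom_comp_aHom (h : (Γ.incr j₀).Nondegenerate)
    (r : (Γ.delete j₀).CharClass → (Γ.delete j₀).Char) (q : ℕ) : bHom r q ∘ₗ aHom h q = 0 :=
  LinearMap.ext fun φ => Subtype.ext (bFun_aFun h r φ.2)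

lemma ker_bHom_le_range_aHom (hΓ : Γ.Nondegenerate) (h : (Γ.incr j₀).Nondegenerate)
    (r : (Γ.delete j₀).CharClass → (Γ.delete j₀).Char) (q : ℕ) :
    LinearMap.ker (bHom r q) ≤ LinearMap.range (aHom h q) := by
  refine ker_le_range_of_pow_smul_eq_zero (cochains_pow_smul_surjective q)
    exists_pow_smul_cochain_eq_zero _ _ (bHom_comp_aHom h r q) fun φ hX hB => ?_
  obtain ⟨_, ⟨ψ, rfl⟩, β, hβ, hφ⟩ := Submodule.mem_sup.mp (mem_range_sup_baseCochains hΓ h hX)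
  have hφ' : aHom h q ψ + ⟨β, hβ.1⟩ = φ := Subtype.ext hφ
  rw [← hφ', map_add, ← LinearMap.comp_apply, bHom_comp_aHom, LinearMap.zero_apply, zero_add] at hB
  obtain rfl := eq_zero_of_mem_baseCochains r hβ (congrArg Subtype.val hB)
  exact ⟨ψ, (add_zero _).symm.trans hφ'⟩

lemma bFun_single (r : (Γ.delete j₀).CharClass → (Γ.delete j₀).Char) (k : (Γ.delete j₀).Char)
    (I : Finset {j : J // j ≠ j₀}) (a : Γ.Parity j₀) (x : TPlus) :
    bFun r (Pi.single (k.extendBy a, I.map (inclDelete j₀).toEmbedding) x)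
      = Pi.single (k, I) (bSign r k a • x) := by
  funext ⟨k', I'⟩
  have hterm : ∀ a', (bSign r k' a' •
      (Pi.single (k.extendBy a, I.map (inclDelete j₀).toEmbedding) x :
      Γ.Cube → TPlus) (k'.extendBy a', I'.map (inclDelete j₀).toEmbedding)) ≠ 0 →
      a' = a ∧ k' = k ∧ I' = I := by
    intro a' hne
    have heq : (k'.extendBy a', I'.map (inclDelete j₀).toEmbedding)
        = (k.extendBy a, I.map (inclDelete j₀).toEmbedding) := by
      by_contra h
      exact hne (by rw [Pi.single_eq_of_ne (M := fun _ => TPlus) h, smul_zero])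
    obtain ⟨hk, hI⟩ := Prod.mk.inj heq
    obtain ⟨hk, ha⟩ := Prod.mk.inj
      (Char.extendBy_injective (a₁ := (k', a')) (a₂ := (k, a)) hk)
    exact ⟨ha, hk, Finset.map_injective _ hI⟩
  rw [bFun, finsum_eq_single _ a fun a' ha' => by_contra fun hne => ha' (hterm a' hne).1]
  by_cases hc : k' = k ∧ I' = I
  · obtain ⟨rfl, rfl⟩ := hc
    rw [Pi.single_eq_same, Pi.single_eq_same]
  · rw [Pi.single_eq_of_ne (M := fun _ => TPlus) fun h => hc (Prod.mk.inj h)]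
    exact by_contra fun hne => hc (hterm a hne).2

lemma bHom_surjective (r : (Γ.delete j₀).CharClass → (Γ.delete j₀).Char) (q : ℕ) :
    Function.Surjective (bHom r q) := by
  intro θ
  suffices θ.1 ∈ LinearMap.range (((Γ.delete j₀).cochains q).subtype ∘ₗ bHom r q) from
    this.imp fun φ hφ => Subtype.ext hφ
  refine mem_of_single_mem θ.2.1 fun ⟨k, I⟩ hc => ?_
  set a : Γ.Parity j₀ := ⟨Γ.e j₀, rfl⟩
  refine ⟨⟨_, single_mem_cochains (c := (k.extendBy a, I.map (inclDelete j₀).toEmbedding))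
    ((Finset.card_map _).trans (θ.2.2 _ hc)) (bSign r k a • θ.1 (k, I))⟩, ?_⟩
  exact (bFun_single r k I a _).trans (by rw [bSign_smul_bSign_smul]; rfl)

/-! ### Weights of extensions -/

lemma delete_matQ_mulVec {y : J → ℚ} (hy : y j₀ = 0) :
    (Γ.delete j₀).matQ.mulVec (fun j => y j) =
      fun i : {j : J // j ≠ j₀} => Γ.matQ.mulVec y i := by
  funext i
  refine Eq.trans ?_ (dotProduct_subtype_ne _ hy)
  refine congrArg (· ⬝ᵥ fun j : {j : J // j ≠ j₀} => y j) (funext fun j => ?_)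
  rw [matQ, matQ, Matrix.map_apply, Matrix.map_apply, delete_mat]

variable (Γ j₀) in
/-- The coordinates of `-E_{j₀}^*` in the basis `E_j`. Its `j₀`-th coordinate is `(E_{j₀}^*)²`. -/
def dualVec : J → ℚ := Γ.matQ⁻¹.mulVec (Pi.single j₀ 1)

lemma matQ_mulVec_dualVec (hΓ : Γ.Nondegenerate) :
    Γ.matQ.mulVec (Γ.dualVec j₀) = Pi.single j₀ 1 := by
  rw [dualVec, Matrix.mulVec_mulVec, Matrix.mul_nonsing_inv _ (isUnit_iff_ne_zero.mpr hΓ),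
    Matrix.one_mulVec]

lemma NegDef.dualVec_mem_Ioo (h : (Γ.incr j₀).NegDef) : Γ.dualVec j₀ j₀ ∈ Set.Ioo (-1 : ℚ) 0 := by
  have hM := matQ_mulVec_dualVec (j₀ := j₀) h.of_incr.nondegenerate
  have hne : Γ.dualVec j₀ ≠ 0 := fun h0 => by simpa [h0] using congrFun hM j₀
  have hincr : (Γ.incr j₀).matQ.mulVec (Γ.dualVec j₀) = Pi.single j₀ (1 + Γ.dualVec j₀ j₀) := by
    funext i
    rw [incr_matQ_mulVec, hM]
    rcases eq_or_ne i j₀ with rfl | hi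
    · simp
    · simp [hi]
  have hneg := h _ hne
  rw [hincr, dotProduct_single] at hneg
  constructor <;> nlinarith

/-- The coordinates of `-k` in the basis `E_j`. -/
def Char.coords (k : Γ.Char) : J → ℚ := Γ.matQ⁻¹.mulVec fun j => (k.1 j : ℚ)

lemma Char.matQ_mulVec_coords (hΓ : Γ.Nondegenerate) (k : Γ.Char) :
    Γ.matQ.mulVec k.coords = fun j => (k.1 j : ℚ) := by
  rw [coords, Matrix.mulVec_mulVec, Matrix.mul_nonsing_inv _ (isUnit_iff_ne_zero.mpr hΓ),
    Matrix.one_mulVec]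

lemma Char.coords_eq (hΓ : Γ.Nondegenerate) {k : Γ.Char} {u : J → ℚ}
    (hu : Γ.matQ.mulVec u = fun j => (k.1 j : ℚ)) : k.coords = u := by
  rw [coords, ← hu, Matrix.mulVec_mulVec, Matrix.nonsing_inv_mul _ (isUnit_iff_ne_zero.mpr hΓ),
    Matrix.one_mulVec]

lemma Char.dotProduct_dualVec (hΓ : Γ.Nondegenerate) (k : Γ.Char) :
    (fun j => (k.1 j : ℚ)) ⬝ᵥ Γ.dualVec j₀ = k.coords j₀ := by
  rw [← k.matQ_mulVec_coords hΓ, dotProduct_comm, Matrix.dotProduct_mulVec,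
    ← Matrix.mulVec_transpose, matQ_transpose, matQ_mulVec_dualVec hΓ, single_dotProduct, one_mul]

variable (j₀) in
/-- The number `(k, E_{j₀}^*) / (E_{j₀}^*)²`, the coefficient of the orthogonal projection of `k` to
the line spanned by `E_{j₀}^*`. -/
def Char.slope (k : Γ.Char) : ℚ := k.coords j₀ / Γ.dualVec j₀ j₀

lemma Char.slope_shift (hΓ : Γ.Nondegenerate) (k : Γ.Char) (l : J → ℤ) :
    (k.shift l).slope j₀ = k.slope j₀ - 2 * l j₀ / Γ.dualVec j₀ j₀ := by
  have hcoords : (k.shift l).coords = k.coords - (2 : ℚ) • fun j => (l j : ℚ) := by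
    refine coords_eq hΓ ?_
    rw [Matrix.mulVec_sub, Matrix.mulVec_smul, matQ_mul_cast, k.matQ_mulVec_coords hΓ]
    funext j
    simp only [shift_apply, Pi.sub_apply, Pi.smul_apply, smul_eq_mul]
    push_cast
    ring
  rw [slope, slope, hcoords, Pi.sub_apply, Pi.smul_apply, smul_eq_mul]
  ring

lemma Char.slope_extendBy (hΓ : Γ.Nondegenerate) (hp : Γ.dualVec j₀ j₀ ≠ 0)
    (k : (Γ.delete j₀).Char) (a a' : Γ.Parity j₀) :
    (k.extendBy a').slope j₀ = (k.extendBy a).slope j₀ + (a'.1 - a.1) := by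
  have hcoords : (k.extendBy a').coords
      = (k.extendBy a).coords + ((a'.1 : ℚ) - a.1) • Γ.dualVec j₀ := by
    refine coords_eq hΓ ?_
    rw [Matrix.mulVec_add, Matrix.mulVec_smul, matQ_mulVec_dualVec hΓ, matQ_mulVec_coords hΓ]
    funext j
    rcases eq_or_ne j j₀ with rfl | hj
    · simp [extendBy_self]
    · have hext := fun b => extendBy_coe k b ⟨j, hj⟩
      simp only at hext
      simp [hext, hj]
  rw [slope, slope, hcoords, Pi.add_apply, Pi.smul_apply, smul_eq_mul]
  field_simp

lemma dualForm_extendBy (hΓ : Γ.Nondegenerate) (hdel : (Γ.delete j₀).Nondegenerate)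
    (hp : Γ.dualVec j₀ j₀ ≠ 0) (k : (Γ.delete j₀).Char) (a : Γ.Parity j₀) :
    Γ.dualForm (k.extendBy a).1 (k.extendBy a).1 = (Γ.delete j₀).dualForm k.1 k.1
      + Γ.dualVec j₀ j₀ * (k.extendBy a).slope j₀ ^ 2 := by
  set K := k.extendBy a
  set y : J → ℚ := K.coords - K.slope j₀ • Γ.dualVec j₀ with hy
  have hslope : K.slope j₀ * Γ.dualVec j₀ j₀ = K.coords j₀ := div_mul_cancel₀ _ hp
  have hy0 : y j₀ = 0 := by rw [hy, Pi.sub_apply, Pi.smul_apply, smul_eq_mul, hslope, sub_self]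
  have hKk : (fun j : {j : J // j ≠ j₀} => (K.1 j : ℚ)) = fun j => (k.1 j : ℚ) :=
    funext fun j => congrArg Int.cast (k.extendBy_coe a j)
  have hMy : (Γ.delete j₀).matQ.mulVec (fun j => y j) = fun j => (k.1 j : ℚ) := by
    rw [delete_matQ_mulVec hy0, ← hKk, hy, Matrix.mulVec_sub, Matrix.mulVec_smul,
      matQ_mulVec_dualVec hΓ, K.matQ_mulVec_coords hΓ]
    funext i
    simp [i.2]
  rw [(Γ.delete j₀).dualForm_eq hdel _ _ _ hMy, ← hKk,
    dotProduct_subtype_ne (fun j => (K.1 j : ℚ)) hy0, hy,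
    dotProduct_sub, dotProduct_smul, K.dotProduct_dualVec hΓ, ← hslope, smul_eq_mul,
    Γ.dualForm_eq hΓ _ _ _ (K.matQ_mulVec_coords hΓ)]
  ring

lemma w_extendBy (hΓ : Γ.Nondegenerate) (hdel : (Γ.delete j₀).Nondegenerate)
    (hp : Γ.dualVec j₀ j₀ ≠ 0) (k : (Γ.delete j₀).Char) (a : Γ.Parity j₀) :
    Γ.w (k.extendBy a) = (Γ.delete j₀).w k
      - (Γ.dualVec j₀ j₀ * (k.extendBy a).slope j₀ ^ 2 + 1) / 8 := by
  have hcard : (Fintype.card J : ℚ) = 1 + Fintype.card {j : J // j ≠ j₀} := by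
    have := Fintype.sum_eq_add_sum_subtype_ne (fun _ => (1 : ℚ)) j₀
    simpa only [Finset.sum_const, nsmul_one, Finset.card_univ] using this
  rw [w, w, dualForm_extendBy hΓ hdel hp, hcard]
  ring

lemma NegDef.neg_card_le_w (h : Γ.NegDef) (k : Γ.Char) : -(Fintype.card J : ℚ) / 8 ≤ Γ.w k := by
  have hM := k.matQ_mulVec_coords h.nondegenerate
  have hnonpos : Γ.dualForm k.1 k.1 ≤ 0 := by
    rw [Γ.dualForm_eq h.nondegenerate _ _ _ hM, ← hM, dotProduct_comm]
    rcases eq_or_ne k.coords 0 with h0 | h0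
    · simp [h0]
    · exact (h _ h0).le
  rw [w]
  linarith

lemma Char.exists_abs_slope_le_one (hΓ : Γ.Nondegenerate) (hp : Γ.dualVec j₀ j₀ ≠ 0)
    (k : (Γ.delete j₀).Char) : ∃ a : Γ.Parity j₀, |(k.extendBy a).slope j₀| ≤ 1 := by
  set a₀ : Γ.Parity j₀ := ⟨Γ.e j₀, rfl⟩
  set s := (k.extendBy a₀).slope j₀
  refine ⟨parityShift (round (s / 2)) a₀, ?_⟩
  have hshift : (parityShift (round (s / 2)) a₀ : Γ.Parity j₀).1 = a₀.1 - 2 * round (s / 2) := rfl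
  have hround := abs_sub_round (s / 2)
  rw [slope_extendBy hΓ hp k a₀, hshift]
  rw [abs_le] at hround ⊢
  push_cast
  constructor <;> linarith

/-! ### Lifting the canonical submodule -/

lemma charClass_shift (k : Γ.Char) (l : J → ℤ) : Γ.charClass (k.shift l) = Γ.charClass k :=
  Quotient.sound (s := Γ.charSetoid) (Setoid.symm' _ ⟨_, rfl⟩)

lemma exists_eq_shift {k k' : Γ.Char} (h : Γ.charClass k = Γ.charClass k') :
    ∃ l, k' = k.shift l :=
  Quotient.exact (s := Γ.charSetoid) h

lemma Char.extendBy_shift_extend (k : (Γ.delete j₀).Char) (a : Γ.Parity j₀)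
    (l : {j : J // j ≠ j₀} → ℤ) :
    (k.extendBy a).shift (Function.extend (inclDelete j₀) l 0) = (k.shift l).extendBy
      (parityShift (Γ.mat.mulVec (Function.extend (inclDelete j₀) l 0) j₀) a) := by
  set a' := parityShift (Γ.mat.mulVec (Function.extend (inclDelete j₀) l 0) j₀) a with ha'
  apply Char.ext
  ext j
  rcases eq_or_ne j j₀ with rfl | hj
  · rw [extendBy_self, shift_apply, extendBy_self]
    rfl
  · have hshift := extendBy_coe (k.shift l) a' ⟨j, hj⟩
    have hext := extendBy_coe k a ⟨j, hj⟩
    have hmul := mulVec_extend (f := inclDelete j₀) (Γ.delete_mat j₀) l ⟨j, hj⟩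
    simp only [OrderEmbedding.subtype_apply] at hshift hext hmul
    rw [hshift, shift_apply, shift_apply, hext, hmul]

lemma restrictE_apply (j : {j : J // j ≠ j₀}) : restrictE Γ j₀ j = -Γ.mat j₀ j := by
  have hE : E {j₀} = Pi.single j₀ 1 := by
    ext m
    simp [E, Pi.single_apply]
  rw [restrictE, toDual, hE, Matrix.mulVec_single_one, Pi.neg_apply, mat_symm]
  rfl

lemma dualForm_toDual_restrictE (hdel : (Γ.delete j₀).Nondegenerate)
    (l : {j : J // j ≠ j₀} → ℤ) : (Γ.delete j₀).dualForm ((Γ.delete j₀).toDual l) (restrictE Γ j₀)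
      = Γ.mat.mulVec (Function.extend (inclDelete j₀) l 0) j₀ := by
  have hl : l = fun j : {j : J // j ≠ j₀} => Function.extend (inclDelete j₀) l 0 j :=
    funext fun j => (extend_map (f := inclDelete j₀) l j).symm
  have hR : restrictE Γ j₀ = fun j : {j : J // j ≠ j₀} => (-Γ.mat j₀) j :=
    funext restrictE_apply
  have hdot : restrictE Γ j₀ ⬝ᵥ l = -Γ.mat.mulVec (Function.extend (inclDelete j₀) l 0) j₀ := by
    conv_lhs => rw [hl, hR]
    rw [dotProduct_subtype_ne _ (extend_inclDelete_self l), neg_dotProduct]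
    rfl
  rw [dualForm_comm, dualForm_toDual _ hdel, hdot]
  push_cast
  ring

lemma bSign_shift_extend (hdel : (Γ.delete j₀).Nondegenerate)
    (r : (Γ.delete j₀).CharClass → (Γ.delete j₀).Char) (k : (Γ.delete j₀).Char)
    (a : Γ.Parity j₀) (l : {j : J // j ≠ j₀} → ℤ) :
    bSign r (k.shift l) (parityShift (Γ.mat.mulVec (Function.extend (inclDelete j₀) l 0) j₀) a)
      = bSign r k a := by
  rw [bSign, bSign, signExponent, signExponent, charClass_shift, Char.shift_val,
    add_sub_right_comm, dualForm_add_left, two_smul, dualForm_add_left,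
    dualForm_toDual_restrictE hdel]
  simp only [parityShift, Equiv.coe_fn_mk]
  congr 4
  push_cast
  ring

lemma NegDef.exists_sub_minWeight_eq_natCast (h : Γ.NegDef) (k : Γ.Char) :
    ∃ n : ℕ, Γ.w k - h.minWeight (Γ.charClass k) = n := by
  obtain ⟨n, hn⟩ := h.sub_minWeight_int k
  have hnonneg := sub_nonneg.mpr (h.minWeight_le k)
  rw [hn] at hnonneg
  lift n to ℕ using by exact_mod_cast hnonneg
  exact ⟨n, by simpa using hn⟩

/-- An element of minimal weight in a class. -/
def NegDef.minRep (h : Γ.NegDef) (c : Γ.CharClass) : Γ.Char := (h.minWeight_isLeast c).1.choose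

lemma NegDef.charClass_minRep (h : Γ.NegDef) (c : Γ.CharClass) : Γ.charClass (h.minRep c) = c :=
  (h.minWeight_isLeast c).1.choose_spec.1

lemma NegDef.w_minRep (h : Γ.NegDef) (c : Γ.CharClass) : Γ.w (h.minRep c) = h.minWeight c :=
  (h.minWeight_isLeast c).1.choose_spec.2

/-- The contribution of the extension `k + a E_{j₀}^*` of `k` to the value at `k` of `B̄⁰` on the
element of `𝕋(Γ)` with coordinates `x`. -/
def bTerm (hN : Γ.NegDef) (r : (Γ.delete j₀).CharClass → (Γ.delete j₀).Char)
    (x : Γ.CharClass →₀ TPlus) (k : (Γ.delete j₀).Char) (a : Γ.Parity j₀) : TPlus :=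
  bSign r k a • uPow (Γ.w (k.extendBy a) - hN.minWeight (Γ.charClass (k.extendBy a))) •
    x (Γ.charClass (k.extendBy a))

section CanonicalSubmodule

variable (hN : Γ.NegDef) (r : (Γ.delete j₀).CharClass → (Γ.delete j₀).Char)

lemma bFun_augmentationFun (x : Γ.CharClass →₀ TPlus) (k : (Γ.delete j₀).Char) :
    bFun r (hN.augmentationFun x) (k, ∅) = ∑ᶠ a : Γ.Parity j₀, bTerm hN r x k a := by
  simp [bFun, bTerm, NegDef.augmentationFun]

lemma finite_support_bTerm (x : Γ.CharClass →₀ TPlus) (k : (Γ.delete j₀).Char) :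
    (Function.support fun a : Γ.Parity j₀ => bTerm hN r x k a).Finite := by
  refine finite_support_smul ?_ _
  simpa [NegDef.augmentationFun] using finite_extendBy (hN.augmentationFun_mem x).1 k ∅

lemma bTerm_shift_extend (x : Γ.CharClass →₀ TPlus) {k : (Γ.delete j₀).Char} (a : Γ.Parity j₀)
    {l : {j : J // j ≠ j₀} → ℤ} (hk : (Γ.delete j₀).w k ≤ (Γ.delete j₀).w (k.shift l)) :
    bTerm hN r x (k.shift l)
        (parityShift (Γ.mat.mulVec (Function.extend (inclDelete j₀) l 0) j₀) a)
      = uPow ((Γ.delete j₀).w (k.shift l) - (Γ.delete j₀).w k) • bTerm hN r x k a := by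
  have hw := w_shift_extend hN.nondegenerate hN.delete.nondegenerate (f := inclDelete j₀)
    (Γ.delete_mat j₀) (k.extendBy a) k (k.extendBy_coe a) l
  rw [bTerm, bTerm, bSign_shift_extend hN.delete.nondegenerate, ← Char.extendBy_shift_extend,
    charClass_shift, smul_comm (uPow ((Γ.delete j₀).w (k.shift l) - (Γ.delete j₀).w k))
      (bSign r k a), smul_smul, uPow_mul (sub_nonneg.mpr hk) (sub_nonneg.mpr (hN.minWeight_le _))
      ((Γ.delete j₀).w_shift_sub_int k l) (hN.sub_minWeight_int _), hw]
  congr 3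
  ring

lemma bFun_augmentationFun_shift (x : Γ.CharClass →₀ TPlus) {k : (Γ.delete j₀).Char}
    {l : {j : J // j ≠ j₀} → ℤ} (hk : (Γ.delete j₀).w k ≤ (Γ.delete j₀).w (k.shift l)) :
    bFun r (hN.augmentationFun x) (k.shift l, ∅)
      = uPow ((Γ.delete j₀).w (k.shift l) - (Γ.delete j₀).w k) •
        bFun r (hN.augmentationFun x) (k, ∅) := by
  rw [bFun_augmentationFun, bFun_augmentationFun, smul_finsum' _ (finite_support_bTerm hN r x k),
    ← finsum_comp_equiv (parityShift (Γ.mat.mulVec (Function.extend (inclDelete j₀) l 0) j₀))]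
  exact finsum_congr fun a => bTerm_shift_extend hN r x a hk

lemma exists_bFun_augmentationFun_eq (x : Γ.CharClass →₀ TPlus) :
    ∃ z : (Γ.delete j₀).CharClass →₀ TPlus,
      bFun r (hN.augmentationFun x) = hN.delete.augmentationFun z ∧
        ∀ c, z c = ∑ᶠ a : Γ.Parity j₀, bTerm hN r x (hN.delete.minRep c) a := by
  have hd : (Γ.delete j₀).NegDef := hN.delete
  have hmem := bFun_mem r (hN.augmentationFun_mem x)
  refine ⟨Finsupp.ofSupportFinite (fun c => bFun r (hN.augmentationFun x) (hd.minRep c, ∅)) ?_,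
    ?_, fun c => bFun_augmentationFun hN r x _⟩
  · refine (hmem.1.image fun c => (Γ.delete j₀).charClass c.1).subset fun c hc => ?_
    exact ⟨(hd.minRep c, ∅), hc, hd.charClass_minRep c⟩
  · ext ⟨k, I⟩
    rcases eq_or_ne I ∅ with rfl | hI
    · obtain ⟨l, hl⟩ := exists_eq_shift (hd.charClass_minRep ((Γ.delete j₀).charClass k))
      have hle := hd.minWeight_le k
      rw [← hd.w_minRep] at hle
      have hshift := bFun_augmentationFun_shift hN r x (l := l) (by rwa [← hl])
      rw [← hl, hd.w_minRep] at hshift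
      simp only [NegDef.augmentationFun, LinearMap.coe_mk, AddHom.coe_mk, if_true] at hshift ⊢
      exact hshift
    · rw [(Γ.delete j₀).cochains_apply_eq_zero hmem (by simpa using hI)]
      simp [NegDef.augmentationFun, hI]

/-- The elements whose image in `𝕋(Γ∖j₀)` is represented by the image under `B̄⁰` of a cocycle. -/
def liftable : Submodule ℤ[X] ((Γ.delete j₀).CharClass →₀ TPlus) :=
  ((LinearMap.ker (Γ.deltaHom 0)).map (bHom r 0)).comap hN.delete.augmentation

lemma mem_liftable_of_bFun_augmentationFun {x : Γ.CharClass →₀ TPlus}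
    {z : (Γ.delete j₀).CharClass →₀ TPlus}
    (hz : bFun r (hN.augmentationFun x) = hN.delete.augmentationFun z) : z ∈ liftable hN r :=
  ⟨hN.augmentation x, Subtype.ext (hN.delta_augmentationFun x), Subtype.ext hz⟩

variable {r} in
lemma bTerm_single_of_eq {C : Γ.CharClass} (y : TPlus) {k : (Γ.delete j₀).Char} {a : Γ.Parity j₀}
    {n : ℕ} (hC : Γ.charClass (k.extendBy a) = C)
    (hn : Γ.w (k.extendBy a) - hN.minWeight C = n) :
    bTerm hN r (Finsupp.single C y) k a = bSign r k a • (X ^ n : ℤ[X]) • y := by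
  rw [bTerm, hC, hn, uPow_natCast, Finsupp.single_eq_same]

variable {r} in
lemma bTerm_single_of_ne {C : Γ.CharClass} (y : TPlus) {k : (Γ.delete j₀).Char} {a : Γ.Parity j₀}
    (hC : Γ.charClass (k.extendBy a) ≠ C) : bTerm hN r (Finsupp.single C y) k a = 0 := by
  rw [bTerm, Finsupp.single_eq_of_ne hC, smul_zero, smul_zero]

end CanonicalSubmodule

lemma Char.eq_shift_of_extendBy_eq {k k' : (Γ.delete j₀).Char} {a a' : Γ.Parity j₀} {l : J → ℤ}
    (hl : l j₀ = 0) (h : k'.extendBy a' = (k.extendBy a).shift l) :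
    k' = k.shift fun j => l j := by
  have hext : l = Function.extend (inclDelete j₀) (fun j : {j : J // j ≠ j₀} => l j) 0 := by
    ext j
    rcases eq_or_ne j j₀ with rfl | hj
    · rw [hl, extend_inclDelete_self]
    · exact (extend_map (f := inclDelete j₀) (fun j : {j : J // j ≠ j₀} => l j) ⟨j, hj⟩).symm
  rw [hext, extendBy_shift_extend] at h
  exact congrArg Prod.fst (Char.extendBy_injective (a₁ := (k', a')) (a₂ := (k.shift _, _)) h)

variable (Γ j₀) in
/-- The least excess of weight caused by moving away from an extension of slope in `[-1, 1]`. -/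
def gap : ℚ := (-(Γ.dualVec j₀ j₀)⁻¹ - 1) / 2

lemma NegDef.gap_pos (h : (Γ.incr j₀).NegDef) : 0 < Γ.gap j₀ := by
  obtain ⟨hp1, hp0⟩ := h.dualVec_mem_Ioo
  rw [gap, ← inv_neg]
  have hinv : 1 < (-Γ.dualVec j₀ j₀)⁻¹ := (one_lt_inv₀ (by linarith)).mpr (by linarith)
  linarith

lemma NegDef.gap_le_w_extendBy_sub (h : (Γ.incr j₀).NegDef) {k k' : (Γ.delete j₀).Char}
    {a a' : Γ.Parity j₀} {l : J → ℤ} (ha : |(k.extendBy a).slope j₀| ≤ 1) (hl : l j₀ ≠ 0)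
    (hkk : k'.extendBy a' = (k.extendBy a).shift l) :
    (Γ.delete j₀).w k' - (Γ.delete j₀).w k + Γ.gap j₀
      ≤ Γ.w (k'.extendBy a') - Γ.w (k.extendBy a) := by
  have hΓ := h.of_incr.nondegenerate
  have hdel := (h.of_incr.delete (j₀ := j₀)).nondegenerate
  have hp := h.dualVec_mem_Ioo
  have hn : 1 ≤ |(l j₀ : ℚ)| := by exact_mod_cast Int.one_le_abs hl
  have hquad := mul_sub_sq_sub_mul_sq_le hp ha hn
  rw [w_extendBy hΓ hdel hp.2.ne, w_extendBy hΓ hdel hp.2.ne, hkk, Char.slope_shift hΓ, gap]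
  linarith

lemma NegDef.eq_of_extendBy_minRep_eq_shift (h : (Γ.incr j₀).NegDef)
    {c c' : (Γ.delete j₀).CharClass} {a a' : Γ.Parity j₀} {l : J → ℤ} (hl : l j₀ = 0)
    (heq : (h.of_incr.delete.minRep c').extendBy a'
      = ((h.of_incr.delete.minRep c).extendBy a).shift l) : (c', a') = (c, a) := by
  have hΓ := h.of_incr.nondegenerate
  obtain rfl : c' = c := by
    rw [← h.of_incr.delete.charClass_minRep c', Char.eq_shift_of_extendBy_eq hl heq,
      charClass_shift, h.of_incr.delete.charClass_minRep]
  have hslope := Char.slope_extendBy hΓ h.dualVec_mem_Ioo.2.ne (h.of_incr.delete.minRep c') a a'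
  rw [heq, Char.slope_shift hΓ, hl, Int.cast_zero, mul_zero, zero_div, sub_zero,
    left_eq_add, sub_eq_zero, Int.cast_inj] at hslope
  exact Prod.ext rfl (Subtype.ext hslope)

lemma NegDef.minWeight_add_gap_le (h : (Γ.incr j₀).NegDef) {c c' : (Γ.delete j₀).CharClass}
    {a a' : Γ.Parity j₀} (ha : |((h.of_incr.delete.minRep c).extendBy a).slope j₀| ≤ 1)
    (hne : (c', a') ≠ (c, a))
    (hcl : Γ.charClass ((h.of_incr.delete.minRep c').extendBy a')
      = Γ.charClass ((h.of_incr.delete.minRep c).extendBy a)) :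
    h.of_incr.delete.minWeight c' + Γ.gap j₀ ≤ h.of_incr.delete.minWeight c
      + (Γ.w ((h.of_incr.delete.minRep c').extendBy a')
        - Γ.w ((h.of_incr.delete.minRep c).extendBy a)) := by
  obtain ⟨l, hl⟩ := exists_eq_shift hcl.symm
  have hgap := h.gap_le_w_extendBy_sub ha (fun hl0 => hne (h.eq_of_extendBy_minRep_eq_shift hl0 hl))
    hl
  rw [h.of_incr.delete.w_minRep, h.of_incr.delete.w_minRep] at hgap
  linarith

/-- Every `x` annihilated by `U^N` lifts from the summand of the class `c`, as soon as
`N + min_c w ≤ L`. -/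
def LiftsUpTo (hN : Γ.NegDef) (r : (Γ.delete j₀).CharClass → (Γ.delete j₀).Char) (L : ℚ) : Prop :=
  ∀ (c : (Γ.delete j₀).CharClass) (N : ℕ) (x : TPlus), N + hN.delete.minWeight c ≤ L →
    (X ^ N : ℤ[X]) • x = 0 → Finsupp.single c x ∈ liftable hN r

section LiftsUpTo

variable (h : (Γ.incr j₀).NegDef) {r : (Γ.delete j₀).CharClass → (Γ.delete j₀).Char} {L : ℚ}

lemma LiftsUpTo.single_bTerm_mem_liftable (hL : LiftsUpTo h.of_incr r L)
    {c c' : (Γ.delete j₀).CharClass} {a a' : Γ.Parity j₀} {K : Γ.Char}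
    (hK : (h.of_incr.delete.minRep c).extendBy a = K) (ha : |K.slope j₀| ≤ 1)
    (hne : (c', a') ≠ (c, a)) {M : ℕ} {y : TPlus} (hy : (X ^ M : ℤ[X]) • y = 0)
    (hM : M + h.of_incr.delete.minWeight c
      ≤ L + Γ.gap j₀ + (Γ.w K - h.of_incr.minWeight (Γ.charClass K))) :
    Finsupp.single c' (bTerm h.of_incr r (Finsupp.single (Γ.charClass K) y)
      (h.of_incr.delete.minRep c') a') ∈ liftable h.of_incr r := by
  subst hK
  set K := (h.of_incr.delete.minRep c).extendBy a
  set K' := (h.of_incr.delete.minRep c').extendBy a'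
  by_cases hcl : Γ.charClass K' = Γ.charClass K
  swap
  · rw [bTerm_single_of_ne _ _ hcl, Finsupp.single_zero]
    exact zero_mem _
  obtain ⟨n, hn⟩ := h.of_incr.exists_sub_minWeight_eq_natCast K'
  rw [hcl] at hn
  rw [bTerm_single_of_eq _ _ hcl hn]
  rcases le_total M n with hMn | hnM
  · rw [pow_smul_eq_zero_of_le hy hMn, smul_zero, Finsupp.single_zero]
    exact zero_mem _
  · refine hL c' (M - n) _ ?_ ?_
    · have hgap := h.minWeight_add_gap_le ha hne hcl
      rw [Nat.cast_sub hnM]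
      linarith
    · rw [smul_comm, smul_smul, ← pow_add, Nat.sub_add_cancel hnM, hy, smul_zero]

/- For the extension `K = k + aE_{j₀}^*` of slope in `[-1, 1]` of the minimal `k` in the class `c`,
some element of `𝕋(Γ)` over `[K]` is mapped by `B̄⁰` to `x` in the class `c` up to terms of lower
level. -/
lemma LiftsUpTo.add_gap (hL : LiftsUpTo h.of_incr r L) :
    LiftsUpTo h.of_incr r (L + Γ.gap j₀) := by
  intro c N x hN hx
  obtain ⟨a, ha⟩ := (h.of_incr.delete.minRep c).exists_abs_slope_le_one h.of_incr.nondegenerate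
    h.dualVec_mem_Ioo.2.ne
  set K := (h.of_incr.delete.minRep c).extendBy a with hK
  obtain ⟨n, hn⟩ := h.of_incr.exists_sub_minWeight_eq_natCast K
  obtain ⟨y, hy : (X ^ n : ℤ[X]) • y = _⟩ :=
    TPlus.pow_smul_surjective n (bSign r (h.of_incr.delete.minRep c) a • x)
  obtain ⟨z, hz, hzc⟩ := exists_bFun_augmentationFun_eq h.of_incr r
    (Finsupp.single (Γ.charClass K) y)
  have hself : bTerm h.of_incr r (Finsupp.single (Γ.charClass K) y)
      (h.of_incr.delete.minRep c) a = x := by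
    rw [bTerm_single_of_eq _ _ rfl hn, hy, smul_smul, bSign_mul_self, one_smul]
  have hother : ∀ c' a', (c', a') ≠ (c, a) → Finsupp.single c' (bTerm h.of_incr r
      (Finsupp.single (Γ.charClass K) y) (h.of_incr.delete.minRep c') a')
        ∈ liftable h.of_incr r := by
    refine fun c' a' hne => hL.single_bTerm_mem_liftable h hK.symm ha hne (M := N + n) ?_ ?_
    · rw [pow_add, mul_smul, hy, smul_comm, hx, smul_zero]
    · rw [hn]
      push_cast
      linarith
  have hdiff : z - Finsupp.single c x ∈ liftable h.of_incr r := by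
    refine mem_of_forall_single_mem fun c' => ?_
    let S := ((liftable h.of_incr r).comap (Finsupp.lsingle c')).toAddSubgroup
    change _ ∈ S
    rw [Finsupp.sub_apply, hzc]
    rcases eq_or_ne c' c with rfl | hc
    · rw [Finsupp.single_eq_same, ← hself]
      exact finsum_sub_apply_mem S (finite_support_bTerm _ r _ _) a fun a' ha' =>
        hother c' a' fun he => ha' (congrArg Prod.snd he)
    · rw [Finsupp.single_eq_of_ne hc, sub_zero]
      exact finsum_induction (· ∈ S) S.zero_mem (fun _ _ => S.add_mem) fun a' =>
        hother c' a' fun he => hc (congrArg Prod.fst he)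
  exact (Submodule.sub_mem_iff_right _ (mem_liftable_of_bFun_augmentationFun _ r hz)).mp hdiff

variable (r) in
lemma liftsUpTo_neg_card (hN : Γ.NegDef) :
    LiftsUpTo hN r (-(Fintype.card {j : J // j ≠ j₀} : ℚ) / 8) := by
  intro c N x hN' hx
  have hmin := hN.delete.neg_card_le_w (hN.delete.minRep c)
  rw [hN.delete.w_minRep] at hmin
  obtain rfl : N = 0 := by
    have : (N : ℚ) ≤ 0 := by linarith
    exact_mod_cast this.antisymm N.cast_nonneg
  rw [pow_zero, one_smul] at hx
  rw [hx, Finsupp.single_zero]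
  exact zero_mem _

variable (r) in
lemma liftable_eq_top : liftable h.of_incr r = ⊤ := by
  have hlevels : ∀ m : ℕ, LiftsUpTo h.of_incr r
      (-(Fintype.card {j : J // j ≠ j₀} : ℚ) / 8 + m * Γ.gap j₀) := by
    intro m
    induction m with
    | zero => simpa using liftsUpTo_neg_card r h.of_incr
    | succ m ih =>
      rw [Nat.cast_succ, add_one_mul, ← add_assoc]
      exact ih.add_gap h
  refine eq_top_iff.mpr fun x _ => mem_of_forall_single_mem fun c => ?_
  obtain ⟨N, hN⟩ := TPlus.exists_pow_smul_eq_zero (x c)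
  obtain ⟨m, hm⟩ := exists_nat_ge ((N + h.of_incr.delete.minWeight c
    - -(Fintype.card {j : J // j ≠ j₀} : ℚ) / 8) / Γ.gap j₀)
  rw [div_le_iff₀ h.gap_pos, sub_le_iff_le_add'] at hm
  exact hlevels m c N _ hm hN

variable (r) in
lemma exists_cocycle_bHom_eq_augmentation (x : (Γ.delete j₀).CharClass →₀ TPlus) :
    ∃ φ : Γ.cochains 0, Γ.delta φ.1 = 0 ∧ bHom r 0 φ = h.of_incr.delete.augmentation x := by
  obtain ⟨φ, hφ, he⟩ : x ∈ liftable h.of_incr r := liftable_eq_top h r ▸ Submodule.mem_top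
  exact ⟨φ, congrArg Subtype.val hφ, he⟩

end LiftsUpTo

lemma surgerySequence_shortExact (hΓ : Γ.Nondegenerate) (hdel : (Γ.delete j₀).Nondegenerate)
    (h : (Γ.incr j₀).Nondegenerate) (r : (Γ.delete j₀).CharClass → (Γ.delete j₀).Char) :
    (surgerySequence hΓ hdel h r).ShortExact := by
  refine HomologicalComplex.shortExact_of_degreewise_shortExact _ fun q => ?_
  have : Mono ((surgerySequence hΓ hdel h r).map (HomologicalComplex.eval _ _ q)).f :=
    (ModuleCat.mono_iff_injective _).mpr (aHom_injective hΓ h q)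
  have : Epi ((surgerySequence hΓ hdel h r).map (HomologicalComplex.eval _ _ q)).g :=
    (ModuleCat.epi_iff_surjective _).mpr (bHom_surjective r q)
  exact ⟨(ShortComplex.moduleCat_exact_iff _).mpr fun _ hφ => ker_bHom_le_range_aHom hΓ h r q hφ⟩

lemma canonicalSubmodule_le_range_bCohomology (h : (Γ.incr j₀).NegDef)
    (r : (Γ.delete j₀).CharClass → (Γ.delete j₀).Char) :
    h.of_incr.delete.canonicalSubmodule ≤ LinearMap.range
      (bCohomology h.of_incr.nondegenerate h.of_incr.delete.nondegenerate r 0).hom := by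
  rintro _ ⟨x, rfl⟩
  obtain ⟨φ, hφ, hb⟩ := exists_cocycle_bHom_eq_augmentation h r x
  have hd : Γ.cochainComplex.d 0 1 φ = 0 := by
    rw [Γ.cochainComplex_d 0]
    exact Subtype.ext hφ
  refine homologyπ_mem_range_homologyMap (bMap _ _ r) 1 (by simp) hd ?_
  refine Eq.trans ?_ hb.symm
  exact ConcreteCategory.congr_hom (HomologicalComplex.liftCycles_i _ _ 1 (by simp)
    h.of_incr.delete.augmentation_d) x

end PlumbingGraph

end

theorem theorem6p2 {J : Type*} [Fintype J] [LinearOrder J] (Γ : PlumbingGraph J) (j₀ : J)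
    (h : (Γ.incr j₀).NegDef)
    (r : (Γ.delete j₀).CharClass → (Γ.delete j₀).Char)
    (hr : ∀ c : (Γ.delete j₀).CharClass, (Γ.delete j₀).charClass (r c) = c) :
    ∃ hS : (PlumbingGraph.surgerySequence h.of_incr.nondegenerate
        h.of_incr.delete.nondegenerate h.nondegenerate r).ShortExact,
      h.of_incr.delete.canonicalSubmodule ≤
          LinearMap.range (PlumbingGraph.bCohomology h.of_incr.nondegenerate
            h.of_incr.delete.nondegenerate r 0).hom ∧
        h.of_incr.delete.canonicalSubmodule ≤
          LinearMap.ker (PlumbingGraph.cCohomology hS 0).hom := by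
  have hS := PlumbingGraph.surgerySequence_shortExact h.of_incr.nondegenerate
    h.of_incr.delete.nondegenerate h.nondegenerate r
  have hB := PlumbingGraph.canonicalSubmodule_le_range_bCohomology h r
  refine ⟨hS, hB, hB.trans ?_⟩
  rintro _ ⟨x, rfl⟩
  exact ConcreteCategory.congr_hom (hS.comp_δ 0 1 rfl) x
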